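/- Let $d\ge 1$. For $f\in L^1(\mathbb R^d)$ put $\hat f(\xi)=\int_{\mathbb R^d}e^{-ix\cdot\xi}f(x)\,dx$, and for $k\ge 0$ let $L^1_k$ be the space of measurable $f:\mathbb R^d\to\mathbb R$ with $\|f\|_{L^1_k}=\int_{\mathbb R^d}(1+|x|^2)^{k/2}|f(x)|\,dx<\infty$. Let $(J^s)_{s\in(1/2,1)}$ be a family of probability densities on $\mathbb R^d$ such that, for some $p\in(1,\infty]$, $J^s\in L^1\cap L^p$ for all $s$, and: (i) $\int_{\mathbb R^d}\min\{1,|y|^2\}J^s(y)\,dy<\infty$ for all $s$; (ii) there are constants $\delta,C_0>0$, independent of $s$, with $|\hat J^s(\xi)-1+|\xi|^{2s}|\le C_0|\xi|^{2s+\delta}$ for all $s$ and all $|\xi|\le1$; (iii) there are constants $C,R>0$ and a function $\Psi\in L^1_2$ with $\int_{\mathbb R^d} x\Psi(x)\,dx=0$, all independent of $s$, with $J^s(x)\le C(1-s)|x|^{-d-2s}+\Psi(x)$ for all $s$ and almost every $x$ with $|x|\ge R$. For $\varepsilon\in(0,1]$ let $J^s_\varepsilon(x)=\varepsilon^{-d}J^s(x/\varepsilon)$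 and $T_tf(x)=e^{(d-\varepsilon^{-2s})t}f(e^tx)$. A mild solution of $$\partial_tu=\frac1{\varepsilon^{2s}}\,(J^s_\varepsilon*u-u)+\operatorname{div}(xu),\qquad u(0)=u_0\in L^1_k,\tag{DFFP}$$ is a function $u\in C([0,\infty),L^1_k)$ such that, for all $t\ge0$, $$u(t)=T_tu_0+\frac1{\varepsilon^{2s}}\int_0^tT_{t-\tau}\big[J^s_\varepsilon*u(\tau)\big]\,d\tau .$$ Then for all $t>0$ and $R_1,R_2>0$ there exists a constant $\alpha>0$ such that for every $\varepsilon\in(0,1]$, every $s\in(1/2,1)$, every $k\in[0,2s)$, every probability density $u_0\in L^1_k$ and every mild solution $u$ of (DFFP) with initial condition $u_0$, $$u(t,x)\ge\alpha\int_{B_{R_2}}u_0(y)\,dy\qquad\text{for almost every }x\in B_{R_1},$$ where $B_R$ is the open ball of radius $R$ centred at the origin. In particular $\alpha$ does not depend on $\varepsilon$, $s$, $k$ or $u_0$. -/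

import Mathlib

open MeasureTheory Set Filter Topology

noncomputable section

namespace FracFP

/-- Euclidean space `ℝ^d`. -/
abbrev E (d : ℕ) := EuclideanSpace ℝ (Fin d)

/-- The measure `⟨x⟩^k dx` on `ℝ^d`, where `⟨x⟩ = (1 + |x|^2)^(1/2)`. -/
def weightMeasure (d : ℕ) (k : ℝ) : Measure (E d) :=
  (volume : Measure (E d)).withDensity
    (fun x => ENNReal.ofReal ((1 + ‖x‖ ^ 2) ^ (k / 2)))

/-- The weighted Lebesgue space `L^1_k`, with norm `∫ ⟨x⟩^k |f(x)| dx`. -/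
abbrev L1k (d : ℕ) (k : ℝ) := Lp ℝ 1 (weightMeasure d k)

/-- Probability densities with respect to Lebesgue measure. -/
structure IsProbDensity {d : ℕ} (f : E d → ℝ) : Prop where
  integrable : Integrable f
  nonneg : ∀ᵐ x, 0 ≤ f x
  integral_eq_one : ∫ x, f x = 1

/-- The Fourier transform `∫ e^{-i x·ξ} f(x) dx`. -/
def fourierT {d : ℕ} (f : E d → ℝ) (ξ : E d) : ℂ :=
  ∫ x, Complex.exp (-Complex.I * ((inner ℝ x ξ : ℝ) : ℂ)) * (f x : ℂ)

/-- The uniform-in-`s` hypothesis on a family of kernels `(J^s)`, `1/2 < s < 1`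
(only the values of `J` at such `s` matter). -/
structure UniformKernelFamily {d : ℕ} (J : ℝ → E d → ℝ) : Prop where
  /-- Each `J^s` is a probability density. -/
  prob : ∀ s ∈ Ioo (1 / 2 : ℝ) 1, IsProbDensity (J s)
  /-- The kernels belong to `L^p` for some `p ∈ (1, ∞]`. -/
  memLp : ∃ p : ENNReal, 1 < p ∧ ∀ s ∈ Ioo (1 / 2 : ℝ) 1, MemLp (J s) p volume
  /-- Each `J^s` is the density of a Lévy measure. -/
  levy : ∀ s ∈ Ioo (1 / 2 : ℝ) 1, Integrable (fun y => min 1 (‖y‖ ^ 2) * J s y)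
  /-- Uniform low frequency expansion `1 - |ξ|^{2s} + R_s(ξ)` of the Fourier transform. -/
  low_freq : ∃ δ > (0 : ℝ), ∃ C₀ > (0 : ℝ), ∀ s ∈ Ioo (1 / 2 : ℝ) 1, ∀ ξ : E d, ‖ξ‖ ≤ 1 →
    ‖fourierT (J s) ξ - (1 - ((‖ξ‖ ^ (2 * s) : ℝ) : ℂ))‖ ≤ C₀ * ‖ξ‖ ^ (2 * s + δ)
  /-- Pointwise tail control, with `C`, `R` and `Ψ ∈ L^1_2` independent of `s`. -/
  tail : ∃ C > (0 : ℝ), ∃ R > (0 : ℝ), ∃ Ψ : E d → ℝ,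
    MemLp Ψ 1 (weightMeasure d 2) ∧ (∫ x, Ψ x • x = 0) ∧
    ∀ s ∈ Ioo (1 / 2 : ℝ) 1, ∀ᵐ x : E d, R ≤ ‖x‖ →
      J s x ≤ C * (1 - s) * ‖x‖ ^ (-(d : ℝ) - 2 * s) + Ψ x

/-- The rescaled kernel `J_ε(x) = ε^{-d} J(x/ε)`. -/
def scaledKernel {d : ℕ} (ε : ℝ) (J : E d → ℝ) (x : E d) : ℝ :=
  (ε ^ d)⁻¹ * J (ε⁻¹ • x)

/-- The convolution `(f * g)(x) = ∫ f(y) g(x - y) dy`. -/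
def conv {d : ℕ} (f g : E d → ℝ) (x : E d) : ℝ :=
  ∫ y, f y * g (x - y)

/-- The semigroup `T_t f(x) = e^{(d - 1/ε^{2s}) t} f(e^t x)` of
`∂_t u = div(x u) - ε^{-2s} u`. -/
def transport {d : ℕ} (ε s t : ℝ) (f : E d → ℝ) (x : E d) : ℝ :=
  Real.exp (((d : ℝ) - 1 / ε ^ (2 * s)) * t) * f (Real.exp t • x)

/-- `u ∈ C([0,∞), L^1_k)` is the (global) mild solution, with initial condition `u₀`, of
`∂_t u = ε^{-2s} (J_ε * u - u) + div(x u)`; that is, for all `t ≥ 0`,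
`u(t) = T_t u₀ + ε^{-2s} ∫_0^t T_{t-τ}[J_ε * u(τ)] dτ`.
The integral is the Bochner integral in `L^1_k` of `g(τ) = T_{t-τ}[J_ε * u(τ)] ∈ L^1_k`. -/
structure IsMildSolution {d : ℕ} {k : ℝ} (ε s : ℝ) (J : E d → ℝ)
    (u₀ : L1k d k) (u : ℝ → L1k d k) : Prop where
  continuousOn : ContinuousOn u (Ici 0)
  mild : ∀ t : ℝ, 0 ≤ t → ∃ g : ℝ → L1k d k,
    (∀ τ ∈ Icc 0 t, ∀ᵐ x : E d,
      g τ x = transport ε s (t - τ) (conv (scaledKernel ε J) (u τ)) x) ∧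
    IntervalIntegrable g volume 0 t ∧
    ∀ᵐ x : E d,
      u t x = transport ε s t u₀ x + 1 / ε ^ (2 * s) * (∫ τ in (0 : ℝ)..t, g τ) x

end FracFP

end

/-!
The mild equation is solved on the Fourier side. At each frequency it is a scalar linear
Volterra equation along the characteristics `ζ ↦ e^{-r} ζ`, so the transform of `u t` equals
that of the law of `e^{-t} X₀ + Z`, where `X₀` has density `u₀` and `Z` is an independent
compound Poisson variable: jumps `ε e^{-r} ξ`, `ξ ∼ J^s`, arrive at rate `ε^{-2s} dr` for ages
`r ∈ (0, t]` (`IsMildSolution.fourierT_eq_charFun`). No positivity of `u t` is assumed: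
uniqueness of characteristic functions, applied to the positive and negative parts of `u t`,
transfers density lower bounds from that law to `u t` (`ae_le_of_fourierT_eq_charFun`). As
`e^{-t} X₀` stays in `B_{R₂}` when `X₀` does, the theorem reduces to a lower bound `c ·
Lebesgue` on a ball of radius `R₁ + R₂` for the law of `Z`, with `c` independent of `ε`, `s` and
`J^s` (`exists_compoundLaw_lower_bound`).

The law of `Z` has an atom and possibly no bounded density, so a smooth part is extracted. The
low frequency expansion makes `J^s` uniformly nondegenerate: there are finitely many sets `A i`
of probability at least `p`, such that every frequency `ζ` is transversal to one of them
(`exists_sectors`). For `ξ ∈ A i` the random age smears the jump along a segment that is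
transversal to `ζ`, which makes the transform of these jumps decay like `1 / |εζ|`. Keeping only
the configurations with more than `d` jumps from every `A i`, and at most `N` of each kind, one
obtains a measure `truncLaw` below the law of `Z` with integrable transform. Its transform is
close, in a weighted supremum norm, to that of a `2s`-stable law (`exists_trunc_sub_stable_le`):
at low frequencies by the expansion of `J^s`, at high frequencies because both are small. The
stable densities are bounded below on compact sets uniformly for `s ∈ [1/2, 1]`
(`exists_stableDensity_lower_bound`), the endpoints being included to have compactness in `s`;
Fourier inversion then gives the bound for small `ε`. For `ε` bounded away from zero, the law at
scale `ε` is compared with the one at the small scale `ε ε₁`: dilating space by `1 / ε₁` matches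
the jump sizes, and since at most `N` jumps of each kind are kept the higher jump rate costs
only a bounded factor (`map_truncLaw_le`).
-/

noncomputable section

namespace FracFP

open scoped FourierTransform ContDiff RealInnerProductSpace

variable {d : ℕ}

/-! ### Fourier inversion for finite measures -/

/-- The inverse Fourier transform `(2π)^{-d} Re ∫ e^{-i x·ζ} h(ζ) dζ`. The sign in the exponent
matches the convention `charFun μ ζ = ∫ e^{i x·ζ} dμ(x)`; the real part is taken because
`h` will be a characteristic function, for which the integral is real. -/
def invFourier (h : E d → ℂ) (x : E d) : ℝ :=
  ((2 * Real.pi) ^ d)⁻¹ * (∫ ζ, Complex.exp (-(⟪x, ζ⟫ : ℂ) * Complex.I) * h ζ).re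

lemma norm_exp_neg_inner_mul (h : E d → ℂ) (x ζ : E d) :
    ‖Complex.exp (-(⟪x, ζ⟫ : ℂ) * Complex.I) * h ζ‖ = ‖h ζ‖ := by
  rw [norm_mul, ← Complex.ofReal_neg, Complex.norm_exp_ofReal_mul_I, one_mul]

lemma integrable_exp_neg_inner_mul {h : E d → ℂ} (hh : Integrable h) (x : E d) :
    Integrable (fun ζ => Complex.exp (-(⟪x, ζ⟫ : ℂ) * Complex.I) * h ζ) := by
  refine hh.norm.mono' ?_ (ae_of_all _ fun ζ => (norm_exp_neg_inner_mul h x ζ).le)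
  exact (Continuous.aestronglyMeasurable (by fun_prop)).mul hh.1

lemma continuous_invFourier {h : E d → ℂ} (hh : Integrable h) : Continuous (invFourier h) := by
  refine continuous_const.mul (Complex.continuous_re.comp ?_)
  refine continuous_of_dominated (bound := fun ζ => ‖h ζ‖)
    (fun x => (integrable_exp_neg_inner_mul hh x).1)
    (fun x => ae_of_all _ fun ζ => (norm_exp_neg_inner_mul h x ζ).le) hh.norm
    (ae_of_all _ fun ζ => by fun_prop)

lemma abs_invFourier_sub_le {h k : E d → ℂ} (hh : Integrable h) (hk : Integrable k) (x : E d) :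
    |invFourier h x - invFourier k x| ≤ ((2 * Real.pi) ^ d)⁻¹ * ∫ ζ, ‖h ζ - k ζ‖ := by
  rw [invFourier, invFourier, ← mul_sub, abs_mul, abs_of_pos (by positivity), ← Complex.sub_re,
    ← integral_sub (integrable_exp_neg_inner_mul hh x) (integrable_exp_neg_inner_mul hk x)]
  gcongr
  refine (Complex.abs_re_le_norm _).trans ((norm_integral_le_integral_norm _).trans (le_of_eq ?_))
  congr with ζ
  rw [← mul_sub]
  exact norm_exp_neg_inner_mul (fun ζ => h ζ - k ζ) x ζ

/-- Parseval's formula between a finite measure and a test function. -/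
lemma integral_test_eq_invFourier (F : Measure (E d)) [IsFiniteMeasure F]
    (hF : Integrable (charFun F)) {φ : E d → ℝ} (hφ : ContDiff ℝ ∞ φ) (hc : HasCompactSupport φ) :
    ∫ x, φ x ∂F = ∫ x, φ x * invFourier (charFun F) x := by
  have hφc : HasCompactSupport (fun x => (φ x : ℂ)) := hc.comp_left (g := ((↑) : ℝ → ℂ)) rfl
  have hφs : ContDiff ℝ ∞ (fun x => (φ x : ℂ)) := Complex.ofRealCLM.contDiff.comp hφ
  let Φ : SchwartzMap (E d) ℂ := hφc.toSchwartzMap hφs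
  have hΦ : ∀ x, Φ x = φ x := fun x => rfl
  have hpi : (0 : ℝ) < 2 * Real.pi := by positivity
  let h : E d → ℂ := fun v => charFun F ((2 * Real.pi) • v)
  have hh : Integrable h := hF.comp_smul hpi.ne'
  -- the test function is the superposition of characters given by its Fourier transform
  have hinv : ∀ x, (φ x : ℂ) = ∫ v, Complex.exp ((⟪x, (2 * Real.pi) • v⟫ : ℂ) * Complex.I) *
      𝓕 (Φ : E d → ℂ) v := by
    intro x
    have := congrFun (Φ.continuous.fourierInv_fourier_eq Φ.integrable
      (by rw [← SchwartzMap.fourier_coe]; exact (𝓕 Φ).integrable)) x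
    rw [← hΦ, ← this, Real.fourierInv_eq']
    refine integral_congr_ae (ae_of_all _ fun v => ?_)
    simp only [smul_eq_mul, real_inner_smul_right, real_inner_comm x v]
  have hΦi : Integrable (𝓕 (Φ : E d → ℂ)) := by
    rw [← SchwartzMap.fourier_coe]; exact (𝓕 Φ).integrable
  have h1 : ∫ x, (φ x : ℂ) ∂F = ∫ v, 𝓕 (Φ : E d → ℂ) v * h v := by
    simp_rw [hinv]
    rw [integral_integral_swap]
    · refine integral_congr_ae (ae_of_all _ fun v => ?_)
      simp only [h, charFun_apply]
      rw [integral_mul_const, mul_comm]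
    · have : Integrable (fun p : E d × E d => 𝓕 (Φ : E d → ℂ) p.2) (F.prod volume) :=
        hΦi.comp_snd F
      refine this.norm.mono' ?_ (ae_of_all _ fun p => ?_)
      · exact (Continuous.aestronglyMeasurable (by fun_prop)).mul this.1
      · simp only [Function.uncurry]
        rw [norm_mul, Complex.norm_exp_ofReal_mul_I, one_mul]
  have h2 : ∫ v, 𝓕 (Φ : E d → ℂ) v * h v = ∫ x, (φ x : ℂ) * 𝓕 h x := by
    simpa using! (VectorFourier.integral_fourierIntegral_smul_eq_flip (L := innerₗ (E d))
      Real.continuous_fourierChar continuous_inner Φ.integrable hh)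
  have h3 : ∀ x, (𝓕 h x).re = invFourier (charFun F) x := by
    intro x
    rw [invFourier, Real.fourier_eq']
    have := Measure.integral_comp_smul (volume : Measure (E d))
      (fun ζ => Complex.exp (-(⟪x, ζ⟫ : ℂ) * Complex.I) * charFun F ζ) (2 * Real.pi)
    simp only [finrank_euclideanSpace, Fintype.card_fin] at this
    rw [abs_of_pos (by positivity)] at this
    rw [← Complex.re_ofReal_mul, ← Complex.real_smul, ← this]
    congr 1
    refine integral_congr_ae (ae_of_all _ fun v => ?_)
    simp only [smul_eq_mul, real_inner_smul_right, real_inner_comm x v, h]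
    push_cast
    ring_nf
  have h4 : Integrable (fun x => (φ x : ℂ) * 𝓕 h x) := by
    have hb : ∀ x, ‖𝓕 h x‖ ≤ ∫ v, ‖h v‖ := fun x => by
      rw [Real.fourier_eq']
      refine (norm_integral_le_integral_norm _).trans (le_of_eq ?_)
      congr with v
      rw [norm_smul, Complex.norm_exp_ofReal_mul_I, one_mul]
    refine Integrable.mul_bdd (c := ∫ v, ‖h v‖) Φ.integrable ?_ (ae_of_all _ hb)
    exact (VectorFourier.fourierIntegral_continuous Real.continuous_fourierChar
      continuous_inner hh).aestronglyMeasurable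
  have h5 : ((∫ x, (φ x : ℂ) ∂F)).re = ∫ x, φ x * invFourier (charFun F) x := by
    rw [h1, h2, ← RCLike.re_eq_complex_re, ← integral_re h4]
    refine integral_congr_ae (ae_of_all _ fun x => ?_)
    simp only [RCLike.re_eq_complex_re, Complex.re_ofReal_mul, h3]
  rw [← h5, integral_complex_ofReal, Complex.ofReal_re]

/-- **Fourier inversion for measures**: a finite measure with integrable characteristic function
has a continuous nonnegative density, given by the inverse Fourier transform.

Both `F` and Lebesgue measure are written as densities with respect to `F + volume`, so that the
identity of integrals against test functions becomes an identity of functions. -/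
theorem eq_withDensity_invFourier (F : Measure (E d)) [IsFiniteMeasure F]
    (hF : Integrable (charFun F)) :
    (∀ x, 0 ≤ invFourier (charFun F) x) ∧
      F = volume.withDensity (fun x => ENNReal.ofReal (invFourier (charFun F) x)) := by
  set g := invFourier (charFun F) with hg
  have hgc : Continuous g := continuous_invFourier hF
  let ν : Measure (E d) := F + volume
  have : SigmaFinite ν := inferInstanceAs (SigmaFinite (F + volume))
  have : IsLocallyFiniteMeasure ν := by
    refine ⟨fun x => ?_⟩
    obtain ⟨s, hs, hv⟩ := (volume : Measure (E d)).finiteAt_nhds x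
    exact ⟨s, hs, by simpa [ν] using hv⟩
  have hFν : F ≪ ν := (Measure.le_add_right le_rfl).absolutelyContinuous
  have hVν : (volume : Measure (E d)) ≪ ν := (Measure.le_add_left le_rfl).absolutelyContinuous
  let a : E d → ℝ := fun x => (F.rnDeriv ν x).toReal
  let b : E d → ℝ := fun x => ((volume : Measure (E d)).rnDeriv ν x).toReal
  have hbm : Measurable b := (Measure.measurable_rnDeriv _ _).ennreal_toReal
  have hb1 : ∀ᵐ x ∂ν, ‖b x‖ ≤ 1 := by
    have h0 : (volume : Measure (E d)).rnDeriv ν ≤ᵐ[ν] 1 :=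
      Measure.rnDeriv_le_one_of_le (Measure.le_add_left le_rfl)
    filter_upwards [h0] with x hx
    rw [Real.norm_of_nonneg ENNReal.toReal_nonneg]
    exact ENNReal.toReal_mono ENNReal.one_ne_top hx
  have hab : ∀ᵐ x ∂ν, a x = g x * b x := by
    refine ae_eq_of_integral_contDiff_smul_eq ?_ ?_ fun φ hφ hc => ?_
    · exact Measure.integrable_toReal_rnDeriv.locallyIntegrable
    · have hgl : LocallyIntegrable g ν := hgc.locallyIntegrable
      refine hgl.mono (hgc.aestronglyMeasurable.mul hbm.aestronglyMeasurable) ?_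
      filter_upwards [hb1] with x hx
      rw [norm_mul]
      exact mul_le_of_le_one_right (norm_nonneg _) hx
    · have e1 : ∫ x, φ x • a x ∂ν = ∫ x, φ x ∂F := by
        rw [← integral_rnDeriv_smul hFν]
        exact integral_congr_ae (ae_of_all _ fun x => by simp [a, mul_comm])
      have e2 : ∫ x, φ x • (g x * b x) ∂ν = ∫ x, φ x * g x := by
        rw [← integral_rnDeriv_smul hVν]
        exact integral_congr_ae (ae_of_all _ fun x => by simp [b]; ring)
      rw [e1, e2]
      exact integral_test_eq_invFourier F hF hφ hc
  have hFd : F = volume.withDensity (fun x => ENNReal.ofReal (g x)) := by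
    conv_lhs => rw [← Measure.withDensity_rnDeriv_eq F ν hFν]
    conv_rhs => rw [← Measure.withDensity_rnDeriv_eq volume ν hVν]
    rw [← withDensity_mul _ (Measure.measurable_rnDeriv _ _) (by fun_prop)]
    refine withDensity_congr_ae ?_
    filter_upwards [hab, Measure.rnDeriv_ne_top F ν, Measure.rnDeriv_ne_top volume ν]
      with x hx h1 h2
    rw [Pi.mul_apply, ← ENNReal.ofReal_toReal h1, ← ENNReal.ofReal_toReal h2, mul_comm,
      ← ENNReal.ofReal_mul' ENNReal.toReal_nonneg]
    exact congrArg _ hx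
  refine ⟨?_, hFd⟩
  have hop : IsOpen {x | g x < 0} := isOpen_lt hgc continuous_const
  -- where `g < 0` the density of Lebesgue measure with respect to `ν` must vanish
  have hnull : (volume : Measure (E d)) {x | g x < 0} = 0 := by
    rw [← Measure.withDensity_rnDeriv_eq volume ν hVν, withDensity_apply _ hop.measurableSet,
      setLIntegral_eq_zero_iff hop.measurableSet (Measure.measurable_rnDeriv _ _)]
    filter_upwards [hab, Measure.rnDeriv_ne_top volume ν] with x hx h2 hneg
    have ha : 0 ≤ a x := ENNReal.toReal_nonneg
    have hb0 : 0 ≤ b x := ENNReal.toReal_nonneg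
    have hbz : b x = 0 := by
      by_contra hne
      have : 0 < b x := lt_of_le_of_ne hb0 (Ne.symm hne)
      have := mul_neg_of_neg_of_pos (show g x < 0 from hneg) this
      linarith
    exact ((ENNReal.toReal_eq_zero_iff _).1 hbz).resolve_right h2
  intro x
  by_contra! hx
  exact (hop.measure_pos volume ⟨x, hx⟩).ne' hnull

/-- If the characteristic function of `F` is `L¹`-close to `k`, a lower bound for the inverse
Fourier transform of `k` on a ball passes to `F`. -/
lemma restrict_ball_le_of_charFun_close (F : Measure (E d)) [IsFiniteMeasure F]
    (hF : Integrable (charFun F)) {k : E d → ℂ} (hk : Integrable k) {A c η : ℝ}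
    (hc : ∀ x ∈ Metric.ball (0 : E d) A, c ≤ invFourier k x)
    (hη : ((2 * Real.pi) ^ d)⁻¹ * ∫ ζ, ‖charFun F ζ - k ζ‖ ≤ η) :
    ENNReal.ofReal (c - η) • (volume : Measure (E d)).restrict (Metric.ball 0 A) ≤ F := by
  rw [(eq_withDensity_invFourier F hF).2, ← withDensity_const, ← withDensity_indicator
    Metric.isOpen_ball.measurableSet]
  refine withDensity_mono (ae_of_all _ fun x => ?_)
  by_cases hx : x ∈ Metric.ball (0 : E d) A
  · rw [indicator_of_mem hx]
    refine ENNReal.ofReal_le_ofReal ?_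
    have := abs_le.1 ((abs_invFourier_sub_le hF hk x).trans hη)
    linarith [hc x hx, this.1]
  · rw [indicator_of_notMem hx]
    exact zero_le

open scoped ENNReal Nat MeasureTheory

/-! ### Convolution powers and exponentials of measures -/

lemma conv_mono {μ μ' ν ν' : Measure (E d)} [SFinite ν'] (h₁ : μ ≤ μ') (h₂ : ν ≤ ν') :
    Measure.conv μ ν ≤ Measure.conv μ' ν' :=
  Measure.map_mono (Measure.prod_mono h₁ h₂) (by fun_prop)

lemma conv_univ (μ ν : Measure (E d)) [SFinite ν] :
    Measure.conv μ ν univ = μ univ * ν univ := by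
  rw [Measure.conv, Measure.map_apply (by fun_prop) MeasurableSet.univ, preimage_univ,
    ← univ_prod_univ, Measure.prod_prod]

lemma charFun_smul_ennreal (c : ℝ≥0∞) (μ : Measure (E d)) (ζ : E d) :
    charFun (c • μ) ζ = (c.toReal : ℂ) * charFun μ ζ := by
  simp [charFun_apply, integral_smul_measure]

lemma integrable_exp_inner (μ : Measure (E d)) [IsFiniteMeasure μ] (ζ : E d) :
    Integrable (fun x => Complex.exp ((⟪x, ζ⟫ : ℂ) * Complex.I)) μ :=
  BoundedContinuousFunction.integrable μ (BoundedContinuousFunction.innerProbChar ζ)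

lemma charFun_add_measure (μ ν : Measure (E d)) [IsFiniteMeasure μ] [IsFiniteMeasure ν]
    (ζ : E d) : charFun (μ + ν) ζ = charFun μ ζ + charFun ν ζ :=
  integral_add_measure (integrable_exp_inner μ ζ) (integrable_exp_inner ν ζ)

lemma charFun_finset_sum {ι : Type*} (S : Finset ι) (μ : ι → Measure (E d))
    [∀ i, IsFiniteMeasure (μ i)] (ζ : E d) :
    charFun (∑ i ∈ S, μ i) ζ = ∑ i ∈ S, charFun (μ i) ζ := by
  classical
  induction S using Finset.induction_on with
  | empty => simp
  | insert i S hi ih => rw [Finset.sum_insert hi, Finset.sum_insert hi, charFun_add_measure, ih]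

/-- Convolution powers `μ^{*n}` of a measure. -/
def convPow (μ : Measure (E d)) : ℕ → Measure (E d)
  | 0 => Measure.dirac 0
  | n + 1 => Measure.conv (convPow μ n) μ

instance isFiniteMeasure_convPow (μ : Measure (E d)) [IsFiniteMeasure μ] (n : ℕ) :
    IsFiniteMeasure (convPow μ n) := by
  induction n with
  | zero => exact inferInstanceAs (IsFiniteMeasure (Measure.dirac (0 : E d)))
  | succ n ih => exact inferInstanceAs (IsFiniteMeasure (Measure.conv (convPow μ n) μ))

lemma charFun_convPow (μ : Measure (E d)) [IsFiniteMeasure μ] (n : ℕ) (ζ : E d) :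
    charFun (convPow μ n) ζ = charFun μ ζ ^ n := by
  induction n with
  | zero => simp [convPow, charFun_dirac]
  | succ n ih => rw [convPow, charFun_conv, ih, pow_succ]

lemma convPow_univ (μ : Measure (E d)) [IsFiniteMeasure μ] (n : ℕ) :
    convPow μ n univ = μ univ ^ n := by
  induction n with
  | zero => simp [convPow]
  | succ n ih => rw [convPow, conv_univ, ih, pow_succ]

lemma convPow_smul (b : ℝ≥0∞) (μ : Measure (E d)) [IsFiniteMeasure μ] (hb : b ≠ ⊤) (n : ℕ) :
    convPow (b • μ) n = b ^ n • convPow μ n := by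
  have : IsFiniteMeasure (b • μ) := Measure.smul_finite μ hb
  induction n with
  | zero => simp [convPow]
  | succ n ih => rw [convPow, convPow, ih, Measure.conv_smul_left, Measure.conv_smul_right,
      smul_smul, pow_succ]

lemma map_smul_conv (B : ℝ) (μ ν : Measure (E d)) [SFinite μ] [SFinite ν] :
    (Measure.conv μ ν).map (fun x => B • x) =
      Measure.conv (μ.map (fun x => B • x)) (ν.map (fun x => B • x)) :=
  Measure.map_conv_continuousLinearMap (B • ContinuousLinearMap.id ℝ (E d))

lemma convPow_map_smul (B : ℝ) (μ : Measure (E d)) [IsFiniteMeasure μ] (n : ℕ) :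
    convPow (μ.map (fun x => B • x)) n = (convPow μ n).map (fun x => B • x) := by
  induction n with
  | zero => simp [convPow, Measure.map_dirac]
  | succ n ih => rw [convPow, convPow, ih, map_smul_conv]

/-- The part `∑_{j ∈ S} μ^{*j} / j!` of the convolution exponential of `μ`. -/
def expTrunc (S : Finset ℕ) (μ : Measure (E d)) : Measure (E d) :=
  ∑ j ∈ S, ((j ! : ℝ≥0∞))⁻¹ • convPow μ j

/-- The convolution exponential `∑_j μ^{*j} / j!`. For a jump intensity `μ`, the measure
`e^{-μ(univ)}` times `convExp μ` is the corresponding compound Poisson law. -/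
def convExp (μ : Measure (E d)) : Measure (E d) :=
  Measure.sum fun j : ℕ => ((j ! : ℝ≥0∞))⁻¹ • convPow μ j

lemma inv_factorial_ne_top (j : ℕ) : ((j ! : ℝ≥0∞))⁻¹ ≠ ⊤ :=
  ENNReal.inv_ne_top.2 (by exact_mod_cast j.factorial_ne_zero)

instance isFiniteMeasure_inv_factorial_smul (μ : Measure (E d)) [IsFiniteMeasure μ] (j : ℕ) :
    IsFiniteMeasure (((j ! : ℝ≥0∞))⁻¹ • μ) :=
  Measure.smul_finite _ (inv_factorial_ne_top j)

instance isFiniteMeasure_expTrunc (S : Finset ℕ) (μ : Measure (E d)) [IsFiniteMeasure μ] :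
    IsFiniteMeasure (expTrunc S μ) := by
  refine ⟨?_⟩
  rw [expTrunc, Measure.finsetSum_apply]
  exact ENNReal.sum_lt_top.2 fun j _ => measure_lt_top _ _

instance isFiniteMeasure_convExp (μ : Measure (E d)) [IsFiniteMeasure μ] :
    IsFiniteMeasure (convExp μ) := by
  refine ⟨?_⟩
  rw [convExp, Measure.sum_apply _ MeasurableSet.univ]
  have h : ∀ j : ℕ, (((j ! : ℝ≥0∞))⁻¹ • convPow μ j) univ =
      ENNReal.ofReal ((μ univ).toReal ^ j / j !) := fun j => by
    rw [Measure.smul_apply, convPow_univ, smul_eq_mul,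
      ENNReal.ofReal_div_of_pos (by exact_mod_cast j.factorial_pos),
      ENNReal.ofReal_pow ENNReal.toReal_nonneg, ENNReal.ofReal_toReal (measure_ne_top _ _),
      ENNReal.ofReal_natCast, mul_comm, ENNReal.div_eq_inv_mul, mul_comm]
  simp_rw [h]
  rw [← ENNReal.ofReal_tsum_of_nonneg (fun j => by positivity)
    (Real.summable_pow_div_factorial _)]
  exact ENNReal.ofReal_lt_top

lemma charFun_expTrunc (S : Finset ℕ) (μ : Measure (E d)) [IsFiniteMeasure μ] (ζ : E d) :
    charFun (expTrunc S μ) ζ = ∑ j ∈ S, charFun μ ζ ^ j / (j ! : ℂ) := by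
  rw [expTrunc, charFun_finset_sum]
  refine Finset.sum_congr rfl fun j _ => ?_
  rw [charFun_smul_ennreal, charFun_convPow]
  simp [div_eq_inv_mul]

lemma charFun_convExp (μ : Measure (E d)) [IsFiniteMeasure μ] (ζ : E d) :
    charFun (convExp μ) ζ = Complex.exp (charFun μ ζ) := by
  have h1 : HasSum (fun j : ℕ => charFun (((j ! : ℝ≥0∞))⁻¹ • convPow μ j) ζ)
      (charFun (convExp μ) ζ) :=
    hasSum_integral_measure (integrable_exp_inner (convExp μ) ζ)
  have h2 : (fun j : ℕ => charFun (((j ! : ℝ≥0∞))⁻¹ • convPow μ j) ζ) =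
      fun j : ℕ => charFun μ ζ ^ j / (j ! : ℂ) := by
    ext j
    rw [charFun_smul_ennreal, charFun_convPow]
    simp [div_eq_inv_mul]
  rw [h2] at h1
  refine h1.unique ?_
  rw [Complex.exp_eq_exp_ℂ]
  exact NormedSpace.expSeries_div_hasSum_exp (charFun μ ζ)

lemma expTrunc_le_convExp (S : Finset ℕ) (μ : Measure (E d)) : expTrunc S μ ≤ convExp μ := by
  refine Measure.le_iff.2 fun s hs => ?_
  rw [convExp, Measure.sum_apply _ hs, expTrunc, Measure.finsetSum_apply]
  exact ENNReal.sum_le_tsum S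

lemma expTrunc_smul_le {b : ℝ≥0∞} (hb1 : 1 ≤ b) (hb : b ≠ ⊤) {S : Finset ℕ} {N : ℕ}
    (hS : ∀ j ∈ S, j ≤ N) (μ : Measure (E d)) [IsFiniteMeasure μ] :
    expTrunc S (b • μ) ≤ b ^ N • expTrunc S μ := by
  rw [expTrunc, expTrunc, Finset.smul_sum]
  refine Finset.sum_le_sum fun j hj => ?_
  rw [convPow_smul b μ hb, smul_comm]
  refine Measure.le_iff.2 fun s _ => ?_
  simp only [Measure.smul_apply, smul_eq_mul]
  gcongr
  exact hS j hj

lemma expTrunc_map_smul (B : ℝ) (S : Finset ℕ) (μ : Measure (E d)) [IsFiniteMeasure μ] :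
    (expTrunc S μ).map (fun x => B • x) = expTrunc S (μ.map (fun x => B • x)) := by
  rw [expTrunc, expTrunc, ← Measure.mapₗ_apply_of_measurable (by fun_prop), map_sum]
  refine Finset.sum_congr rfl fun j _ => ?_
  rw [Measure.mapₗ_apply_of_measurable (by fun_prop), convPow_map_smul, Measure.map_smul]

/-- The convolution product `T 0 ∗ ⋯ ∗ T (n - 1)`. -/
def convProd (T : ℕ → Measure (E d)) : ℕ → Measure (E d)
  | 0 => Measure.dirac 0
  | n + 1 => Measure.conv (convProd T n) (T n)

instance isFiniteMeasure_convProd (T : ℕ → Measure (E d)) [∀ i, IsFiniteMeasure (T i)] (n : ℕ) :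
    IsFiniteMeasure (convProd T n) := by
  induction n with
  | zero => exact inferInstanceAs (IsFiniteMeasure (Measure.dirac (0 : E d)))
  | succ n ih => exact inferInstanceAs (IsFiniteMeasure (Measure.conv (convProd T n) (T n)))

lemma charFun_convProd (T : ℕ → Measure (E d)) [∀ i, IsFiniteMeasure (T i)] (n : ℕ) (ζ : E d) :
    charFun (convProd T n) ζ = ∏ i ∈ Finset.range n, charFun (T i) ζ := by
  induction n with
  | zero => simp [convProd, charFun_dirac]
  | succ n ih => rw [convProd, charFun_conv, ih, Finset.prod_range_succ]

lemma convProd_mono {T T' : ℕ → Measure (E d)} [∀ i, IsFiniteMeasure (T' i)]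
    (h : ∀ i, T i ≤ T' i) (n : ℕ) : convProd T n ≤ convProd T' n := by
  induction n with
  | zero => exact le_rfl
  | succ n ih => exact conv_mono ih (h n)

lemma convProd_smul (c : ℝ≥0∞) (T : ℕ → Measure (E d)) [∀ i, IsFiniteMeasure (T i)] (n : ℕ) :
    convProd (fun i => c • T i) n = c ^ n • convProd T n := by
  induction n with
  | zero => simp [convProd]
  | succ n ih => rw [convProd, convProd, ih, Measure.conv_smul_left, Measure.conv_smul_right,
      smul_smul, pow_succ]

lemma convProd_map_smul (B : ℝ) (T : ℕ → Measure (E d)) [∀ i, IsFiniteMeasure (T i)] (n : ℕ) :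
    (convProd T n).map (fun x => B • x) = convProd (fun i => (T i).map (fun x => B • x)) n := by
  induction n with
  | zero => simp [convProd, Measure.map_dirac]
  | succ n ih => rw [convProd, convProd, map_smul_conv, ih]

/-- Convolving Lebesgue measure on a ball with `μ` leaves on a smaller ball a multiple of
Lebesgue measure, the factor being the mass of `μ` near the origin. -/
lemma restrict_ball_le_conv (μ : Measure (E d)) [IsFiniteMeasure μ] (R₁ R₂ : ℝ) :
    μ (Metric.ball 0 R₂) • (volume : Measure (E d)).restrict (Metric.ball 0 R₁) ≤
      Measure.conv ((volume : Measure (E d)).restrict (Metric.ball 0 (R₁ + R₂))) μ := by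
  refine Measure.le_iff.2 fun s hs => ?_
  have hm : Measurable fun x : E d => s.indicator (1 : E d → ℝ≥0∞) x :=
    measurable_one.indicator hs
  rw [Measure.conv_comm, Measure.smul_apply, smul_eq_mul, mul_comm, ← setLIntegral_const,
    ← lintegral_indicator_one (μ := Measure.conv _ _) hs, Measure.lintegral_conv hm]
  refine (setLIntegral_mono' Metric.isOpen_ball.measurableSet fun x hx => ?_).trans
    (setLIntegral_le_lintegral (Metric.ball 0 R₂) _)
  rw [Measure.restrict_apply hs,
    ← measure_preimage_add (volume : Measure (E d)) x (s ∩ Metric.ball 0 R₁),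
    ← lintegral_indicator_one (by measurability),
    ← lintegral_indicator Metric.isOpen_ball.measurableSet]
  refine lintegral_mono fun y => ?_
  by_cases hy : x + y ∈ s ∩ Metric.ball 0 R₁
  · have hyb : y ∈ Metric.ball (0 : E d) (R₁ + R₂) := by
      have h1 := hy.2
      rw [mem_ball_zero_iff] at h1 hx ⊢
      calc ‖y‖ = ‖(x + y) - x‖ := by simp
        _ ≤ ‖x + y‖ + ‖x‖ := norm_sub_le _ _
        _ < R₁ + R₂ := add_lt_add h1 hx
    rw [indicator_of_mem hyb, indicator_of_mem hy.1]
    exact indicator_le_self' (fun _ _ => zero_le) _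
  · rw [indicator_of_notMem (by exact hy)]
    exact zero_le

/-! ### Isotropic stable laws -/

/-- The symbol `e^{-σ|ζ|^{2s}}` of the isotropic `2s`-stable semigroup at time `σ`. -/
def stableSymbol (s σ : ℝ) (ζ : E d) : ℂ := (Real.exp (-(σ * ‖ζ‖ ^ (2 * s))) : ℂ)

/-- The reference weight `(1 + |ζ|)^{-(d+1)}`, integrable over frequency space. -/
def freqWeight (ζ : E d) : ℝ := ((1 + ‖ζ‖) ^ (d + 1))⁻¹

lemma freqWeight_pos (ζ : E d) : 0 < freqWeight ζ := by unfold freqWeight; positivity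

lemma integrable_freqWeight : Integrable (freqWeight : E d → ℝ) := by
  have h := integrable_one_add_norm (E := E d) (μ := volume) (r := (d + 1 : ℝ)) (by simp)
  refine h.congr (ae_of_all _ fun ζ => ?_)
  simp only [freqWeight]
  rw [Real.rpow_neg (by positivity)]
  norm_cast

lemma one_add_pow_mul_exp_neg_le (n : ℕ) {σ : ℝ} (hσ : 0 < σ) {x : ℝ} (hx : 0 ≤ x) :
    (1 + x) ^ n * Real.exp (-(σ * x)) ≤ n ! * σ⁻¹ ^ n * Real.exp σ := by
  have h := Real.pow_div_factorial_le_exp (σ * (1 + x)) (by positivity) n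
  rw [div_le_iff₀ (by positivity), mul_pow] at h
  have h2 : (1 + x) ^ n ≤ n ! * σ⁻¹ ^ n * Real.exp (σ * (1 + x)) := by
    calc (1 + x) ^ n = σ⁻¹ ^ n * (σ ^ n * (1 + x) ^ n) := by
          rw [inv_pow, inv_mul_cancel_left₀ (pow_ne_zero n hσ.ne')]
      _ ≤ σ⁻¹ ^ n * (Real.exp (σ * (1 + x)) * n !) := by gcongr
      _ = _ := by ring
  calc (1 + x) ^ n * Real.exp (-(σ * x))
      ≤ (n ! * σ⁻¹ ^ n * Real.exp (σ * (1 + x))) * Real.exp (-(σ * x)) := by gcongr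
    _ = n ! * σ⁻¹ ^ n * Real.exp σ := by
      rw [mul_assoc, ← Real.exp_add]; ring_nf

lemma sub_one_le_rpow {x p : ℝ} (hx : 0 ≤ x) (hp : 1 ≤ p) : x - 1 ≤ x ^ p := by
  rcases le_total x 1 with h | h
  · linarith [Real.rpow_nonneg hx p]
  · have := Real.rpow_le_rpow_of_exponent_le h hp
    rw [Real.rpow_one] at this
    linarith

/-- Polynomially weighted bound for the stable symbol, uniform in the exponent. -/
lemma one_add_pow_mul_exp_neg_rpow_le (n : ℕ) {σ₀ σ s : ℝ} (hσ₀ : 0 < σ₀) (hσ : σ₀ ≤ σ)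
    (hs : 1 / 2 ≤ s) {x : ℝ} (hx : 0 ≤ x) :
    (1 + x) ^ n * Real.exp (-(σ * x ^ (2 * s))) ≤
      n ! * σ₀⁻¹ ^ n * Real.exp σ₀ * Real.exp σ₀ := by
  have h1 := sub_one_le_rpow hx (show 1 ≤ 2 * s by linarith)
  have h2 : 0 ≤ x ^ (2 * s) := Real.rpow_nonneg hx _
  have h3 : Real.exp (-(σ * x ^ (2 * s))) ≤ Real.exp (-(σ₀ * x)) * Real.exp σ₀ := by
    rw [← Real.exp_add]
    refine Real.exp_le_exp.2 ?_
    nlinarith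
  calc (1 + x) ^ n * Real.exp (-(σ * x ^ (2 * s)))
      ≤ (1 + x) ^ n * (Real.exp (-(σ₀ * x)) * Real.exp σ₀) := by gcongr
    _ = (1 + x) ^ n * Real.exp (-(σ₀ * x)) * Real.exp σ₀ := by ring
    _ ≤ _ := mul_le_mul_of_nonneg_right (one_add_pow_mul_exp_neg_le n hσ₀ hx) (Real.exp_pos _).le

lemma norm_stableSymbol (s σ : ℝ) (ζ : E d) :
    ‖stableSymbol s σ ζ‖ = Real.exp (-(σ * ‖ζ‖ ^ (2 * s))) := by
  rw [stableSymbol, Complex.norm_real, Real.norm_of_nonneg (Real.exp_pos _).le]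

lemma norm_stableSymbol_le {σ₀ σ s : ℝ} (hσ₀ : 0 < σ₀) (hσ : σ₀ ≤ σ) (hs : 1 / 2 ≤ s) (ζ : E d) :
    ‖stableSymbol s σ ζ‖ ≤
      ((d + 1)! * σ₀⁻¹ ^ (d + 1) * Real.exp σ₀ * Real.exp σ₀) * freqWeight ζ := by
  rw [norm_stableSymbol, freqWeight, ← div_eq_mul_inv, le_div_iff₀ (by positivity), mul_comm]
  exact one_add_pow_mul_exp_neg_rpow_le (d + 1) hσ₀ hσ hs (norm_nonneg ζ)

lemma continuous_stableSymbol {s : ℝ} (hs : 0 ≤ s) (σ : ℝ) :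
    Continuous (stableSymbol s σ : E d → ℂ) := by
  unfold stableSymbol
  have : Continuous fun ζ : E d => ‖ζ‖ ^ (2 * s) :=
    continuous_norm.rpow_const fun _ => Or.inr (by linarith)
  fun_prop

lemma integrable_stableSymbol {s σ : ℝ} (hσ : 0 < σ) (hs : 1 / 2 ≤ s) :
    Integrable (stableSymbol s σ : E d → ℂ) :=
  (integrable_freqWeight.const_mul _).mono'
    (continuous_stableSymbol (by linarith) σ).aestronglyMeasurable
    (ae_of_all _ fun ζ => norm_stableSymbol_le hσ le_rfl hs ζ)

lemma stableSymbol_add (s σ τ : ℝ) (ζ : E d) :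
    stableSymbol s (σ + τ) ζ = stableSymbol s σ ζ * stableSymbol s τ ζ := by
  simp only [stableSymbol]
  rw [← Complex.ofReal_mul, ← Real.exp_add]
  ring_nf

lemma stableSymbol_smul {b : ℝ} (hb : 0 ≤ b) (s σ : ℝ) (ζ : E d) :
    stableSymbol s σ (b • ζ) = stableSymbol s (b ^ (2 * s) * σ) ζ := by
  simp only [stableSymbol]
  rw [norm_smul, Real.norm_of_nonneg hb, Real.mul_rpow hb (norm_nonneg _)]
  ring_nf

/-- The existence half of Lévy's continuity theorem. -/
lemma exists_charFun_eq_of_tendsto {μ : ℕ → Measure (E d)} [∀ n, IsProbabilityMeasure (μ n)]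
    {f : E d → ℂ} (hf : ContinuousAt f 0)
    (h : ∀ ζ, Tendsto (fun n => charFun (μ n) ζ) atTop (𝓝 (f ζ))) :
    ∃ γ : Measure (E d), IsProbabilityMeasure γ ∧ charFun γ = f := by
  have ht := isTightMeasureSet_of_tendsto_charFun hf h
  let ν : ℕ → ProbabilityMeasure (E d) := fun n => ⟨μ n, inferInstance⟩
  have ht' : IsTightMeasureSet {((ρ : ProbabilityMeasure (E d)) : Measure (E d)) |
      ρ ∈ Set.range ν} := by
    refine ht.subset ?_
    rintro _ ⟨ρ, ⟨n, rfl⟩, rfl⟩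
    exact ⟨n, rfl⟩
  obtain ⟨γ, -, hγ⟩ := (isCompact_closure_of_isTightMeasureSet ht').ultrafilter_le_nhds
    ((hyperfilter ℕ).map ν)
    (by
      refine le_trans ?_ (monotone_principal subset_closure)
      simp)
  refine ⟨γ, inferInstance, ?_⟩
  ext ζ
  have hγ' : Tendsto ν (hyperfilter ℕ : Filter ℕ) (𝓝 γ) := hγ
  rw [ProbabilityMeasure.tendsto_iff_forall_integral_rclike_tendsto ℂ] at hγ'
  have h1 := hγ' (BoundedContinuousFunction.innerProbChar ζ)
  have h2 : Tendsto (fun n => charFun (μ n) ζ) (hyperfilter ℕ : Filter ℕ) (𝓝 (f ζ)) :=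
    (h ζ).mono_left Nat.hyperfilter_le_atTop
  rw [charFun_eq_integral_innerProbChar]
  refine tendsto_nhds_unique h1 (h2.congr fun n => ?_)
  rw [charFun_eq_integral_innerProbChar]
  rfl

/-- The law on `E d` with Lebesgue density `f`. -/
def lawOf (f : E d → ℝ) : Measure (E d) := volume.withDensity fun x => ENNReal.ofReal (f x)

lemma isProbabilityMeasure_lawOf {f : E d → ℝ} (hf : IsProbDensity f) :
    IsProbabilityMeasure (lawOf f) := by
  refine ⟨?_⟩
  rw [lawOf, withDensity_apply _ MeasurableSet.univ, setLIntegral_univ,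
    ← ofReal_integral_eq_lintegral_ofReal hf.integrable hf.nonneg, hf.integral_eq_one,
    ENNReal.ofReal_one]

lemma charFun_lawOf_eq_integral {f : E d → ℝ} (hf : Integrable f) (h0 : ∀ᵐ x, 0 ≤ f x) (ζ : E d) :
    charFun (lawOf f) ζ = ∫ x, Complex.exp ((⟪x, ζ⟫ : ℂ) * Complex.I) * (f x : ℂ) := by
  rw [charFun_apply, lawOf, integral_withDensity_eq_integral_toReal_smul₀
    hf.1.aemeasurable.ennreal_ofReal (ae_of_all _ fun _ => ENNReal.ofReal_lt_top)]
  refine integral_congr_ae ?_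
  filter_upwards [h0] with x hx
  rw [ENNReal.toReal_ofReal hx, Complex.real_smul, mul_comm]

lemma charFun_lawOf {f : E d → ℝ} (hf : Integrable f) (h0 : ∀ᵐ x, 0 ≤ f x) (ζ : E d) :
    charFun (lawOf f) ζ = fourierT f (-ζ) := by
  rw [charFun_lawOf_eq_integral hf h0, fourierT]
  refine integral_congr_ae (ae_of_all _ fun x => ?_)
  simp only [inner_neg_right]
  push_cast
  ring_nf

/-- At scale `ε` and intensity `ε^{-2s}`, the exponent of the compound Poisson law converges to
the stable exponent at rate `ε^δ`. -/
lemma norm_scaled_exponent_le {P : Measure (E d)} {C₀ δ s : ℝ}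
    (hP : ∀ ζ : E d, ‖ζ‖ ≤ 1 →
      ‖charFun P ζ - (1 - ((‖ζ‖ ^ (2 * s) : ℝ) : ℂ))‖ ≤ C₀ * ‖ζ‖ ^ (2 * s + δ))
    {ε : ℝ} (hε : 0 < ε) {ζ : E d} (hζ : ε * ‖ζ‖ ≤ 1) :
    ‖((1 / ε ^ (2 * s) : ℝ) : ℂ) * (charFun P (ε • ζ) - 1) + ((‖ζ‖ ^ (2 * s) : ℝ) : ℂ)‖ ≤
      C₀ * ε ^ δ * ‖ζ‖ ^ (2 * s + δ) := by
  have hn : ‖ε • ζ‖ = ε * ‖ζ‖ := by rw [norm_smul, Real.norm_of_nonneg hε.le]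
  have h := hP (ε • ζ) (by rw [hn]; exact hζ)
  have he : 0 < ε ^ (2 * s) := Real.rpow_pos_of_pos hε _
  rw [hn, Real.mul_rpow hε.le (norm_nonneg _), Real.mul_rpow hε.le (norm_nonneg _),
    Real.rpow_add hε] at h
  have heq : ((1 / ε ^ (2 * s) : ℝ) : ℂ) * (charFun P (ε • ζ) - 1) + ((‖ζ‖ ^ (2 * s) : ℝ) : ℂ) =
      ((1 / ε ^ (2 * s) : ℝ) : ℂ) *
        (charFun P (ε • ζ) - (1 - ((ε ^ (2 * s) * ‖ζ‖ ^ (2 * s) : ℝ) : ℂ))) := by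
    have : ((ε ^ (2 * s) : ℝ) : ℂ) ≠ 0 := by exact_mod_cast he.ne'
    push_cast
    field_simp
    ring
  rw [heq, norm_mul, Complex.norm_real, Real.norm_of_nonneg (by positivity)]
  calc 1 / ε ^ (2 * s) * ‖charFun P (ε • ζ) - (1 - ((ε ^ (2 * s) * ‖ζ‖ ^ (2 * s) : ℝ) : ℂ))‖
      ≤ 1 / ε ^ (2 * s) * (C₀ * (ε ^ (2 * s) * ε ^ δ * ‖ζ‖ ^ (2 * s + δ))) := by gcongr
    _ = _ := by field_simp

lemma compoundPoisson_prob (μ : Measure (E d)) [IsFiniteMeasure μ] :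
    IsProbabilityMeasure (ENNReal.ofReal (Real.exp (-(μ.real univ))) • convExp μ) := by
  refine ⟨?_⟩
  have h1 := charFun_convExp μ 0
  rw [charFun_zero, charFun_zero, ← Complex.ofReal_exp, Complex.ofReal_inj] at h1
  have h2 : convExp μ univ = ENNReal.ofReal (Real.exp (μ.real univ)) := by
    rw [← h1, Measure.real, ENNReal.ofReal_toReal (measure_ne_top _ _)]
  rw [Measure.smul_apply, h2, smul_eq_mul, ← ENNReal.ofReal_mul (Real.exp_pos _).le,
    ← Real.exp_add]
  simp

lemma charFun_compoundPoisson (μ : Measure (E d)) [IsFiniteMeasure μ] (ζ : E d) :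
    charFun (ENNReal.ofReal (Real.exp (-(μ.real univ))) • convExp μ) ζ =
      Complex.exp (charFun μ ζ - μ.real univ) := by
  rw [charFun_smul_ennreal, charFun_convExp, ENNReal.toReal_ofReal (Real.exp_pos _).le,
    Complex.ofReal_exp, ← Complex.exp_add, Complex.ofReal_neg, neg_add_eq_sub]

/-- A law in the domain of normal attraction of the stable law, in the sense of the low
frequency expansion, gives the existence of the stable law as a limit of compound Poisson laws. -/
lemma exists_stableLaw_of_low_freq {P : Measure (E d)} [IsProbabilityMeasure P] {C₀ δ s : ℝ}
    (hδ : 0 < δ) (hs : 0 < s)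
    (hP : ∀ ζ : E d, ‖ζ‖ ≤ 1 →
      ‖charFun P ζ - (1 - ((‖ζ‖ ^ (2 * s) : ℝ) : ℂ))‖ ≤ C₀ * ‖ζ‖ ^ (2 * s + δ)) :
    ∃ γ : Measure (E d), IsProbabilityMeasure γ ∧ charFun γ = stableSymbol s 1 := by
  let ε : ℕ → ℝ := fun n => 1 / ((n : ℝ) + 1)
  have hε : ∀ n, 0 < ε n := fun n => by positivity
  have hε0 : Tendsto ε atTop (𝓝 0) := tendsto_one_div_add_atTop_nhds_zero_nat
  let Q : ℕ → Measure (E d) := fun n =>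
    ENNReal.ofReal (1 / ε n ^ (2 * s)) • P.map (fun x => ε n • x)
  have hQf : ∀ n, IsFiniteMeasure (Q n) := fun n =>
    have : IsProbabilityMeasure (P.map (fun x => ε n • x)) :=
      Measure.isProbabilityMeasure_map (by fun_prop)
    Measure.smul_finite _ ENNReal.ofReal_ne_top
  have hpos : ∀ n, 0 ≤ 1 / ε n ^ (2 * s) := fun n => by
    have := Real.rpow_pos_of_pos (hε n) (2 * s)
    positivity
  have hQc : ∀ n ζ, charFun (Q n) ζ = ((1 / ε n ^ (2 * s) : ℝ) : ℂ) * charFun P (ε n • ζ) := by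
    intro n ζ
    rw [charFun_smul_ennreal, charFun_map_smul, ENNReal.toReal_ofReal (hpos n)]
  have hQu : ∀ n, (((Q n).real univ : ℝ) : ℂ) = ((1 / ε n ^ (2 * s) : ℝ) : ℂ) := by
    intro n
    rw [← charFun_zero, hQc, smul_zero, charFun_zero]
    simp
  have hprob := fun n => compoundPoisson_prob (Q n)
  refine exists_charFun_eq_of_tendsto
    (μ := fun n => ENNReal.ofReal (Real.exp (-((Q n).real univ))) • convExp (Q n))
    (continuous_stableSymbol hs.le 1).continuousAt fun ζ => ?_
  simp_rw [charFun_compoundPoisson, hQc, hQu]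
  have hexp : stableSymbol s 1 ζ = Complex.exp (-((‖ζ‖ ^ (2 * s) : ℝ) : ℂ)) := by
    simp [stableSymbol]
  rw [hexp]
  refine (Complex.continuous_exp.tendsto _).comp ?_
  rw [tendsto_iff_norm_sub_tendsto_zero]
  have hlim : Tendsto (fun n => C₀ * ε n ^ δ * ‖ζ‖ ^ (2 * s + δ)) atTop (𝓝 0) := by
    have h1 : Tendsto (fun n => ε n ^ δ) atTop (𝓝 0) := by
      have := hε0.rpow_const (p := δ) (Or.inr hδ.le)
      rwa [Real.zero_rpow hδ.ne'] at this
    simpa using (h1.const_mul C₀).mul_const (‖ζ‖ ^ (2 * s + δ))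
  refine tendsto_of_tendsto_of_tendsto_of_le_of_le' tendsto_const_nhds hlim
    (Eventually.of_forall fun n => norm_nonneg _) ?_
  have hsmall : ∀ᶠ n in atTop, ε n * ‖ζ‖ < 1 := by
    have := hε0.mul_const ‖ζ‖
    rw [zero_mul] at this
    exact this.eventually_lt_const one_pos
  filter_upwards [hsmall] with n hn
  refine le_of_eq_of_le (congrArg norm ?_) (norm_scaled_exponent_le hP (hε n) hn.le)
  ring

/-- Stable laws of every index in `[1/2, 1]` exist, once they exist for indices in `(1/2, 1)`. -/
lemma exists_stableLaw_Icc
    (h : ∀ s ∈ Ioo (1 / 2 : ℝ) 1, ∃ γ : Measure (E d), IsProbabilityMeasure γ ∧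
      charFun γ = stableSymbol s 1) {s : ℝ} (hs : s ∈ Icc (1 / 2 : ℝ) 1) :
    ∃ γ : Measure (E d), IsProbabilityMeasure γ ∧ charFun γ = stableSymbol s 1 := by
  have hcl : s ∈ closure (Ioo (1 / 2 : ℝ) 1) := by
    rwa [closure_Ioo (by norm_num)]
  obtain ⟨u, hu, hlim⟩ := mem_closure_iff_seq_limit.1 hcl
  choose γ hγ hγc using fun n => h (u n) (hu n)
  refine exists_charFun_eq_of_tendsto (μ := γ)
    (continuous_stableSymbol (by linarith [hs.1]) 1).continuousAt fun ζ => ?_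
  simp_rw [hγc]
  simp only [stableSymbol]
  refine (Complex.continuous_ofReal.tendsto _).comp ((Real.continuous_exp.tendsto _).comp ?_)
  refine ((tendsto_const_nhds.rpow (hlim.const_mul 2) (Or.inr ?_)).const_mul 1).neg
  linarith [hs.1]

lemma exists_stableLaw_time {s : ℝ} (hs : 0 < s)
    (h : ∃ γ : Measure (E d), IsProbabilityMeasure γ ∧ charFun γ = stableSymbol s 1)
    {σ : ℝ} (hσ : 0 < σ) :
    ∃ γ : Measure (E d), IsProbabilityMeasure γ ∧ charFun γ = stableSymbol s σ := by
  obtain ⟨γ, hγ, hc⟩ := h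
  refine ⟨γ.map (fun x => σ ^ (1 / (2 * s)) • x), Measure.isProbabilityMeasure_map (by fun_prop), ?_⟩
  ext ζ
  rw [charFun_map_smul, hc, stableSymbol_smul (by positivity), ← Real.rpow_mul hσ.le]
  have : 1 / (2 * s) * (2 * s) = 1 := by field_simp
  rw [this, Real.rpow_one, mul_one]

/-! ### Uniform positivity of the stable densities -/

/-- Multiplying a symbol by a characteristic function averages the inverse transform. -/
lemma invFourier_charFun_mul (μ : Measure (E d)) [IsFiniteMeasure μ] {h : E d → ℂ}
    (hh : Integrable h) (x : E d) :
    invFourier (fun ζ => charFun μ ζ * h ζ) x = ∫ y, invFourier h (x - y) ∂μ := by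
  have hint : Integrable (Function.uncurry fun (y ζ : E d) =>
      Complex.exp (-(⟪x - y, ζ⟫ : ℂ) * Complex.I) * h ζ) (μ.prod volume) := by
    have h2 : Integrable (fun p : E d × E d => h p.2) (μ.prod volume) := hh.comp_snd μ
    refine h2.norm.mono' ?_ (ae_of_all _ fun p => ?_)
    · exact (Continuous.aestronglyMeasurable (by fun_prop)).mul h2.1
    · simp only [Function.uncurry]
      exact (norm_exp_neg_inner_mul h _ _).le
  have h1 : ∫ ζ, Complex.exp (-(⟪x, ζ⟫ : ℂ) * Complex.I) * (charFun μ ζ * h ζ) =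
      ∫ y, (∫ ζ, Complex.exp (-(⟪x - y, ζ⟫ : ℂ) * Complex.I) * h ζ) ∂μ := by
    rw [integral_integral_swap hint]
    refine integral_congr_ae (ae_of_all _ fun ζ => ?_)
    simp only [charFun_apply]
    rw [integral_mul_const, ← mul_assoc, ← integral_const_mul]
    congr 2
    ext y
    rw [← Complex.exp_add, inner_sub_left]
    push_cast
    ring_nf
  have hint2 : Integrable (fun y => ∫ ζ, Complex.exp (-(⟪x - y, ζ⟫ : ℂ) * Complex.I) * h ζ) μ :=
    hint.integral_prod_left
  unfold invFourier
  rw [h1, integral_const_mul]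
  congr 1
  rw [← RCLike.re_eq_complex_re, ← integral_re hint2]

lemma invFourier_comp_smul {b : ℝ} (hb : 0 < b) (h : E d → ℂ) (x : E d) :
    invFourier h (b • x) = (b ^ d)⁻¹ * invFourier (fun ζ => h (b⁻¹ • ζ)) x := by
  unfold invFourier
  have := Measure.integral_comp_smul (volume : Measure (E d))
      (fun ζ => Complex.exp (-(⟪x, ζ⟫ : ℂ) * Complex.I) * h (b⁻¹ • ζ)) b
  simp only [finrank_euclideanSpace, Fintype.card_fin] at this
  rw [abs_of_pos (by positivity)] at this
  rw [mul_left_comm, ← Complex.re_ofReal_mul ((b ^ d)⁻¹), ← Complex.real_smul, ← this]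
  congr 2
  refine integral_congr_ae (ae_of_all _ fun ζ => ?_)
  simp only [real_inner_smul_left, real_inner_smul_right, inv_smul_smul₀ hb.ne']

lemma invFourier_isometry (O : E d ≃ₗᵢ[ℝ] E d) {h : E d → ℂ} (hO : ∀ ζ, h (O ζ) = h ζ) (x : E d) :
    invFourier h (O x) = invFourier h x := by
  unfold invFourier
  congr 2
  rw [← O.measurePreserving.integral_comp O.toMeasurableEquiv.measurableEmbedding]
  refine integral_congr_ae (ae_of_all _ fun ζ => ?_)
  simp only [hO, LinearIsometryEquiv.inner_map_map]

/-- The density of the isotropic stable law of index `2s` at time `σ`, as the inverse Fourier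
transform of its symbol. -/
def stableDensity (s σ : ℝ) : E d → ℝ := invFourier (stableSymbol s σ)

lemma continuous_stableDensity {s σ : ℝ} (hσ : 0 < σ) (hs : 1 / 2 ≤ s) :
    Continuous (stableDensity s σ : E d → ℝ) :=
  continuous_invFourier (integrable_stableSymbol hσ hs)

lemma stableDensity_zero_pos {s σ : ℝ} (hσ : 0 < σ) (hs : 1 / 2 ≤ s) :
    0 < stableDensity s σ (0 : E d) := by
  have h1 : (∫ ζ : E d, Complex.exp (-(⟪(0 : E d), ζ⟫ : ℂ) * Complex.I) * stableSymbol s σ ζ).re =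
      ∫ ζ : E d, Real.exp (-(σ * ‖ζ‖ ^ (2 * s))) := by
    rw [← RCLike.re_eq_complex_re, ← integral_re (integrable_exp_neg_inner_mul
      (integrable_stableSymbol hσ hs) 0)]
    refine integral_congr_ae (ae_of_all _ fun ζ => ?_)
    simp only [inner_zero_left, Complex.ofReal_zero, neg_zero, zero_mul, Complex.exp_zero, one_mul,
      stableSymbol, RCLike.re_eq_complex_re, Complex.ofReal_re]
  unfold stableDensity invFourier
  rw [h1]
  refine mul_pos (by positivity) ?_
  have hint : Integrable fun ζ : E d => Real.exp (-(σ * ‖ζ‖ ^ (2 * s))) := by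
    refine (integrable_stableSymbol (d := d) hσ hs).norm.congr (ae_of_all _ fun ζ => ?_)
    exact norm_stableSymbol s σ ζ
  rw [integral_pos_iff_support_of_nonneg (fun _ => (Real.exp_pos _).le) hint]
  have : Function.support (fun ζ : E d => Real.exp (-(σ * ‖ζ‖ ^ (2 * s)))) = univ := by
    ext ζ
    simp [(Real.exp_pos _).ne']
  rw [this]
  exact isOpen_univ.measure_pos volume univ_nonempty

lemma stableDensity_smul_pos_iff {s σ a : ℝ} (ha : 0 < a) (hs : 0 < s) (x : E d) :
    0 < stableDensity s (a * σ) (a ^ (1 / (2 * s)) • x) ↔ 0 < stableDensity s σ x := by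
  have hb : 0 < a ^ (1 / (2 * s)) := Real.rpow_pos_of_pos ha _
  unfold stableDensity
  rw [invFourier_comp_smul hb, mul_pos_iff_of_pos_left (by positivity)]
  have : (fun ζ : E d => stableSymbol s (a * σ) ((a ^ (1 / (2 * s)))⁻¹ • ζ)) =
      stableSymbol s σ := by
    ext ζ
    rw [stableSymbol_smul (by positivity), Real.inv_rpow hb.le, ← Real.rpow_mul ha.le]
    have : 1 / (2 * s) * (2 * s) = 1 := by field_simp
    rw [this, Real.rpow_one, inv_mul_cancel_left₀ ha.ne']
  rw [this]

lemma stableDensity_spec {s : ℝ} (hs : s ∈ Icc (1 / 2 : ℝ) 1)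
    (hex : ∃ γ : Measure (E d), IsProbabilityMeasure γ ∧ charFun γ = stableSymbol s 1)
    {σ : ℝ} (hσ : 0 < σ) :
    (∀ x : E d, 0 ≤ stableDensity s σ x) ∧
      IsProbabilityMeasure (lawOf (stableDensity s σ : E d → ℝ)) ∧
      charFun (lawOf (stableDensity s σ : E d → ℝ)) = stableSymbol s σ := by
  obtain ⟨γ, hγ, hc⟩ := exists_stableLaw_time (by linarith [hs.1]) hex hσ
  have hi : Integrable (charFun γ) := by rw [hc]; exact integrable_stableSymbol hσ hs.1
  obtain ⟨h1, h2⟩ := eq_withDensity_invFourier γ hi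
  rw [hc] at h1 h2
  have h3 : lawOf (stableDensity s σ : E d → ℝ) = γ := h2.symm
  exact ⟨h1, h3 ▸ hγ, h3 ▸ hc⟩

/-- Chapman–Kolmogorov for the stable semigroup, at the level of positivity sets. -/
lemma stableDensity_add_pos {s : ℝ} (hs : s ∈ Icc (1 / 2 : ℝ) 1)
    (hex : ∃ γ : Measure (E d), IsProbabilityMeasure γ ∧ charFun γ = stableSymbol s 1)
    {σ τ : ℝ} (hσ : 0 < σ) (hτ : 0 < τ) {x y : E d}
    (hx : 0 < stableDensity s σ x) (hy : 0 < stableDensity s τ y) :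
    0 < stableDensity s (σ + τ) (x + y) := by
  obtain ⟨hσ0, hσp, hσc⟩ := stableDensity_spec hs hex hσ
  obtain ⟨hτ0, -, -⟩ := stableDensity_spec hs hex hτ
  have hcσ := continuous_stableDensity (d := d) hσ hs.1
  have hcτ := continuous_stableDensity (d := d) hτ hs.1
  have hsym : stableSymbol s (σ + τ) = fun ζ : E d =>
      charFun (lawOf (stableDensity s σ : E d → ℝ)) ζ * stableSymbol s τ ζ := by
    ext ζ
    rw [hσc, stableSymbol_add]
  have hτi := integrable_stableSymbol (d := d) hτ hs.1
  have heq : stableDensity s (σ + τ) (x + y) = ∫ z, stableDensity s τ (x + y - z)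
      ∂(lawOf (stableDensity s σ : E d → ℝ)) := by
    rw [stableDensity, hsym]
    exact invFourier_charFun_mul _ hτi _
  rw [heq]
  -- the integrand is continuous, nonnegative and positive near `z = x`, where the law has mass
  have hbdd : ∀ z, ‖stableDensity s τ (x + y - z)‖ ≤
      ((2 * Real.pi) ^ d)⁻¹ * ∫ ζ : E d, ‖stableSymbol s τ ζ‖ := fun z => by
    have h := abs_invFourier_sub_le hτi (integrable_zero (E d) ℂ volume) (x + y - z)
    have h0 : invFourier (0 : E d → ℂ) (x + y - z) = 0 := by simp [invFourier]
    rw [h0] at h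
    simpa [stableDensity] using h
  have hint : Integrable (fun z => stableDensity s τ (x + y - z))
      (lawOf (stableDensity s σ : E d → ℝ)) :=
    Integrable.of_bound (hcτ.comp (continuous_const.sub continuous_id)).aestronglyMeasurable _
      (ae_of_all _ hbdd)
  rw [integral_pos_iff_support_of_nonneg (fun z => hτ0 _) hint, lawOf]
  have hop : IsOpen {z : E d | 0 < stableDensity s σ z ∧ 0 < stableDensity s τ (x + y - z)} :=
    (isOpen_lt continuous_const hcσ).inter
      (isOpen_lt continuous_const (hcτ.comp (continuous_const.sub continuous_id)))
  have hmem : x ∈ {z : E d | 0 < stableDensity s σ z ∧ 0 < stableDensity s τ (x + y - z)} :=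
    ⟨hx, by simpa using hy⟩
  refine lt_of_lt_of_le ?_ (measure_mono (s := {z : E d | 0 < stableDensity s σ z ∧
    0 < stableDensity s τ (x + y - z)}) fun z hz => hz.2.ne')
  rw [withDensity_apply _ hop.measurableSet, setLIntegral_pos_iff (by fun_prop)]
  refine lt_of_lt_of_le (hop.measure_pos volume ⟨x, hmem⟩) (measure_mono fun z hz => ⟨?_, hz⟩)
  exact (ENNReal.ofReal_pos.2 hz.1).ne'

/-- The positivity set of a stable density is stable under the combinations
`a^{1/2s} x + (1-a)^{1/2s} y`. -/
lemma stableDensity_combination_pos {s : ℝ} (hs : s ∈ Icc (1 / 2 : ℝ) 1)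
    (hex : ∃ γ : Measure (E d), IsProbabilityMeasure γ ∧ charFun γ = stableSymbol s 1)
    {σ a : ℝ} (hσ : 0 < σ) (ha : a ∈ Ioo (0 : ℝ) 1) {x y : E d}
    (hx : 0 < stableDensity s σ x) (hy : 0 < stableDensity s σ y) :
    0 < stableDensity s σ (a ^ (1 / (2 * s)) • x + (1 - a) ^ (1 / (2 * s)) • y) := by
  have h1a : 0 < 1 - a := by linarith [ha.2]
  have hs0 : 0 < s := by linarith [hs.1]
  have := stableDensity_add_pos hs hex (mul_pos ha.1 hσ) (mul_pos h1a hσ)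
    ((stableDensity_smul_pos_iff ha.1 hs0 x).2 hx) ((stableDensity_smul_pos_iff h1a hs0 y).2 hy)
  rwa [← add_mul, add_sub_cancel, one_mul] at this

/-- For `2s > 1` the positivity set contains a ball and is invariant under a dilation. -/
lemma stableDensity_pos_of_half_lt {s : ℝ} (hs : s ∈ Icc (1 / 2 : ℝ) 1)
    (hex : ∃ γ : Measure (E d), IsProbabilityMeasure γ ∧ charFun γ = stableSymbol s 1)
    (hs' : 1 / 2 < s) {σ : ℝ} (hσ : 0 < σ) (x : E d) :
    0 < stableDensity s σ x := by
  set κ : ℝ := 2 * (1 / 2 : ℝ) ^ (1 / (2 * s)) with hκ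
  have hκ1 : 1 < κ := by
    have h1 : (1 / 2 : ℝ) ^ (1 : ℝ) < (1 / 2 : ℝ) ^ (1 / (2 * s)) := by
      refine Real.rpow_lt_rpow_of_exponent_gt (by norm_num) (by norm_num) ?_
      rw [div_lt_one (by linarith)]
      linarith
    rw [Real.rpow_one] at h1
    linarith
  have hstep : ∀ y : E d, 0 < stableDensity s σ y → 0 < stableDensity s σ (κ • y) := by
    intro y hy
    have := stableDensity_combination_pos hs hex hσ (a := 1 / 2) ⟨by norm_num, by norm_num⟩ hy hy
    rw [← add_smul] at this
    convert this using 2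
    rw [hκ]
    norm_num
    ring_nf
  have hiter : ∀ n : ℕ, ∀ y : E d, 0 < stableDensity s σ y → 0 < stableDensity s σ (κ ^ n • y) := by
    intro n
    induction n with
    | zero => intro y hy; simpa using hy
    | succ n ih =>
      intro y hy
      rw [pow_succ', mul_smul]
      exact hstep _ (ih y hy)
  have hlim : Tendsto (fun n : ℕ => (κ⁻¹) ^ n • x) atTop (𝓝 0) := by
    have h := tendsto_pow_atTop_nhds_zero_of_lt_one (r := κ⁻¹) (by positivity)
      (inv_lt_one_of_one_lt₀ hκ1)
    simpa using h.smul_const x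
  have hev := ((continuous_stableDensity hσ hs.1).tendsto 0).comp hlim |>.eventually_const_lt
    (stableDensity_zero_pos (d := d) hσ hs.1)
  obtain ⟨n, hn⟩ := hev.exists
  have := hiter n _ hn
  rwa [smul_smul, ← mul_pow, mul_inv_cancel₀ (by positivity), one_pow, one_smul] at this

/-- For `2s = 1` the positivity set is convex and radial, hence a ball or the whole space. A ball
would give compact support and a twice differentiable characteristic function, whereas
`e^{-σ|ζ|}` has a corner at the origin. -/
lemma stableDensity_pos_of_eq_half {s : ℝ} (hs : s ∈ Icc (1 / 2 : ℝ) 1)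
    (hex : ∃ γ : Measure (E d), IsProbabilityMeasure γ ∧ charFun γ = stableSymbol s 1)
    (hs' : s = 1 / 2) {σ : ℝ} (hσ : 0 < σ) (x : E d) :
    0 < stableDensity s σ x := by
  by_contra hx
  obtain ⟨h0, hprob, hchar⟩ := stableDensity_spec hs hex hσ
  have hzero := stableDensity_zero_pos (d := d) hσ hs.1
  have hx0 : x ≠ 0 := by rintro rfl; exact hx hzero
  have hout : ∀ y : E d, ‖x‖ ≤ ‖y‖ → stableDensity s σ y = 0 := by
    intro y hy
    refine le_antisymm (not_lt.1 fun hpos => hx ?_) (h0 y)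
    have hxp : 0 < ‖x‖ := norm_pos_iff.2 hx0
    -- rotate `y` onto the ray through `x`
    set z : E d := (‖y‖ / ‖x‖) • x with hz
    have hnorm : ‖y‖ = ‖z‖ := by
      rw [hz, norm_smul, Real.norm_of_nonneg (by positivity), div_mul_cancel₀ _ hxp.ne']
    have hzpos : 0 < stableDensity s σ z := by
      rw [← Submodule.reflection_sub hnorm]
      unfold stableDensity
      rwa [invFourier_isometry _ fun ζ => by simp [stableSymbol]]
    have hxz : x = (‖x‖ / ‖y‖) • z := by
      rw [hz, smul_smul, div_mul_div_cancel₀ (by linarith), div_self hxp.ne', one_smul]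
    rcases hy.eq_or_lt with heq | hlt
    · rw [hxz, ← heq, div_self hxp.ne', one_smul]
      exact hzpos
    · have := stableDensity_combination_pos hs hex hσ (a := ‖x‖ / ‖y‖)
        ⟨div_pos hxp (hxp.trans hlt), (div_lt_one (by linarith)).2 hlt⟩ hzpos hzero
      rw [hs'] at this ⊢
      norm_num at this
      rw [hxz]
      exact this
  set γ := lawOf (stableDensity s σ : E d → ℝ) with hγ
  have hsupp : ∀ᵐ y ∂γ, ‖y‖ ≤ ‖x‖ := by
    have hcd := continuous_stableDensity (d := d) hσ hs.1
    rw [hγ, lawOf, ae_withDensity_iff (by fun_prop)]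
    refine ae_of_all _ fun y hy => ?_
    by_contra! hlt
    exact hy (by rw [hout y hlt.le, ENNReal.ofReal_zero])
  set e : E d := ‖x‖⁻¹ • x with he
  have hen : ‖e‖ = 1 := norm_smul_inv_norm (𝕜 := ℝ) hx0
  have hquad : ∀ τ : ℝ, 0 < τ → 1 - Real.exp (-(σ * τ)) ≤ (‖x‖ * τ) ^ 2 / 2 := by
    intro τ hτ
    have h1 : (charFun γ (τ • e)).re = Real.exp (-(σ * τ)) := by
      rw [hchar, stableSymbol, Complex.ofReal_re, norm_smul, hen, Real.norm_of_nonneg hτ.le, hs']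
      norm_num
    have h2 : (charFun γ (τ • e)).re = ∫ y, Real.cos ⟪y, τ • e⟫ ∂γ := by
      rw [charFun_apply, ← RCLike.re_eq_complex_re, ← integral_re (integrable_exp_inner γ _)]
      refine integral_congr_ae (ae_of_all _ fun y => ?_)
      simp only [RCLike.re_eq_complex_re, Complex.exp_ofReal_mul_I_re]
    have h3 : ∫ y, (1 - (‖x‖ * τ) ^ 2 / 2) ∂γ ≤ ∫ y, Real.cos ⟪y, τ • e⟫ ∂γ := by
      refine integral_mono_ae (integrable_const _) ?_ ?_
      · exact Integrable.of_bound (Continuous.aestronglyMeasurable (by fun_prop)) 1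
          (ae_of_all _ fun y => Real.abs_cos_le_one _)
      · filter_upwards [hsupp] with y hy
        have hi : |⟪y, τ • e⟫| ≤ ‖x‖ * τ := by
          refine (abs_real_inner_le_norm _ _).trans ?_
          rw [norm_smul, hen, mul_one, Real.norm_of_nonneg hτ.le]
          gcongr
        have hsq : ⟪y, τ • e⟫ ^ 2 ≤ (‖x‖ * τ) ^ 2 := sq_le_sq' (abs_le.1 hi).1 (abs_le.1 hi).2
        linarith [Real.one_sub_sq_div_two_le_cos (x := ⟪y, τ • e⟫)]
    rw [← h2, h1] at h3
    simp only [integral_const, probReal_univ, one_smul] at h3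
    linarith
  -- a small `τ` contradicts the quadratic bound
  set τ : ℝ := σ / (1 + ‖x‖ ^ 2 + σ ^ 2) with hτ
  have hD : 0 < 1 + ‖x‖ ^ 2 + σ ^ 2 := by positivity
  have hτ0 : 0 < τ := by positivity
  have h1 := hquad τ hτ0
  have hστ : σ * τ ≤ 1 := by
    rw [hτ, ← mul_div_assoc, div_le_one hD]
    nlinarith [sq_nonneg ‖x‖]
  have h2 : ‖x‖ ^ 2 * τ < σ := by
    rw [hτ, ← mul_div_assoc, div_lt_iff₀ hD]
    nlinarith [sq_nonneg ‖x‖, pow_pos hσ 3]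
  have h3 : Real.exp (-(σ * τ)) ≤ 1 - σ * τ / 2 := by
    have hst : 0 < σ * τ := by positivity
    have h4 : Real.exp (-(σ * τ)) * (1 + σ * τ) ≤ 1 := by
      calc Real.exp (-(σ * τ)) * (1 + σ * τ) ≤ Real.exp (-(σ * τ)) * Real.exp (σ * τ) := by
            gcongr
            linarith [Real.add_one_le_exp (σ * τ)]
        _ = 1 := by rw [← Real.exp_add]; simp
    nlinarith
  nlinarith

lemma stableDensity_pos {s : ℝ} (hs : s ∈ Icc (1 / 2 : ℝ) 1)
    (hex : ∃ γ : Measure (E d), IsProbabilityMeasure γ ∧ charFun γ = stableSymbol s 1)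
    {σ : ℝ} (hσ : 0 < σ) (x : E d) : 0 < stableDensity s σ x := by
  rcases hs.1.eq_or_lt with h | h
  · exact stableDensity_pos_of_eq_half hs hex h.symm hσ x
  · exact stableDensity_pos_of_half_lt hs hex h hσ x

/-- Stable densities are bounded below on compact sets, uniformly in the index `2s ∈ [1, 2]`, by
joint continuity in index, time and space. -/
lemma exists_stableDensity_lower_bound
    (hex : ∀ s ∈ Icc (1 / 2 : ℝ) 1, ∃ γ : Measure (E d), IsProbabilityMeasure γ ∧
      charFun γ = stableSymbol s 1) {σ₀ σ₁ : ℝ} (hσ₀ : 0 < σ₀) (hσ₁ : σ₀ ≤ σ₁) {A : ℝ}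
    (hA : 0 ≤ A) :
    ∃ c > 0, ∀ s ∈ Icc (1 / 2 : ℝ) 1, ∀ σ ∈ Icc σ₀ σ₁, ∀ x ∈ Metric.closedBall (0 : E d) A,
      c ≤ stableDensity s σ x := by
  let K : Set (ℝ × ℝ × E d) := Icc (1 / 2 : ℝ) 1 ×ˢ Icc σ₀ σ₁ ×ˢ Metric.closedBall (0 : E d) A
  have hK : IsCompact K := isCompact_Icc.prod (isCompact_Icc.prod (isCompact_closedBall _ _))
  have hne : K.Nonempty := ⟨((1 : ℝ), σ₀, (0 : E d)), mk_mem_prod (right_mem_Icc.2 (by norm_num))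
    (mk_mem_prod (left_mem_Icc.2 hσ₁) (Metric.mem_closedBall_self hA))⟩
  have hcont : ContinuousOn (fun p : ℝ × ℝ × E d => stableDensity p.1 p.2.1 p.2.2) K := by
    unfold stableDensity invFourier
    refine continuousOn_const.mul (Complex.continuous_re.comp_continuousOn ?_)
    refine continuousOn_of_dominated (F := fun (p : ℝ × ℝ × E d) (ζ : E d) =>
        Complex.exp (-(⟪p.2.2, ζ⟫ : ℂ) * Complex.I) * stableSymbol p.1 p.2.1 ζ)
      (bound := fun ζ => ((d + 1)! * σ₀⁻¹ ^ (d + 1) * Real.exp σ₀ * Real.exp σ₀) * freqWeight ζ)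
      ?_ ?_ (integrable_freqWeight.const_mul _) ?_
    · rintro p ⟨hp1, hp2, -⟩
      exact (integrable_exp_neg_inner_mul
        (integrable_stableSymbol (hσ₀.trans_le hp2.1) hp1.1) _).1
    · rintro p ⟨hp1, hp2, -⟩
      refine ae_of_all _ fun ζ => ?_
      rw [norm_exp_neg_inner_mul]
      exact norm_stableSymbol_le hσ₀ hp2.1 hp1.1 ζ
    · refine ae_of_all _ fun ζ => ContinuousOn.mul (by fun_prop) ?_
      unfold stableSymbol
      refine Complex.continuous_ofReal.comp_continuousOn
        (Real.continuous_exp.comp_continuousOn (ContinuousOn.neg (ContinuousOn.mul ?_ ?_)))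
      · fun_prop
      · refine ContinuousOn.rpow continuousOn_const (by fun_prop) ?_
        rintro p ⟨hp1, -, -⟩
        right
        linarith [hp1.1]
  obtain ⟨⟨s₀, τ₀, x₀⟩, hp, hmin⟩ := hK.exists_isMinOn hne hcont
  obtain ⟨h1, h2, -⟩ := hp
  refine ⟨stableDensity s₀ τ₀ x₀, stableDensity_pos h1 (hex _ h1) (hσ₀.trans_le h2.1) _, ?_⟩
  intro s hs σ hσ x hx
  exact isMinOn_iff.1 hmin (s, σ, x) (mk_mem_prod hs (mk_mem_prod hσ hx))

/-! ### Nondegeneracy of the jump law -/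

/-- The low frequency expansion `1 - |ζ|^{2s} + O(|ζ|^{2s+δ})` of the characteristic function
of a law, with explicit constant. -/
def LowFreq (C₀ δ s : ℝ) (P : Measure (E d)) : Prop :=
  ∀ ζ : E d, ‖ζ‖ ≤ 1 →
    ‖charFun P ζ - (1 - ((‖ζ‖ ^ (2 * s) : ℝ) : ℂ))‖ ≤ C₀ * ‖ζ‖ ^ (2 * s + δ)

lemma exists_small_radius {C δ η : ℝ} (hC : 0 < C) (hδ : 0 < δ) (hη : 0 < η) :
    ∃ r > 0, r ≤ 1 ∧ C * r ^ δ ≤ η := by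
  refine ⟨min 1 ((η / C) ^ (1 / δ)), by positivity, min_le_left _ _, ?_⟩
  have h : (min 1 ((η / C) ^ (1 / δ))) ^ δ ≤ η / C := by
    refine (Real.rpow_le_rpow (by positivity) (min_le_right _ _) hδ.le).trans (le_of_eq ?_)
    rw [← Real.rpow_mul (by positivity), one_div, inv_mul_cancel₀ hδ.ne', Real.rpow_one]
  calc C * _ ≤ C * (η / C) := by gcongr
    _ = η := by field_simp

/-- Laws with a common low frequency expansion are uniformly nondegenerate in every direction. -/
lemma exists_nondegenerate {C₀ δ : ℝ} (hC₀ : 0 < C₀) (hδ : 0 < δ) :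
    ∃ κ > 0, ∃ p > 0, ∀ s ∈ Ioo (1 / 2 : ℝ) 1, ∀ P : Measure (E d), IsProbabilityMeasure P →
      LowFreq C₀ δ s P → ∀ e : E d, ‖e‖ = 1 → p ≤ P.real {x | κ ≤ |⟪e, x⟫|} := by
  obtain ⟨r, hr, hr1, hrC⟩ := exists_small_radius hC₀ hδ (show (0 : ℝ) < 1 / 2 by norm_num)
  refine ⟨r / 4, by positivity, r ^ 2 / 8, by positivity, fun s hs P hP hlow e he => ?_⟩
  have hn : ‖r • e‖ = r := by rw [norm_smul, he, mul_one, Real.norm_of_nonneg hr.le]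
  have h1 := hlow (r • e) (by rw [hn]; exact hr1)
  rw [hn, Real.rpow_add hr] at h1
  have hr2 : r ^ 2 ≤ r ^ (2 * s) := by
    rw [← Real.rpow_natCast]
    refine Real.rpow_le_rpow_of_exponent_ge hr hr1 ?_
    push_cast
    linarith [hs.2]
  have hrs : 0 < r ^ (2 * s) := Real.rpow_pos_of_pos hr _
  have h2 : r ^ 2 / 2 ≤ ‖charFun P (r • e) - 1‖ := by
    have h3 : ‖((r ^ (2 * s) : ℝ) : ℂ)‖ ≤ ‖charFun P (r • e) - 1‖ +
        ‖charFun P (r • e) - (1 - ((r ^ (2 * s) : ℝ) : ℂ))‖ := by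
      rw [← norm_neg (charFun P (r • e) - 1)]
      refine le_trans (le_of_eq ?_) (norm_add_le _ _)
      congr 1
      ring
    rw [Complex.norm_real, Real.norm_of_nonneg hrs.le] at h3
    nlinarith
  set A : Set (E d) := {x | r / 4 ≤ |⟪e, x⟫|} with hA
  have hAm : MeasurableSet A := measurableSet_le measurable_const (by fun_prop)
  have h3 : ‖charFun P (r • e) - 1‖ ≤ ∫ x, (r ^ 2 / 4 + A.indicator (fun _ => (2 : ℝ)) x) ∂P := by
    have : charFun P (r • e) - 1 =
        ∫ x, (Complex.exp ((⟪x, r • e⟫ : ℂ) * Complex.I) - 1) ∂P := by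
      rw [integral_sub (integrable_exp_inner P _) (integrable_const _), charFun_apply]
      simp
    rw [this]
    refine norm_integral_le_of_norm_le ?_ (ae_of_all _ fun x => ?_)
    · exact (integrable_const _).add ((integrable_const _).indicator hAm)
    · by_cases hx : x ∈ A
      · rw [indicator_of_mem hx]
        calc ‖Complex.exp ((⟪x, r • e⟫ : ℂ) * Complex.I) - 1‖
            ≤ ‖Complex.exp ((⟪x, r • e⟫ : ℂ) * Complex.I)‖ + ‖(1 : ℂ)‖ := norm_sub_le _ _
          _ = 2 := by rw [Complex.norm_exp_ofReal_mul_I]; norm_num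
          _ ≤ _ := by nlinarith
      · rw [indicator_of_notMem hx, add_zero, mul_comm]
        refine (Real.norm_exp_I_mul_ofReal_sub_one_le).trans ?_
        have hx' : |⟪e, x⟫| < r / 4 := not_le.1 hx
        rw [real_inner_smul_right, real_inner_comm, Real.norm_eq_abs, abs_mul, abs_of_pos hr]
        nlinarith
  rw [integral_add (integrable_const _) ((integrable_const _).indicator hAm),
    integral_indicator hAm] at h3
  simp only [integral_const, probReal_univ, smul_eq_mul, measureReal_restrict_apply_univ] at h3
  nlinarith

/-- Laws with a common low frequency expansion are uniformly tight. -/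
lemma exists_tight {C₀ δ : ℝ} (hC₀ : 0 < C₀) (hδ : 0 < δ) {q : ℝ} (hq : 0 < q) :
    ∃ M > 0, ∀ s ∈ Ioo (1 / 2 : ℝ) 1, ∀ P : Measure (E d), IsProbabilityMeasure P →
      LowFreq C₀ δ s P → P.real {x | M < ‖x‖} ≤ q := by
  set r : ℝ := max 2 (4 * (1 + C₀) * d / q) with hr
  have hr2 : 2 ≤ r := le_max_left _ _
  have hr0 : 0 < r := by linarith
  have hrq : d * (4 * (1 + C₀) / r) ≤ q := by
    have h : 4 * (1 + C₀) * d / q ≤ r := le_max_right _ _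
    rw [div_le_iff₀ hq] at h
    rw [← mul_div_assoc, div_le_iff₀ hr0]
    linarith
  refine ⟨(d + 1) * r, by positivity, fun s hs P hP hlow => ?_⟩
  have hcoord : ∀ i : Fin d, P.real {x | r < |⟪EuclideanSpace.single i (1 : ℝ), x⟫|} ≤
      4 * (1 + C₀) / r := by
    intro i
    set a : E d := EuclideanSpace.single i (1 : ℝ) with ha
    have han : ‖a‖ = 1 := by rw [ha]; simp
    refine (measureReal_abs_inner_gt_le_integral_charFun hr0).trans ?_
    have hb : ∀ u ∈ Set.uIoc (-2 * r⁻¹) (2 * r⁻¹), ‖1 - charFun P (u • a)‖ ≤ (1 + C₀) * (2 / r) := by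
      intro u hu
      rw [Set.uIoc_of_le (by nlinarith [inv_pos.2 hr0])] at hu
      have hu' : |u| ≤ 2 / r := by
        rw [abs_le, div_eq_mul_inv]
        constructor <;> linarith [hu.1, hu.2]
      have hu1 : |u| ≤ 1 := hu'.trans ((div_le_one hr0).2 hr2)
      have hn : ‖u • a‖ = |u| := by rw [norm_smul, han, mul_one, Real.norm_eq_abs]
      have h1 := hlow (u • a) (by rw [hn]; exact hu1)
      rw [hn] at h1
      have hp : ∀ p : ℝ, 1 ≤ p → |u| ^ p ≤ |u| := by
        intro p hp
        rcases (abs_nonneg u).eq_or_lt with h0 | h0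
        · rw [← h0, Real.zero_rpow (by linarith)]
        · simpa using Real.rpow_le_rpow_of_exponent_ge h0 hu1 hp
      have h2 : ‖1 - charFun P (u • a)‖ ≤ |u| ^ (2 * s) + C₀ * |u| ^ (2 * s + δ) := by
        have h3 : ‖1 - charFun P (u • a)‖ ≤ ‖((|u| ^ (2 * s) : ℝ) : ℂ)‖ +
            ‖charFun P (u • a) - (1 - ((|u| ^ (2 * s) : ℝ) : ℂ))‖ := by
          rw [← norm_neg (charFun P (u • a) - _)]
          refine le_trans (le_of_eq ?_) (norm_add_le _ _)
          congr 1
          ring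
        rw [Complex.norm_real, Real.norm_of_nonneg (by positivity)] at h3
        linarith
      have h4 := hp (2 * s) (by linarith [hs.1])
      have h5 := hp (2 * s + δ) (by linarith [hs.1])
      nlinarith
    have := intervalIntegral.norm_integral_le_of_norm_le_const hb
    calc 2⁻¹ * r * ‖∫ u in -2 * r⁻¹..2 * r⁻¹, 1 - charFun P (u • a)‖
        ≤ 2⁻¹ * r * ((1 + C₀) * (2 / r) * |2 * r⁻¹ - -2 * r⁻¹|) := by gcongr
      _ = 4 * (1 + C₀) / r := by
        have : |2 * r⁻¹ - -2 * r⁻¹| = 4 * r⁻¹ := by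
          rw [abs_of_pos (by nlinarith [inv_pos.2 hr0])]; ring
        rw [this]
        field_simp
  have hsub : {x : E d | (d + 1) * r < ‖x‖} ⊆
      ⋃ i : Fin d, {x | r < |⟪EuclideanSpace.single i (1 : ℝ), x⟫|} := by
    intro x hx
    by_contra hcon
    simp only [mem_iUnion, mem_ofPred_eq, not_exists, not_lt, EuclideanSpace.inner_single_left,
      map_one, one_mul] at hcon hx
    have h1 : ‖x‖ ≤ ∑ i, ‖x i‖ := by
      have h2 : x = ∑ i, x i • EuclideanSpace.single i (1 : ℝ) := by
        ext j
        simp [Finset.sum_apply, Pi.single_apply]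
      conv_lhs => rw [h2]
      refine (norm_sum_le _ _).trans (le_of_eq (Finset.sum_congr rfl fun i _ => ?_))
      rw [norm_smul]
      simp
    have h3 : ∑ i, ‖x i‖ ≤ ∑ _i : Fin d, r := Finset.sum_le_sum fun i _ => hcon i
    rw [Finset.sum_const, Finset.card_univ, Fintype.card_fin, nsmul_eq_mul] at h3
    nlinarith
  calc P.real {x | (d + 1) * r < ‖x‖}
      ≤ P.real (⋃ i : Fin d, {x | r < |⟪EuclideanSpace.single i (1 : ℝ), x⟫|}) :=
        measureReal_mono hsub
    _ ≤ ∑ i : Fin d, P.real {x | r < |⟪EuclideanSpace.single i (1 : ℝ), x⟫|} :=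
        measureReal_iUnion_fintype_le _
    _ ≤ ∑ _i : Fin d, 4 * (1 + C₀) / r := Finset.sum_le_sum fun i _ => hcoord i
    _ ≤ q := by simpa using hrq

/-- A finite net of the unit sphere. -/
lemma exists_sphere_net (hd : 0 < d) {h : ℝ} (hh : 0 < h) :
    ∃ K : ℕ, 0 < K ∧ ∃ e : ℕ → E d, (∀ i < K, ‖e i‖ = 1) ∧
      ∀ w : E d, ‖w‖ = 1 → ∃ i < K, ‖w - e i‖ < h := by
  obtain ⟨T, hT, hfin, hcov⟩ := (isCompact_sphere (0 : E d) 1).finite_cover_balls hh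
  let L := hfin.toFinset.toList
  have hLmem : ∀ x, x ∈ L ↔ x ∈ T := by simp [L]
  have hnet : ∀ w : E d, ‖w‖ = 1 → ∃ i < L.length, ‖w - L.getD i 0‖ < h := by
    intro w hw
    have hw' := hcov (show w ∈ Metric.sphere (0 : E d) 1 by simpa using hw)
    simp only [mem_iUnion, exists_prop] at hw'
    obtain ⟨y, hy, hwy⟩ := hw'
    obtain ⟨i, hi, hget⟩ := List.getElem_of_mem ((hLmem y).2 hy)
    refine ⟨i, hi, ?_⟩
    rw [List.getD_eq_getElem _ _ hi, hget, ← dist_eq_norm]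
    exact hwy
  refine ⟨L.length, ?_, fun i => L.getD i 0, fun i hi => ?_, hnet⟩
  · obtain ⟨i, hi, -⟩ := hnet (EuclideanSpace.single ⟨0, hd⟩ (1 : ℝ)) (by simp)
    exact Nat.zero_lt_of_lt hi
  · have := hT ((hLmem _).1 (List.getElem_mem hi))
    change ‖L.getD i 0‖ = 1
    rw [List.getD_eq_getElem _ _ hi]
    simpa using this

/-- Finitely many truncated double cones, each charged by all laws with the given low frequency
expansion, such that every frequency is transversal to all vectors of one of them. -/
lemma exists_sectors (hd : 0 < d) {C₀ δ : ℝ} (hC₀ : 0 < C₀) (hδ : 0 < δ) :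
    ∃ κ > 0, ∃ p > 0, ∃ K : ℕ, 0 < K ∧ ∃ A : ℕ → Set (E d),
      (∀ ζ : E d, ∃ i < K, ∀ v ∈ A i, κ * ‖ζ‖ ≤ |⟪v, ζ⟫|) ∧
      ∀ s ∈ Ioo (1 / 2 : ℝ) 1, ∀ P : Measure (E d), IsProbabilityMeasure P →
        LowFreq C₀ δ s P → ∀ i < K, p ≤ P.real (A i) := by
  obtain ⟨κ, hκ, p, hp, hnd⟩ := exists_nondegenerate (d := d) hC₀ hδ
  obtain ⟨M, hM, htight⟩ := exists_tight (d := d) hC₀ hδ (half_pos hp)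
  obtain ⟨K, hK, e, he, hnet⟩ := exists_sphere_net hd (h := κ / (2 * M)) (by positivity)
  refine ⟨κ / 2, half_pos hκ, p / 2, half_pos hp, K, hK,
    fun i => {x | κ ≤ |⟪e i, x⟫|} \ {x | M < ‖x‖}, fun ζ => ?_, ?_⟩
  · rcases eq_or_ne ζ 0 with rfl | hζ
    · exact ⟨0, hK, fun v _ => by simp⟩
    · have hζp : 0 < ‖ζ‖ := norm_pos_iff.2 hζ
      obtain ⟨i, hi, hclose⟩ := hnet (‖ζ‖⁻¹ • ζ) (norm_smul_inv_norm (𝕜 := ℝ) hζ)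
      refine ⟨i, hi, fun v hv => ?_⟩
      obtain ⟨hv1, hv2⟩ := hv
      simp only [mem_ofPred_eq, not_lt] at hv1 hv2
      have h1 : |⟪v, ‖ζ‖⁻¹ • ζ - e i⟫| ≤ κ / 2 := by
        refine (abs_real_inner_le_norm _ _).trans ?_
        calc ‖v‖ * ‖‖ζ‖⁻¹ • ζ - e i‖ ≤ M * (κ / (2 * M)) := by gcongr
          _ = κ / 2 := by field_simp
      have h2 : κ / 2 ≤ |⟪v, ‖ζ‖⁻¹ • ζ⟫| := by
        have h3 : |⟪e i, v⟫| ≤ |⟪v, ‖ζ‖⁻¹ • ζ⟫| + |⟪v, ‖ζ‖⁻¹ • ζ - e i⟫| := by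
          rw [real_inner_comm v (e i), inner_sub_right]
          refine le_trans (le_of_eq ?_) (abs_sub _ _)
          congr 1
          ring
        linarith
      rw [real_inner_smul_right, abs_mul, abs_of_pos (inv_pos.2 hζp), ← div_eq_inv_mul,
        le_div_iff₀ hζp] at h2
      exact h2
  · intro s hs P hP hlow i hi
    have h1 := hnd s hs P hP hlow (e i) (he i hi)
    have h2 := htight s hs P hP hlow
    have h3 := le_measureReal_sdiff (μ := P) (s₁ := {x | κ ≤ |⟪e i, x⟫|}) (s₂ := {x : E d | M < ‖x‖})
    linarith

/-! ### The jump intensity and its sectors -/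

/-- The intensity, per unit jump rate, of the jumps `e^{-r} ξ` accumulated by the drift over
ages `r ∈ (0, t]`, where `ξ` has law `P`. -/
def jumpMeasure (t : ℝ) (P : Measure (E d)) : Measure (E d) :=
  (((volume : Measure ℝ).restrict (Ioc 0 t)).prod P).map fun p => Real.exp (-p.1) • p.2

/-- The part of `jumpMeasure t P` coming from `ξ ∈ A`, with ages weighted by `e^{-r} ≤ 1`. The
weight makes the contraction factor `e^{-r}` uniformly distributed on `[e^{-t}, 1]`. -/
def sectorMeasure (t : ℝ) (P : Measure (E d)) (A : Set (E d)) : Measure (E d) :=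
  ((((volume : Measure ℝ).restrict (Ioc 0 t)).withDensity
    fun r => ENNReal.ofReal (Real.exp (-r))).prod (P.restrict A)).map
      fun p => Real.exp (-p.1) • p.2

lemma withDensity_exp_le (t : ℝ) :
    ((volume : Measure ℝ).restrict (Ioc 0 t)).withDensity
      (fun r => ENNReal.ofReal (Real.exp (-r))) ≤ (volume : Measure ℝ).restrict (Ioc 0 t) := by
  conv_rhs => rw [← withDensity_one (μ := (volume : Measure ℝ).restrict (Ioc 0 t))]
  refine withDensity_mono ?_
  filter_upwards [ae_restrict_mem measurableSet_Ioc] with r hr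
  rw [Pi.one_apply, ← ENNReal.ofReal_one]
  exact ENNReal.ofReal_le_ofReal (Real.exp_le_one_iff.2 (by linarith [hr.1]))

instance isFiniteMeasure_withDensity_exp (t : ℝ) :
    IsFiniteMeasure (((volume : Measure ℝ).restrict (Ioc 0 t)).withDensity
      fun r => ENNReal.ofReal (Real.exp (-r))) :=
  isFiniteMeasure_of_le _ (withDensity_exp_le t)

instance isFiniteMeasure_jumpMeasure (t : ℝ) (P : Measure (E d)) [IsFiniteMeasure P] :
    IsFiniteMeasure (jumpMeasure t P) := by unfold jumpMeasure; infer_instance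

instance isFiniteMeasure_sectorMeasure (t : ℝ) (P : Measure (E d)) [IsFiniteMeasure P]
    (A : Set (E d)) : IsFiniteMeasure (sectorMeasure t P A) := by
  unfold sectorMeasure; infer_instance

lemma sectorMeasure_le (t : ℝ) (P : Measure (E d)) [IsFiniteMeasure P] (A : Set (E d)) :
    sectorMeasure t P A ≤ jumpMeasure t P :=
  Measure.map_mono (Measure.prod_mono (withDensity_exp_le t) Measure.restrict_le_self)
    (by fun_prop)

lemma charFun_jumpMeasure {t : ℝ} (ht : 0 ≤ t) (P : Measure (E d)) [IsFiniteMeasure P] (ζ : E d) :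
    charFun (jumpMeasure t P) ζ = ∫ r in (0 : ℝ)..t, charFun P (Real.exp (-r) • ζ) := by
  rw [charFun_apply, jumpMeasure, integral_map (by fun_prop)
    (Continuous.aestronglyMeasurable (by fun_prop)), intervalIntegral.integral_of_le ht,
    integral_prod]
  · refine integral_congr_ae (ae_of_all _ fun r => ?_)
    simp only [charFun_apply, real_inner_smul_left, real_inner_smul_right]
  · refine Integrable.of_bound (Continuous.aestronglyMeasurable (by fun_prop)) 1
      (ae_of_all _ fun p => ?_)
    rw [Complex.norm_exp_ofReal_mul_I]

lemma jumpMeasure_real_univ {t : ℝ} (ht : 0 ≤ t) (P : Measure (E d)) [IsProbabilityMeasure P] :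
    (jumpMeasure t P).real univ = t := by
  have h := charFun_jumpMeasure ht P 0
  simp only [charFun_zero, smul_zero, probReal_univ, Complex.ofReal_one,
    intervalIntegral.integral_const, sub_zero, Complex.real_smul, mul_one] at h
  exact_mod_cast h

lemma charFun_sectorMeasure {t : ℝ} (ht : 0 ≤ t) (P : Measure (E d)) [IsFiniteMeasure P]
    (A : Set (E d)) (ζ : E d) :
    charFun (sectorMeasure t P A) ζ = ∫ v in A, (∫ r in (0 : ℝ)..t,
      (Real.exp (-r) : ℂ) * Complex.exp ((Real.exp (-r) * ⟪v, ζ⟫ : ℝ) * Complex.I)) ∂P := by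
  rw [charFun_apply, sectorMeasure, integral_map (by fun_prop)
    (Continuous.aestronglyMeasurable (by fun_prop)), integral_prod_symm]
  · refine integral_congr_ae (ae_of_all _ fun v => ?_)
    simp only
    rw [integral_withDensity_eq_integral_toReal_smul (by fun_prop)
      (ae_of_all _ fun _ => ENNReal.ofReal_lt_top), intervalIntegral.integral_of_le ht]
    refine integral_congr_ae (ae_of_all _ fun r => ?_)
    simp only [real_inner_smul_left]
    rw [ENNReal.toReal_ofReal (Real.exp_pos _).le, Complex.real_smul]
  · refine Integrable.of_bound (Continuous.aestronglyMeasurable (by fun_prop)) 1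
      (ae_of_all _ fun p => ?_)
    rw [Complex.norm_exp_ofReal_mul_I]

lemma integral_exp_neg_eq (t : ℝ) : ∫ r in (0 : ℝ)..t, Real.exp (-r) = 1 - Real.exp (-t) := by
  rw [intervalIntegral.integral_comp_neg (fun r => Real.exp r), integral_exp]
  simp

/-- The oscillatory integral over ages, computed exactly since `e^{-r} dr` is the differential
of the phase. -/
lemma norm_age_integral (t z : ℝ) :
    ‖∫ r in (0 : ℝ)..t, (Real.exp (-r) : ℂ) * Complex.exp ((Real.exp (-r) * z : ℝ) * Complex.I)‖
      * |z| = 2 * |Real.sin ((1 - Real.exp (-t)) * z / 2)| := by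
  have hder : ∀ r : ℝ, HasDerivAt
      (fun r : ℝ => -Complex.exp ((Real.exp (-r) * z : ℝ) * Complex.I))
      (((Real.exp (-r) : ℂ) * Complex.exp ((Real.exp (-r) * z : ℝ) * Complex.I)) *
        (z * Complex.I)) r := by
    intro r
    have h1 : HasDerivAt (fun r : ℝ => Real.exp (-r) * z) (-Real.exp (-r) * z) r := by
      have := ((hasDerivAt_neg r).exp.mul_const z)
      simpa using this
    have h2 := ((h1.ofReal_comp.mul_const Complex.I).cexp).neg
    refine h2.congr_deriv ?_
    simp only [Complex.ofReal_mul, Complex.ofReal_neg]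
    ring
  have hint := intervalIntegral.integral_eq_sub_of_hasDerivAt (a := 0) (b := t)
    (fun r _ => hder r) (Continuous.intervalIntegrable (by fun_prop) _ _)
  rw [intervalIntegral.integral_mul_const] at hint
  have h3 : ‖(∫ r in (0 : ℝ)..t, (Real.exp (-r) : ℂ) *
      Complex.exp ((Real.exp (-r) * z : ℝ) * Complex.I)) * (z * Complex.I)‖ =
      ‖∫ r in (0 : ℝ)..t, (Real.exp (-r) : ℂ) *
        Complex.exp ((Real.exp (-r) * z : ℝ) * Complex.I)‖ * |z| := by
    rw [norm_mul, norm_mul, Complex.norm_I, mul_one, Complex.norm_real, Real.norm_eq_abs]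
  rw [← h3, hint]
  have h4 : -Complex.exp ((Real.exp (-t) * z : ℝ) * Complex.I) -
      -Complex.exp ((Real.exp (-0) * z : ℝ) * Complex.I) =
      Complex.exp ((Real.exp (-t) * z : ℝ) * Complex.I) *
        (Complex.exp (Complex.I * ((1 - Real.exp (-t)) * z : ℝ)) - 1) := by
    have h5 : ((Real.exp (-t) * z : ℝ) : ℂ) * Complex.I +
        Complex.I * ((1 - Real.exp (-t)) * z : ℝ) = ((Real.exp (-0) * z : ℝ) : ℂ) * Complex.I := by
      rw [neg_zero, Real.exp_zero]
      push_cast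
      ring
    rw [mul_sub, ← Complex.exp_add, h5]
    ring
  rw [h4, norm_mul, Complex.norm_exp_ofReal_mul_I, one_mul, Complex.norm_exp_I_mul_ofReal_sub_one,
    norm_mul, Real.norm_eq_abs, Real.norm_eq_abs, abs_of_pos (by norm_num : (0 : ℝ) < 2)]

/-- Away from the origin, `|sin y| / y` is bounded away from one. -/
lemma exists_sinc_bound {y₀ : ℝ} (hy₀ : 0 < y₀) :
    ∃ S : ℝ, 0 < S ∧ S < 1 ∧ ∀ y, y₀ ≤ y → |Real.sin y| ≤ S * y := by
  set a := min y₀ 2 / 2 with ha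
  have ha0 : 0 < a := by positivity
  have ha1 : a ≤ 1 := by rw [ha]; linarith [min_le_right y₀ 2]
  have hpi := Real.pi_gt_three
  have hcos : Real.cos a < 1 := by
    have := Real.cos_lt_cos_of_nonneg_of_le_pi le_rfl (by linarith) ha0
    rwa [Real.cos_zero] at this
  refine ⟨max (Real.cos a) (1 / 2), by positivity, max_lt hcos (by norm_num), fun y hy => ?_⟩
  have hy0 : 0 < y := hy₀.trans_le hy
  rcases le_total 2 y with h2 | h2
  · calc |Real.sin y| ≤ 1 := Real.abs_sin_le_one y
      _ ≤ 1 / 2 * y := by linarith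
      _ ≤ _ := by gcongr; exact le_max_right _ _
  · have hay : a ≤ y / 2 := by rw [ha]; linarith [min_le_left y₀ 2]
    have hs0 : 0 ≤ Real.sin (y / 2) := Real.sin_nonneg_of_nonneg_of_le_pi (by linarith) (by linarith)
    have hs1 : Real.sin (y / 2) ≤ y / 2 := Real.sin_le (by linarith)
    have hc : Real.cos (y / 2) ≤ Real.cos a :=
      Real.cos_le_cos_of_nonneg_of_le_pi ha0.le (by linarith) hay
    have hc0 : 0 ≤ Real.cos (y / 2) := Real.cos_nonneg_of_mem_Icc ⟨by linarith, by linarith⟩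
    have hsin : Real.sin y = 2 * Real.sin (y / 2) * Real.cos (y / 2) := by
      rw [← Real.sin_two_mul]; ring_nf
    rw [hsin, abs_of_nonneg (by positivity)]
    calc 2 * Real.sin (y / 2) * Real.cos (y / 2) ≤ 2 * (y / 2) * Real.cos a := by gcongr
      _ = Real.cos a * y := by ring
      _ ≤ _ := by gcongr; exact le_max_left _ _

lemma sectorMeasure_real_univ {t : ℝ} (ht : 0 ≤ t) (P : Measure (E d)) [IsFiniteMeasure P]
    (A : Set (E d)) : (sectorMeasure t P A).real univ = (1 - Real.exp (-t)) * P.real A := by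
  have h := charFun_sectorMeasure ht P A 0
  simp only [charFun_zero, inner_zero_right, mul_zero, Complex.ofReal_zero, zero_mul,
    Complex.exp_zero, mul_one, intervalIntegral.integral_ofReal, integral_exp_neg_eq,
    integral_const, measureReal_restrict_apply_univ, Complex.real_smul] at h
  rw [mul_comm]
  exact_mod_cast h

/-- At frequencies transversal to a sector, its characteristic function is strictly smaller
than its mass, and decays like the inverse of the frequency. -/
lemma norm_charFun_sectorMeasure_le {t : ℝ} (ht : 0 < t) (P : Measure (E d)) [IsFiniteMeasure P]
    {A : Set (E d)} {ζ : E d} {a S y₀ : ℝ} (ha : 0 < a)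
    (hζ : ∀ v ∈ A, a ≤ |⟪v, ζ⟫|) (hS : ∀ y, y₀ ≤ y → |Real.sin y| ≤ S * y)
    (hy₀ : y₀ ≤ (1 - Real.exp (-t)) * a / 2) :
    ‖charFun (sectorMeasure t P A) ζ‖ ≤ (sectorMeasure t P A).real univ * S ∧
    ‖charFun (sectorMeasure t P A) ζ‖ ≤
      (sectorMeasure t P A).real univ * (2 / ((1 - Real.exp (-t)) * a)) := by
  have hθ : 0 < 1 - Real.exp (-t) := by
    have : Real.exp (-t) < 1 := by rw [Real.exp_lt_one_iff]; linarith
    linarith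
  have key : ∀ B : ℝ, (∀ v ∈ A, ‖∫ r in (0 : ℝ)..t, (Real.exp (-r) : ℂ) *
      Complex.exp ((Real.exp (-r) * ⟪v, ζ⟫ : ℝ) * Complex.I)‖ ≤ (1 - Real.exp (-t)) * B) →
      ‖charFun (sectorMeasure t P A) ζ‖ ≤ (sectorMeasure t P A).real univ * B := by
    intro B hB
    rw [charFun_sectorMeasure ht.le, sectorMeasure_real_univ ht.le]
    refine (norm_setIntegral_le_of_norm_le_const (measure_lt_top _ _) hB).trans (le_of_eq ?_)
    ring
  refine ⟨key _ fun v hv => ?_, key _ fun v hv => ?_⟩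
  all_goals
    have hz := hζ v hv
    have hz0 : 0 < |⟪v, ζ⟫| := ha.trans_le hz
    have hn := norm_age_integral t ⟪v, ζ⟫
  · have habs : |Real.sin ((1 - Real.exp (-t)) * ⟪v, ζ⟫ / 2)| =
        |Real.sin ((1 - Real.exp (-t)) * |⟪v, ζ⟫| / 2)| := by
      rcases abs_choice ⟪v, ζ⟫ with h | h <;> rw [h]
      rw [mul_neg, neg_div, Real.sin_neg, abs_neg]
    have hs := hS ((1 - Real.exp (-t)) * |⟪v, ζ⟫| / 2) (hy₀.trans (by gcongr))
    rw [habs] at hn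
    refine le_of_mul_le_mul_right ?_ hz0
    linarith
  · have hθa : (1 - Real.exp (-t)) * (2 / ((1 - Real.exp (-t)) * a)) = 2 / a := by
      field_simp
    rw [hθa, le_div_iff₀ ha]
    have h1 := Real.abs_sin_le_one ((1 - Real.exp (-t)) * ⟪v, ζ⟫ / 2)
    refine (mul_le_mul_of_nonneg_left hz (norm_nonneg _)).trans ?_
    linarith

/-! ### Truncated exponential series -/

lemma norm_prod_sub_prod_le {a b : ℕ → ℂ} (ha : ∀ i, ‖a i‖ ≤ 1) (hb : ∀ i, ‖b i‖ ≤ 1) (n : ℕ) :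
    ‖∏ i ∈ Finset.range n, a i - ∏ i ∈ Finset.range n, b i‖ ≤
      ∑ i ∈ Finset.range n, ‖a i - b i‖ := by
  induction n with
  | zero => simp
  | succ n ih =>
    rw [Finset.prod_range_succ, Finset.prod_range_succ, Finset.sum_range_succ]
    have hbp : ‖∏ i ∈ Finset.range n, b i‖ ≤ 1 := by
      rw [norm_prod]
      exact Finset.prod_le_one (fun _ _ => norm_nonneg _) fun i _ => hb i
    calc ‖(∏ i ∈ Finset.range n, a i) * a n - (∏ i ∈ Finset.range n, b i) * b n‖
        = ‖(∏ i ∈ Finset.range n, a i - ∏ i ∈ Finset.range n, b i) * a n +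
            (∏ i ∈ Finset.range n, b i) * (a n - b n)‖ := by congr 1; ring
      _ ≤ ‖∏ i ∈ Finset.range n, a i - ∏ i ∈ Finset.range n, b i‖ * ‖a n‖ +
            ‖∏ i ∈ Finset.range n, b i‖ * ‖a n - b n‖ := by
          refine (norm_add_le _ _).trans ?_
          rw [norm_mul, norm_mul]
      _ ≤ ‖∏ i ∈ Finset.range n, a i - ∏ i ∈ Finset.range n, b i‖ * 1 + 1 * ‖a n - b n‖ := by
          gcongr
          exact ha n
      _ ≤ _ := by linarith

/-- The tail `∑_{j > N} m^j / j!` of the exponential series. -/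
def expTail (N : ℕ) (m : ℝ) : ℝ := Real.exp m - ∑ j ∈ Finset.range (N + 1), m ^ j / (j ! : ℝ)

lemma expTail_eq_tsum (N : ℕ) (m : ℝ) :
    expTail N m = ∑' j : ℕ, m ^ (j + (N + 1)) / ((j + (N + 1))! : ℝ) := by
  have h := (Real.summable_pow_div_factorial m).sum_add_tsum_nat_add (N + 1)
  have h2 : ∑' j : ℕ, m ^ j / (j ! : ℝ) = Real.exp m := by
    rw [Real.exp_eq_exp_ℝ, NormedSpace.exp_eq_tsum_div]
  rw [expTail]
  linarith

lemma expTail_mono (N : ℕ) {m m' : ℝ} (hm : 0 ≤ m) (h : m ≤ m') : expTail N m ≤ expTail N m' := by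
  rw [expTail_eq_tsum, expTail_eq_tsum]
  have hs := fun x : ℝ => (summable_nat_add_iff (N + 1)).2 (Real.summable_pow_div_factorial x)
  exact (hs m).tsum_le_tsum (fun j => by gcongr) (hs m')

lemma tendsto_expTail (m : ℝ) : Tendsto (fun N => expTail N m) atTop (𝓝 0) := by
  have h := ((NormedSpace.expSeries_div_hasSum_exp (m : ℝ)).tendsto_sum_nat).comp
    (tendsto_add_atTop_nat 1)
  rw [← Real.exp_eq_exp_ℝ] at h
  simpa [expTail] using (tendsto_const_nhds (x := Real.exp m)).sub h

lemma norm_sum_pow_div_factorial_le {z : ℂ} {m : ℝ} (hz : ‖z‖ ≤ m) (S : Finset ℕ) :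
    ‖∑ j ∈ S, z ^ j / (j ! : ℂ)‖ ≤ Real.exp m := by
  have hm : 0 ≤ m := (norm_nonneg z).trans hz
  calc ‖∑ j ∈ S, z ^ j / (j ! : ℂ)‖ ≤ ∑ j ∈ S, m ^ j / (j ! : ℝ) := by
        refine norm_sum_le_of_le _ fun j _ => ?_
        rw [norm_div, norm_pow, Complex.norm_natCast]
        gcongr
    _ ≤ ∑' j : ℕ, m ^ j / (j ! : ℝ) :=
        (Real.summable_pow_div_factorial m).sum_le_tsum S fun j _ => by positivity
    _ = Real.exp m := by rw [Real.exp_eq_exp_ℝ, NormedSpace.exp_eq_tsum_div]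

lemma norm_exp_sub_sum_le_expTail {z : ℂ} {m : ℝ} (hz : ‖z‖ ≤ m) (N : ℕ) :
    ‖Complex.exp z - ∑ j ∈ Finset.range (N + 1), z ^ j / (j ! : ℂ)‖ ≤ expTail N m :=
  (Complex.norm_exp_sub_sum_le_exp_norm_sub_sum z (N + 1)).trans
    (expTail_mono N (norm_nonneg z) hz)

lemma sum_Ioc_eq (f : ℕ → ℂ) {k N : ℕ} (h : k ≤ N) :
    ∑ j ∈ Finset.Ioc k N, f j = ∑ j ∈ Finset.range (N + 1), f j - ∑ j ∈ Finset.range (k + 1), f j := by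
  rw [eq_sub_iff_add_eq, Finset.range_eq_Ico, Finset.range_eq_Ico, add_comm,
    ← Finset.sum_Ico_consecutive f (Nat.zero_le (k + 1)) (Nat.succ_le_succ h)]
  congr 2
  ext j
  simp only [Finset.mem_Ioc, Finset.mem_Ico]
  omega

/-- Dropping the terms up to degree `k` from the exponential series costs at most `2^k e^{m/2}`,
which is exponentially small relative to `e^m`. -/
lemma norm_exp_sub_sum_Ioc_le {z : ℂ} {m : ℝ} (hz : ‖z‖ ≤ m) {k N : ℕ} (h : k ≤ N) :
    ‖Complex.exp z - ∑ j ∈ Finset.Ioc k N, z ^ j / (j ! : ℂ)‖ ≤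
      expTail N m + 2 ^ k * Real.exp (m / 2) := by
  have hm : 0 ≤ m := (norm_nonneg z).trans hz
  rw [sum_Ioc_eq _ h, ← sub_add]
  refine (norm_add_le _ _).trans (add_le_add (norm_exp_sub_sum_le_expTail hz N) ?_)
  calc ‖∑ j ∈ Finset.range (k + 1), z ^ j / (j ! : ℂ)‖
      ≤ ∑ j ∈ Finset.range (k + 1), 2 ^ k * ((m / 2) ^ j / (j ! : ℝ)) := by
        refine norm_sum_le_of_le _ fun j hj => ?_
        have hjk : j ≤ k := Nat.lt_succ_iff.1 (Finset.mem_range.1 hj)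
        rw [norm_div, norm_pow, Complex.norm_natCast]
        calc ‖z‖ ^ j / (j ! : ℝ) ≤ m ^ j / (j ! : ℝ) := by gcongr
          _ = 2 ^ j * ((m / 2) ^ j / (j ! : ℝ)) := by
            rw [div_pow]; field_simp
          _ ≤ 2 ^ k * ((m / 2) ^ j / (j ! : ℝ)) := by
            gcongr
            norm_num
    _ = 2 ^ k * ∑ j ∈ Finset.range (k + 1), (m / 2) ^ j / (j ! : ℝ) := by rw [Finset.mul_sum]
    _ ≤ 2 ^ k * Real.exp (m / 2) := by
        gcongr
        exact Real.sum_le_exp_of_nonneg (by positivity) _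

lemma norm_sum_Ioc_le (z : ℂ) (k N : ℕ) :
    ‖∑ j ∈ Finset.Ioc k N, z ^ j / (j ! : ℂ)‖ ≤ ‖z‖ ^ (k + 1) * Real.exp ‖z‖ := by
  calc ‖∑ j ∈ Finset.Ioc k N, z ^ j / (j ! : ℂ)‖
      ≤ ∑ j ∈ Finset.Ioc k N, ‖z‖ ^ (k + 1) * (‖z‖ ^ (j - (k + 1)) / ((j - (k + 1))! : ℝ)) := by
        refine norm_sum_le_of_le _ fun j hj => ?_
        have hjk : k + 1 ≤ j := (Finset.mem_Ioc.1 hj).1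
        rw [norm_div, norm_pow, Complex.norm_natCast, ← mul_div_assoc, ← pow_add,
          Nat.add_sub_cancel' hjk]
        gcongr
        exact Nat.sub_le _ _
    _ = ‖z‖ ^ (k + 1) * ∑ j ∈ Finset.Ioc k N, ‖z‖ ^ (j - (k + 1)) / ((j - (k + 1))! : ℝ) := by
        rw [Finset.mul_sum]
    _ ≤ ‖z‖ ^ (k + 1) * Real.exp ‖z‖ := by
        gcongr
        have : Finset.Ioc k N = Finset.Ico (k + 1) (N + 1) := by
          ext j; simp only [Finset.mem_Ioc, Finset.mem_Ico]; omega
        rw [this, Finset.sum_Ico_eq_sum_range]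
        simp only [Nat.add_sub_cancel_left]
        exact Real.sum_le_exp_of_nonneg (norm_nonneg z) _

lemma pow_mul_exp_neg_le (n : ℕ) {c : ℝ} (hc : 0 < c) {x : ℝ} (hx : 0 ≤ x) :
    x ^ n * Real.exp (-(c * x)) ≤ n ! * c⁻¹ ^ n := by
  have h := Real.pow_div_factorial_le_exp (c * x) (by positivity) n
  rw [div_le_iff₀ (by positivity), mul_pow] at h
  rw [Real.exp_neg, ← div_eq_mul_inv, div_le_iff₀ (Real.exp_pos _)]
  calc x ^ n = c⁻¹ ^ n * (c ^ n * x ^ n) := by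
        rw [inv_pow, inv_mul_cancel_left₀ (pow_ne_zero n hc.ne')]
    _ ≤ c⁻¹ ^ n * (Real.exp (c * x) * n !) := by gcongr
    _ = _ := by ring

lemma exp_neg_div_le (n : ℕ) {c ε : ℝ} (hc : 0 < c) (hε : 0 < ε) :
    Real.exp (-(c / ε)) ≤ n ! * c⁻¹ ^ n * ε ^ n := by
  have h := pow_mul_exp_neg_le n hc (x := ε⁻¹) (by positivity)
  rw [← div_eq_mul_inv, inv_pow ε, inv_mul_le_iff₀ (by positivity)] at h
  linarith

/-! ### Splitting the jump intensity -/

/-- The jump intensity split into `K` sector parts, each of weight `1/K`, and a remainder with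
index `K`. -/
def jumpPiece (t : ℝ) (P : Measure (E d)) (A : ℕ → Set (E d)) (K i : ℕ) : Measure (E d) :=
  if i < K then (K : ℝ≥0∞)⁻¹ • sectorMeasure t P (A i)
  else jumpMeasure t P - ∑ j ∈ Finset.range K, (K : ℝ≥0∞)⁻¹ • sectorMeasure t P (A j)

instance isFiniteMeasure_jumpPiece (t : ℝ) (P : Measure (E d)) [IsFiniteMeasure P]
    (A : ℕ → Set (E d)) (K i : ℕ) : IsFiniteMeasure (jumpPiece t P A K i) := by
  unfold jumpPiece
  split_ifs with h
  · exact Measure.smul_finite _ (ENNReal.inv_ne_top.2 (by exact_mod_cast (Nat.zero_lt_of_lt h).ne'))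
  · exact isFiniteMeasure_of_le _ Measure.sub_le

lemma sum_jumpPiece (t : ℝ) (P : Measure (E d)) [IsFiniteMeasure P] (A : ℕ → Set (E d)) {K : ℕ}
    (hK : 0 < K) : ∑ i ∈ Finset.range (K + 1), jumpPiece t P A K i = jumpMeasure t P := by
  have hK0 : (K : ℝ≥0∞) ≠ 0 := by exact_mod_cast hK.ne'
  have hle : ∑ j ∈ Finset.range K, (K : ℝ≥0∞)⁻¹ • sectorMeasure t P (A j) ≤ jumpMeasure t P := by
    calc ∑ j ∈ Finset.range K, (K : ℝ≥0∞)⁻¹ • sectorMeasure t P (A j)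
        ≤ ∑ j ∈ Finset.range K, (K : ℝ≥0∞)⁻¹ • jumpMeasure t P := by
          refine Finset.sum_le_sum fun j _ => Measure.le_iff.2 fun s _ => ?_
          simp only [Measure.smul_apply, smul_eq_mul]
          gcongr
          exact sectorMeasure_le t P (A j)
      _ = jumpMeasure t P := by
          rw [Finset.sum_const, Finset.card_range, ← Nat.cast_smul_eq_nsmul ℝ≥0∞, smul_smul,
            ENNReal.mul_inv_cancel hK0 (ENNReal.natCast_ne_top K), one_smul]
  have hsum : ∑ i ∈ Finset.range K, jumpPiece t P A K i =
      ∑ j ∈ Finset.range K, (K : ℝ≥0∞)⁻¹ • sectorMeasure t P (A j) :=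
    Finset.sum_congr rfl fun i hi => if_pos (Finset.mem_range.1 hi)
  have : IsFiniteMeasure (∑ j ∈ Finset.range K, (K : ℝ≥0∞)⁻¹ • sectorMeasure t P (A j)) :=
    isFiniteMeasure_of_le _ hle
  rw [Finset.sum_range_succ, hsum, jumpPiece, if_neg (lt_irrefl K), add_comm,
    Measure.sub_add_cancel_of_le hle]

lemma sum_charFun_jumpPiece (t : ℝ) (P : Measure (E d)) [IsFiniteMeasure P] (A : ℕ → Set (E d))
    {K : ℕ} (hK : 0 < K) (ζ : E d) :
    ∑ i ∈ Finset.range (K + 1), charFun (jumpPiece t P A K i) ζ = charFun (jumpMeasure t P) ζ := by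
  rw [← charFun_finset_sum, sum_jumpPiece t P A hK]

lemma sum_real_jumpPiece {t : ℝ} (ht : 0 ≤ t) (P : Measure (E d)) [IsProbabilityMeasure P]
    (A : ℕ → Set (E d)) {K : ℕ} (hK : 0 < K) :
    ∑ i ∈ Finset.range (K + 1), (jumpPiece t P A K i).real univ = t := by
  have h := sum_charFun_jumpPiece t P A hK 0
  simp only [charFun_zero, jumpMeasure_real_univ ht] at h
  exact_mod_cast h

/-- The pieces of the jump intensity for jump rate `lam` and jump scale `ε`. -/
def scaledPiece (t : ℝ) (P : Measure (E d)) (A : ℕ → Set (E d)) (K : ℕ) (lam ε : ℝ) (i : ℕ) :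
    Measure (E d) :=
  ENNReal.ofReal lam • (jumpPiece t P A K i).map fun x => ε • x

instance isFiniteMeasure_scaledPiece (t : ℝ) (P : Measure (E d)) [IsFiniteMeasure P]
    (A : ℕ → Set (E d)) (K : ℕ) (lam ε : ℝ) (i : ℕ) :
    IsFiniteMeasure (scaledPiece t P A K lam ε i) :=
  Measure.smul_finite _ ENNReal.ofReal_ne_top

lemma charFun_scaledPiece (t : ℝ) (P : Measure (E d)) (A : ℕ → Set (E d)) (K : ℕ) {lam : ℝ}
    (hlam : 0 ≤ lam) (ε : ℝ) (i : ℕ) (ζ : E d) :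
    charFun (scaledPiece t P A K lam ε i) ζ = lam * charFun (jumpPiece t P A K i) (ε • ζ) := by
  rw [scaledPiece, charFun_smul_ennreal, charFun_map_smul, ENNReal.toReal_ofReal hlam]

/-- The law at time `t` of the jump part of the process: the compound Poisson law of intensity
`lam` times the image of `jumpMeasure t P` under `x ↦ ε x`. It is written as a convolution of the
contributions of the pieces, but does not depend on the splitting. -/
def compoundLaw (t : ℝ) (P : Measure (E d)) (A : ℕ → Set (E d)) (K : ℕ) (lam ε : ℝ) :
    Measure (E d) :=
  ENNReal.ofReal (Real.exp (-(lam * t))) •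
    convProd (fun i => convExp (scaledPiece t P A K lam ε i)) (K + 1)

/-- The numbers of jumps that are retained: between `d + 1` and `N` in each sector, at most `N`
elsewhere. -/
def truncIdx (d K N i : ℕ) : Finset ℕ := if i < K then Finset.Ioc d N else Finset.range (N + 1)

lemma le_of_mem_truncIdx {K N i j : ℕ} (h : j ∈ truncIdx d K N i) : j ≤ N := by
  unfold truncIdx at h
  split_ifs at h
  · exact (Finset.mem_Ioc.1 h).2
  · exact Nat.lt_succ_iff.1 (Finset.mem_range.1 h)

/-- The part of the compound Poisson law with more than `d` jumps in every sector, which has a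
bounded continuous density, and at most `N` jumps of each kind. -/
def truncLaw (t : ℝ) (P : Measure (E d)) (A : ℕ → Set (E d)) (K : ℕ) (lam ε : ℝ) (N : ℕ) :
    Measure (E d) :=
  ENNReal.ofReal (Real.exp (-(lam * t))) •
    convProd (fun i => expTrunc (truncIdx d K N i) (scaledPiece t P A K lam ε i)) (K + 1)

instance isFiniteMeasure_compoundLaw (t : ℝ) (P : Measure (E d)) [IsFiniteMeasure P]
    (A : ℕ → Set (E d)) (K : ℕ) (lam ε : ℝ) : IsFiniteMeasure (compoundLaw t P A K lam ε) :=
  Measure.smul_finite _ ENNReal.ofReal_ne_top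

instance isFiniteMeasure_truncLaw (t : ℝ) (P : Measure (E d)) [IsFiniteMeasure P]
    (A : ℕ → Set (E d)) (K : ℕ) (lam ε : ℝ) (N : ℕ) :
    IsFiniteMeasure (truncLaw t P A K lam ε N) :=
  Measure.smul_finite _ ENNReal.ofReal_ne_top

lemma smul_measure_mono (c : ℝ≥0∞) {μ ν : Measure (E d)} (h : μ ≤ ν) : c • μ ≤ c • ν := by
  refine Measure.le_iff.2 fun s _ => ?_
  simp only [Measure.smul_apply, smul_eq_mul]
  gcongr

lemma truncLaw_le_compoundLaw (t : ℝ) (P : Measure (E d)) [IsFiniteMeasure P]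
    (A : ℕ → Set (E d)) (K : ℕ) (lam ε : ℝ) (N : ℕ) :
    truncLaw t P A K lam ε N ≤ compoundLaw t P A K lam ε :=
  smul_measure_mono _ (convProd_mono (fun _ => expTrunc_le_convExp _ _) _)

lemma charFun_compoundLaw (t : ℝ) (P : Measure (E d)) [IsFiniteMeasure P]
    (A : ℕ → Set (E d)) {K : ℕ} (hK : 0 < K) {lam : ℝ} (hlam : 0 ≤ lam) (ε : ℝ) (ζ : E d) :
    charFun (compoundLaw t P A K lam ε) ζ =
      Complex.exp (lam * (charFun (jumpMeasure t P) (ε • ζ) - t)) := by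
  rw [compoundLaw, charFun_smul_ennreal, ENNReal.toReal_ofReal (Real.exp_pos _).le,
    charFun_convProd]
  simp_rw [charFun_convExp, charFun_scaledPiece t P A K hlam]
  rw [← Complex.exp_sum, ← Finset.mul_sum, sum_charFun_jumpPiece t P A hK, Complex.ofReal_exp,
    ← Complex.exp_add]
  push_cast
  ring_nf

lemma charFun_truncLaw {t : ℝ} (ht : 0 ≤ t) (P : Measure (E d)) [IsProbabilityMeasure P]
    (A : ℕ → Set (E d)) {K : ℕ} (hK : 0 < K) {lam : ℝ} (hlam : 0 ≤ lam) (ε : ℝ) (N : ℕ) (ζ : E d) :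
    charFun (truncLaw t P A K lam ε N) ζ = ∏ i ∈ Finset.range (K + 1),
      ((Real.exp (-(lam * (jumpPiece t P A K i).real univ)) : ℂ) *
        ∑ j ∈ truncIdx d K N i,
          (lam * charFun (jumpPiece t P A K i) (ε • ζ)) ^ j / (j ! : ℂ)) := by
  rw [truncLaw, charFun_smul_ennreal, ENNReal.toReal_ofReal (Real.exp_pos _).le,
    charFun_convProd, Finset.prod_mul_distrib]
  simp_rw [charFun_expTrunc, charFun_scaledPiece t P A K hlam]
  congr 1
  rw [← Complex.ofReal_prod, ← Real.exp_sum, Finset.sum_neg_distrib, ← Finset.mul_sum,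
    sum_real_jumpPiece ht P A hK]

/-! ### Comparison with the stable law on the Fourier side -/

/-- The time parameter `∫_0^t e^{-2sr} dr` of the limiting stable law: jumps of age `r` are
contracted by `e^{-r}`. -/
def agedTime (s t : ℝ) : ℝ := ∫ r in (0 : ℝ)..t, Real.exp (-(2 * s * r))

lemma agedTime_mem_Icc {s t : ℝ} (hs : s ∈ Icc (0 : ℝ) 1) (ht : 0 ≤ t) :
    agedTime s t ∈ Icc (t * Real.exp (-(2 * t))) t := by
  have hi : IntervalIntegrable (fun r => Real.exp (-(2 * s * r))) volume 0 t :=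
    Continuous.intervalIntegrable (by fun_prop) _ _
  constructor
  · have := intervalIntegral.integral_mono_on ht (intervalIntegrable_const
      (c := Real.exp (-(2 * t)))) hi fun r hr => by
        refine Real.exp_le_exp.2 ?_
        nlinarith [hr.1, hr.2, hs.1, hs.2, mul_le_mul hs.2 hr.2 hr.1 zero_le_one]
    simpa [agedTime] using this
  · have := intervalIntegral.integral_mono_on ht hi (intervalIntegrable_const (c := (1 : ℝ)))
      fun r hr => by
        refine Real.exp_le_one_iff.2 ?_
        nlinarith [mul_nonneg hs.1 hr.1]
    simpa [agedTime] using this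

/-- The exponent of the compound Poisson law against that of the stable law: the low frequency
expansion, integrated over the ages of the jumps. -/
lemma norm_exponent_sub_le {P : Measure (E d)} [IsProbabilityMeasure P] {C₀ δ s t ε : ℝ}
    (hP : LowFreq C₀ δ s P) (hC₀ : 0 ≤ C₀) (hδ : 0 ≤ δ) (hs : 0 < s) (ht : 0 ≤ t) (hε : 0 < ε)
    {ζ : E d} (hζ : ε * ‖ζ‖ ≤ 1) :
    ‖((1 / ε ^ (2 * s) : ℝ) : ℂ) * (charFun (jumpMeasure t P) (ε • ζ) - t) +
      ((agedTime s t * ‖ζ‖ ^ (2 * s) : ℝ) : ℂ)‖ ≤ t * (C₀ * ε ^ δ * ‖ζ‖ ^ (2 * s + δ)) := by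
  set lam : ℝ := 1 / ε ^ (2 * s) with hlam
  have hcont : Continuous fun r : ℝ => charFun P (Real.exp (-r) • ε • ζ) := by fun_prop
  have heq : (lam : ℂ) * (charFun (jumpMeasure t P) (ε • ζ) - t) +
      ((agedTime s t * ‖ζ‖ ^ (2 * s) : ℝ) : ℂ) =
      ∫ r in (0 : ℝ)..t, ((lam : ℂ) * (charFun P (Real.exp (-r) • ε • ζ) - 1) +
        ((Real.exp (-(2 * s * r)) * ‖ζ‖ ^ (2 * s) : ℝ) : ℂ)) := by
    rw [intervalIntegral.integral_add (Continuous.intervalIntegrable (by fun_prop) _ _)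
      (Continuous.intervalIntegrable (by fun_prop) _ _), intervalIntegral.integral_const_mul,
      intervalIntegral.integral_sub (hcont.intervalIntegrable _ _) intervalIntegrable_const,
      ← charFun_jumpMeasure ht, intervalIntegral.integral_ofReal,
      intervalIntegral.integral_mul_const, agedTime]
    simp
  rw [heq]
  refine (intervalIntegral.norm_integral_le_of_norm_le_const
    (C := C₀ * ε ^ δ * ‖ζ‖ ^ (2 * s + δ)) fun r hr => ?_).trans (le_of_eq ?_)
  · rw [uIoc_of_le ht] at hr
    have he1 : Real.exp (-r) ≤ 1 := Real.exp_le_one_iff.2 (by linarith [hr.1])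
    have hn : ‖Real.exp (-r) • ζ‖ = Real.exp (-r) * ‖ζ‖ := by
      rw [norm_smul, Real.norm_of_nonneg (Real.exp_pos _).le]
    have hle : ‖Real.exp (-r) • ζ‖ ≤ ‖ζ‖ := by
      rw [hn]
      exact mul_le_of_le_one_left (norm_nonneg _) he1
    have h := norm_scaled_exponent_le hP hε (ζ := Real.exp (-r) • ζ)
      ((mul_le_mul_of_nonneg_left hle hε.le).trans hζ)
    rw [smul_comm] at h
    have hpow : ‖Real.exp (-r) • ζ‖ ^ (2 * s) = Real.exp (-(2 * s * r)) * ‖ζ‖ ^ (2 * s) := by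
      rw [hn, Real.mul_rpow (Real.exp_pos _).le (norm_nonneg _), ← Real.exp_mul]
      ring_nf
    rw [hpow] at h
    refine h.trans ?_
    gcongr
  · rw [sub_zero, abs_of_nonneg ht, mul_comm]

lemma norm_exp_sub_exp_le (a b : ℂ) :
    ‖Complex.exp a - Complex.exp b‖ ≤ ‖a - b‖ * Real.exp (b.re + ‖a - b‖) := by
  have h1 : Complex.exp a - Complex.exp b = Complex.exp b * (Complex.exp (a - b) - 1) := by
    rw [mul_sub, ← Complex.exp_add]
    ring_nf
  have h2 := Complex.norm_exp_sub_sum_le_norm_mul_exp (a - b) 1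
  simp only [Finset.range_one, Finset.sum_singleton, pow_zero, Nat.factorial_zero, Nat.cast_one,
    div_one, pow_one] at h2
  rw [h1, norm_mul, Complex.norm_exp, Real.exp_add]
  calc Real.exp b.re * ‖Complex.exp (a - b) - 1‖
      ≤ Real.exp b.re * (‖a - b‖ * Real.exp ‖a - b‖) := by gcongr
    _ = _ := by ring

/-- Low frequencies: the full compound Poisson law against the stable law. The condition on `ρ`
keeps the error in the exponent below half of the stable exponent, so that the weight is still
absorbed by the remaining stable decay. -/
lemma norm_compound_sub_stable_le {C₀ δ t ρ : ℝ} (hC₀ : 0 < C₀) (hδ : 0 < δ) (hδ1 : δ ≤ 1)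
    (ht : 0 < t) (hρ1 : ρ ≤ 1)
    (hρC : t * C₀ * ρ ^ δ ≤ t * Real.exp (-(2 * t)) / 2) :
    ∃ C > 0, ∀ s ∈ Ioo (1 / 2 : ℝ) 1, ∀ P : Measure (E d), IsProbabilityMeasure P →
      LowFreq C₀ δ s P → ∀ ε > 0, ∀ ζ : E d, ε * ‖ζ‖ ≤ ρ →
      ‖Complex.exp (((1 / ε ^ (2 * s) : ℝ) : ℂ) * (charFun (jumpMeasure t P) (ε • ζ) - t)) -
        stableSymbol s (agedTime s t) ζ‖ ≤ C * ε ^ δ * freqWeight ζ := by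
  set σ₀ : ℝ := t * Real.exp (-(2 * t)) with hσ₀
  have hσ₀p : 0 < σ₀ := by positivity
  set D : ℝ := (d + 4)! * (σ₀ / 2)⁻¹ ^ (d + 4) * Real.exp (σ₀ / 2) * Real.exp (σ₀ / 2) with hD
  refine ⟨t * C₀ * D, by positivity, fun s hs P hP hlow ε hε ζ hζ => ?_⟩
  set x := ‖ζ‖ with hx
  have hx0 : 0 ≤ x := norm_nonneg ζ
  set a : ℂ := ((1 / ε ^ (2 * s) : ℝ) : ℂ) * (charFun (jumpMeasure t P) (ε • ζ) - t) with ha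
  set b : ℂ := ((-(agedTime s t * x ^ (2 * s)) : ℝ) : ℂ) with hb
  have hsym : stableSymbol s (agedTime s t) ζ = Complex.exp b := by
    rw [stableSymbol, hb, Complex.ofReal_exp]
  have hage := agedTime_mem_Icc (s := s) ⟨by linarith [hs.1], hs.2.le⟩ ht.le
  have hΔ : ‖a - b‖ ≤ t * (C₀ * ε ^ δ * x ^ (2 * s + δ)) := by
    have := norm_exponent_sub_le hlow hC₀.le hδ.le (by linarith [hs.1]) ht.le hε
      (hζ.trans hρ1)
    rw [hb, Complex.ofReal_neg, sub_neg_eq_add]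
    exact this
  have hxs : 0 ≤ x ^ (2 * s) := Real.rpow_nonneg hx0 _
  have hΔ2 : ‖a - b‖ ≤ σ₀ / 2 * x ^ (2 * s) := by
    refine hΔ.trans ?_
    have h1 : ε ^ δ * x ^ (2 * s + δ) ≤ ρ ^ δ * x ^ (2 * s) := by
      rw [Real.rpow_add_of_nonneg hx0 (by linarith [hs.1]) hδ.le]
      calc ε ^ δ * (x ^ (2 * s) * x ^ δ) = (ε * x) ^ δ * x ^ (2 * s) := by
            rw [Real.mul_rpow hε.le hx0]; ring
        _ ≤ ρ ^ δ * x ^ (2 * s) := by gcongr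
    calc t * (C₀ * ε ^ δ * x ^ (2 * s + δ)) = t * C₀ * (ε ^ δ * x ^ (2 * s + δ)) := by ring
      _ ≤ t * C₀ * (ρ ^ δ * x ^ (2 * s)) := by gcongr
      _ = t * C₀ * ρ ^ δ * x ^ (2 * s) := by ring
      _ ≤ _ := by gcongr
  have hre : b.re + ‖a - b‖ ≤ -(σ₀ / 2 * x ^ (2 * s)) := by
    rw [hb, Complex.ofReal_re]
    nlinarith [hage.1]
  rw [hsym]
  refine (norm_exp_sub_exp_le a b).trans ?_
  have h3 : x ^ (2 * s + δ) ≤ (1 + x) ^ 3 := by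
    calc x ^ (2 * s + δ) ≤ (1 + x) ^ (2 * s + δ) :=
          Real.rpow_le_rpow hx0 (by linarith) (by linarith [hs.1])
      _ ≤ (1 + x) ^ (3 : ℝ) := Real.rpow_le_rpow_of_exponent_le (by linarith) (by linarith [hs.2])
      _ = (1 + x) ^ 3 := by norm_cast
  have h4 := one_add_pow_mul_exp_neg_rpow_le (d + 4) (half_pos hσ₀p) le_rfl hs.1.le hx0
  calc ‖a - b‖ * Real.exp (b.re + ‖a - b‖)
      ≤ (t * (C₀ * ε ^ δ * (1 + x) ^ 3)) * Real.exp (-(σ₀ / 2 * x ^ (2 * s))) := by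
        gcongr
        exact hΔ.trans (by gcongr)
    _ = t * C₀ * ε ^ δ * ((1 + x) ^ (d + 4) * Real.exp (-(σ₀ / 2 * x ^ (2 * s)))) *
          freqWeight ζ := by
        rw [freqWeight, ← hx, show d + 4 = 3 + (d + 1) by ring, pow_add]
        field_simp
    _ ≤ t * C₀ * ε ^ δ * D * freqWeight ζ := by
        have := (freqWeight_pos ζ).le
        gcongr
    _ = _ := by ring

/-- A product of exponentials against the product of their truncated series, each normalised
by its mass. -/
lemma norm_prod_trunc_sub_prod_exp_le {m : ℕ → ℝ} {z : ℕ → ℂ} {M μ₀ T : ℝ} {d K N : ℕ}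
    (hN : d ≤ N) (hM : 0 ≤ M) (hm0 : ∀ i, 0 ≤ m i) (hzm : ∀ i, ‖z i‖ ≤ m i)
    (hmt : ∀ i ∈ Finset.range (K + 1), m i ≤ M) (hmass : ∀ i < K, μ₀ ≤ m i)
    (hT : expTail N M ≤ T) :
    ‖∏ i ∈ Finset.range (K + 1),
        ((Real.exp (-(m i)) : ℂ) * ∑ j ∈ truncIdx d K N i, z i ^ j / (j ! : ℂ)) -
      ∏ i ∈ Finset.range (K + 1), ((Real.exp (-(m i)) : ℂ) * Complex.exp (z i))‖ ≤
      (K + 1) * T + K * (2 ^ d * Real.exp (-(μ₀ / 2))) := by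
  have hnorm : ∀ i, ∀ w : ℂ, ‖w‖ ≤ Real.exp (m i) → ‖(Real.exp (-(m i)) : ℂ) * w‖ ≤ 1 := by
    intro i w hw
    rw [norm_mul, Complex.norm_real, Real.norm_of_nonneg (Real.exp_pos _).le]
    calc Real.exp (-(m i)) * ‖w‖ ≤ Real.exp (-(m i)) * Real.exp (m i) := by gcongr
      _ = 1 := by rw [← Real.exp_add]; simp
  refine (norm_prod_sub_prod_le (fun i => hnorm i _ (norm_sum_pow_div_factorial_le (hzm i) _))
    (fun i => hnorm i _ ?_) (K + 1)).trans ?_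
  · rw [Complex.norm_exp]
    exact Real.exp_le_exp.2 ((Complex.re_le_norm _).trans (hzm i))
  have hdiff : ∀ i ∈ Finset.range (K + 1), ∀ w : ℂ, ∀ B : ℝ, 0 ≤ B →
      ‖Complex.exp (z i) - w‖ ≤ expTail N (m i) + B →
      ‖(Real.exp (-(m i)) : ℂ) * w - (Real.exp (-(m i)) : ℂ) * Complex.exp (z i)‖ ≤
        T + Real.exp (-(m i)) * B := by
    intro i hi w B hB h
    rw [← mul_sub, norm_mul, Complex.norm_real, Real.norm_of_nonneg (Real.exp_pos _).le,
      norm_sub_rev]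
    have h1 : expTail N (m i) ≤ T := (expTail_mono N (hm0 i) (hmt i hi)).trans hT
    have h2 : Real.exp (-(m i)) ≤ 1 := Real.exp_le_one_iff.2 (by linarith [hm0 i])
    have hT0 : 0 ≤ T := by
      refine le_trans ?_ hT
      have := expTail_mono N le_rfl hM
      refine le_trans ?_ this
      have := (norm_nonneg _).trans (norm_exp_sub_sum_le_expTail (z := 0) (m := 0) (by simp) N)
      exact this
    calc Real.exp (-(m i)) * ‖Complex.exp (z i) - w‖
        ≤ Real.exp (-(m i)) * (T + B) := by gcongr; linarith
      _ = Real.exp (-(m i)) * T + Real.exp (-(m i)) * B := by ring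
      _ ≤ 1 * T + Real.exp (-(m i)) * B := by gcongr
      _ = _ := by ring
  rw [Finset.sum_range_succ]
  have hlast := hdiff K (Finset.self_mem_range_succ K) (∑ j ∈ truncIdx d K N K, z K ^ j / (j ! : ℂ))
    0 le_rfl (by
      rw [truncIdx, if_neg (lt_irrefl K), add_zero]
      exact norm_exp_sub_sum_le_expTail (hzm K) N)
  have hfirst : ∀ i ∈ Finset.range K,
      ‖(Real.exp (-(m i)) : ℂ) * (∑ j ∈ truncIdx d K N i, z i ^ j / (j ! : ℂ)) -
        (Real.exp (-(m i)) : ℂ) * Complex.exp (z i)‖ ≤ T + 2 ^ d * Real.exp (-(μ₀ / 2)) := by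
    intro i hi
    have hiK := Finset.mem_range.1 hi
    refine (hdiff i (Finset.mem_range.2 (hiK.trans (Nat.lt_succ_self K))) _
      (2 ^ d * Real.exp (m i / 2)) (by positivity) ?_).trans ?_
    · rw [truncIdx, if_pos hiK]
      exact norm_exp_sub_sum_Ioc_le (hzm i) hN
    · rw [mul_left_comm, ← Real.exp_add]
      gcongr
      have := hmass i hiK
      linarith
  have hsum := Finset.sum_le_sum hfirst
  rw [Finset.sum_const, Finset.card_range, nsmul_eq_mul] at hsum
  simp only [mul_zero, add_zero] at hlast
  linarith

lemma norm_mul_charFun_le {lam : ℝ} (hlam : 0 ≤ lam) (μ : Measure (E d)) [IsFiniteMeasure μ]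
    (ζ : E d) : ‖(lam : ℂ) * charFun μ ζ‖ ≤ lam * μ.real univ := by
  rw [norm_mul, Complex.norm_real, Real.norm_of_nonneg hlam]
  gcongr
  exact norm_charFun_le _

/-- All frequencies: truncating the numbers of jumps costs little, because every sector
typically contributes many jumps. -/
lemma norm_trunc_sub_compound_le {t lam μ₀ ε T : ℝ} (ht : 0 ≤ t) (P : Measure (E d))
    [IsProbabilityMeasure P] (A : ℕ → Set (E d)) {K N : ℕ} (hK : 0 < K) (hN : d ≤ N)
    (hlam : 0 ≤ lam) (hmass : ∀ i < K, μ₀ ≤ lam * (jumpPiece t P A K i).real univ)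
    (hT : expTail N (lam * t) ≤ T) (ζ : E d) :
    ‖charFun (truncLaw t P A K lam ε N) ζ - charFun (compoundLaw t P A K lam ε) ζ‖ ≤
      (K + 1) * T + K * (2 ^ d * Real.exp (-(μ₀ / 2))) := by
  have hmt : ∀ i ∈ Finset.range (K + 1), lam * (jumpPiece t P A K i).real univ ≤ lam * t := by
    intro i hi
    refine mul_le_mul_of_nonneg_left ?_ hlam
    exact (Finset.single_le_sum (f := fun i => (jumpPiece t P A K i).real univ)
      (fun _ _ => measureReal_nonneg) hi).trans_eq (sum_real_jumpPiece ht P A hK)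
  have hcomp : charFun (compoundLaw t P A K lam ε) ζ = ∏ i ∈ Finset.range (K + 1),
      ((Real.exp (-(lam * (jumpPiece t P A K i).real univ)) : ℂ) *
        Complex.exp (lam * charFun (jumpPiece t P A K i) (ε • ζ))) := by
    rw [Finset.prod_mul_distrib, ← Complex.ofReal_prod, ← Real.exp_sum, ← Complex.exp_sum,
      Finset.sum_neg_distrib, ← Finset.mul_sum, ← Finset.mul_sum, sum_real_jumpPiece ht P A hK,
      sum_charFun_jumpPiece t P A hK, Complex.ofReal_exp, ← Complex.exp_add,
      charFun_compoundLaw t P A hK hlam]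
    congr 1
    push_cast
    ring
  rw [hcomp, charFun_truncLaw ht P A hK hlam]
  exact norm_prod_trunc_sub_prod_exp_le hN (mul_nonneg hlam ht)
    (fun i => mul_nonneg hlam measureReal_nonneg) (fun i => norm_mul_charFun_le hlam _ _) hmt
    hmass hT

/-- A product of numbers in the unit disc is bounded by each of its factors. -/
lemma norm_prod_le_norm_of_mem {ι : Type*} {s : Finset ι} {f : ι → ℂ} (hf : ∀ i, ‖f i‖ ≤ 1)
    {i : ι} (hi : i ∈ s) : ‖∏ j ∈ s, f j‖ ≤ ‖f i‖ := by
  classical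
  rw [← Finset.mul_prod_erase s f hi, norm_mul, norm_prod]
  exact mul_le_of_le_one_right (norm_nonneg _)
    (Finset.prod_le_one (fun _ _ => norm_nonneg _) fun j _ => hf j)

lemma freqWeight_ge {ρ ε : ℝ} (hε : 0 < ε) (hε1 : ε ≤ 1) {ζ : E d} (hζ : ε * ‖ζ‖ ≤ ρ) :
    1 ≤ ((1 + ρ) / ε) ^ (d + 1) * freqWeight ζ := by
  rw [freqWeight, ← div_eq_mul_inv, one_le_div (by positivity)]
  gcongr
  rw [le_div_iff₀ hε]
  nlinarith [norm_nonneg ζ]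

lemma inv_pow_le_freqWeight {ρ ε : ℝ} (hρ : 0 < ρ) (hε : 0 < ε) (hε1 : ε ≤ 1) {ζ : E d}
    (hζ : ρ ≤ ε * ‖ζ‖) :
    (ε * ‖ζ‖)⁻¹ ^ (d + 1) ≤ (1 + 1 / ρ) ^ (d + 1) * ε⁻¹ ^ (d + 1) * freqWeight ζ := by
  have hx : 0 < ‖ζ‖ := pos_of_mul_pos_right (hρ.trans_le hζ) hε.le
  have h1 : ρ ≤ ‖ζ‖ := hζ.trans (mul_le_of_le_one_left hx.le hε1)
  rw [freqWeight, ← mul_pow, ← inv_pow, ← mul_pow]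
  gcongr
  rw [mul_inv, mul_comm (1 + 1 / ρ), mul_assoc]
  gcongr
  rw [← div_eq_mul_inv, le_div_iff₀ (by positivity), inv_mul_le_iff₀ hx]
  have : 1 ≤ ‖ζ‖ * (1 / ρ) := by rw [mul_one_div, le_div_iff₀ hρ]; linarith
  linarith

/-- High frequencies: the truncated law. A frequency is transversal to some sector, and the
contribution of at least `d + 1` jumps from that sector is integrable in the frequency. -/
lemma exists_trunc_high_freq {t κ p ρ : ℝ} (ht : 0 < t) (hκ : 0 < κ) (hp : 0 < p) (hρ : 0 < ρ)
    {K : ℕ} (hK : 0 < K) {A : ℕ → Set (E d)}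
    (hA : ∀ ζ : E d, ∃ i < K, ∀ v ∈ A i, κ * ‖ζ‖ ≤ |⟪v, ζ⟫|) :
    ∃ C > 0, ∀ P : Measure (E d), IsProbabilityMeasure P → (∀ i < K, p ≤ P.real (A i)) →
      ∀ lam ε : ℝ, 0 < ε → ε ≤ 1 → 1 / ε ≤ lam → ∀ N : ℕ, ∀ ζ : E d, ρ ≤ ε * ‖ζ‖ →
      ‖charFun (truncLaw t P A K lam ε N) ζ‖ ≤ C * ε * freqWeight ζ := by
  have hθ : 0 < 1 - Real.exp (-t) := by
    have : Real.exp (-t) < 1 := by rw [Real.exp_lt_one_iff]; linarith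
    linarith
  set θ := 1 - Real.exp (-t) with hθdef
  obtain ⟨S, hS0, hS1, hS⟩ := exists_sinc_bound (y₀ := θ * (κ * ρ) / 2) (by positivity)
  have hKr : (0 : ℝ) < K := by exact_mod_cast hK
  set μ₀ := θ * p / K with hμ₀
  have hμ₀p : 0 < μ₀ := by positivity
  set g := (1 - S) / 2 with hg
  have hgp : 0 < g := by rw [hg]; linarith
  set C₁ : ℝ := (d + 1)! * g⁻¹ ^ (d + 1) with hC₁
  set C₂ : ℝ := (d + 2)! * (g * μ₀)⁻¹ ^ (d + 2) with hC₂
  refine ⟨C₁ * C₂ * (2 / (θ * κ)) ^ (d + 1) * (1 + 1 / ρ) ^ (d + 1), by positivity, ?_⟩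
  intro P hP hPA lam ε hε hε1 hlam N ζ hζ
  have hlam0 : 0 < lam := lt_of_lt_of_le (by positivity) hlam
  obtain ⟨i, hiK, hi⟩ := hA (ε • ζ)
  have hn : ‖ε • ζ‖ = ε * ‖ζ‖ := by rw [norm_smul, Real.norm_of_nonneg hε.le]
  rw [hn] at hi
  have hεζ : 0 < ε * ‖ζ‖ := hρ.trans_le hζ
  set m : ℕ → ℝ := fun i => lam * (jumpPiece t P A K i).real univ with hm
  set z : ℕ → ℂ := fun i => lam * charFun (jumpPiece t P A K i) (ε • ζ) with hz
  have hm0 : ∀ i, 0 ≤ m i := fun i => mul_nonneg hlam0.le measureReal_nonneg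
  have hzm : ∀ i, ‖z i‖ ≤ m i := fun i => by
    simp only [hz, hm]
    rw [norm_mul, Complex.norm_real, Real.norm_of_nonneg hlam0.le]
    gcongr
    exact norm_charFun_le _
  have hpiece : jumpPiece t P A K i = (K : ℝ≥0∞)⁻¹ • sectorMeasure t P (A i) := if_pos hiK
  have hmi : m i = lam * ((K : ℝ)⁻¹ * (sectorMeasure t P (A i)).real univ) := by
    simp only [hm, hpiece, measureReal_ennreal_smul_apply]
    simp
  have hzi : ‖z i‖ = lam * ((K : ℝ)⁻¹ * ‖charFun (sectorMeasure t P (A i)) (ε • ζ)‖) := by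
    simp only [hz, hpiece, charFun_smul_ennreal]
    rw [norm_mul, norm_mul, Complex.norm_real, Complex.norm_real,
      Real.norm_of_nonneg hlam0.le]
    simp
  have hsec := norm_charFun_sectorMeasure_le ht P (A := A i) (ζ := ε • ζ)
    (a := κ * (ε * ‖ζ‖)) (by positivity) hi hS (by rw [← hθdef]; gcongr)
  have hz1 : ‖z i‖ ≤ m i * S := by
    rw [hzi, hmi]
    calc lam * ((K : ℝ)⁻¹ * ‖charFun (sectorMeasure t P (A i)) (ε • ζ)‖)
        ≤ lam * ((K : ℝ)⁻¹ * ((sectorMeasure t P (A i)).real univ * S)) := by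
          gcongr; exact hsec.1
      _ = _ := by ring
  have hz2 : ‖z i‖ ≤ m i * (2 / (θ * κ) * (ε * ‖ζ‖)⁻¹) := by
    rw [hzi, hmi]
    calc lam * ((K : ℝ)⁻¹ * ‖charFun (sectorMeasure t P (A i)) (ε • ζ)‖)
        ≤ lam * ((K : ℝ)⁻¹ * ((sectorMeasure t P (A i)).real univ *
            (2 / (θ * (κ * (ε * ‖ζ‖)))))) := by
          gcongr; exact hsec.2
      _ = _ := by field_simp
  have hmlow : μ₀ / ε ≤ m i := by
    rw [hmi, sectorMeasure_real_univ ht.le, hμ₀, ← hθdef]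
    calc θ * p / K / ε = 1 / ε * ((K : ℝ)⁻¹ * (θ * p)) := by field_simp
      _ ≤ lam * ((K : ℝ)⁻¹ * (θ * P.real (A i))) := by
        gcongr
        exact hPA i hiK
  rw [charFun_truncLaw ht.le P A hK hlam0.le]
  have hnorm : ∀ j, ‖(Real.exp (-(m j)) : ℂ) *
      ∑ l ∈ truncIdx d K N j, z j ^ l / (l ! : ℂ)‖ ≤ 1 := by
    intro j
    rw [norm_mul, Complex.norm_real, Real.norm_of_nonneg (Real.exp_pos _).le]
    calc Real.exp (-(m j)) * ‖∑ l ∈ truncIdx d K N j, z j ^ l / (l ! : ℂ)‖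
        ≤ Real.exp (-(m j)) * Real.exp (m j) := by
          gcongr; exact norm_sum_pow_div_factorial_le (hzm j) _
      _ = 1 := by rw [← Real.exp_add]; simp
  refine (norm_prod_le_norm_of_mem hnorm
    (Finset.mem_range.2 (hiK.trans (Nat.lt_succ_self K)))).trans ?_
  rw [truncIdx, if_pos hiK, norm_mul, Complex.norm_real, Real.norm_of_nonneg (Real.exp_pos _).le]
  clear_value m z
  have e1 : m i ^ (d + 1) * Real.exp (-(g * m i)) ≤ C₁ := pow_mul_exp_neg_le (d + 1) hgp (hm0 i)
  have e2 : Real.exp (-(g * m i)) ≤ C₂ * ε ^ (d + 2) := by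
    refine le_trans (Real.exp_le_exp.2 ?_) (exp_neg_div_le (d + 2) (mul_pos hgp hμ₀p) hε)
    rw [neg_le_neg_iff, mul_div_assoc]
    gcongr
  have e3 := inv_pow_le_freqWeight hρ hε hε1 hζ
  have e4 : Real.exp (-(m i)) * Real.exp (m i * S) =
      Real.exp (-(g * m i)) * Real.exp (-(g * m i)) := by
    rw [← Real.exp_add, ← Real.exp_add]
    congr 1
    rw [hg]
    ring
  have hw := (freqWeight_pos ζ).le
  have hε0 : ε ≠ 0 := hε.ne'
  calc Real.exp (-(m i)) * ‖∑ l ∈ Finset.Ioc d N, z i ^ l / (l ! : ℂ)‖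
      ≤ Real.exp (-(m i)) * (‖z i‖ ^ (d + 1) * Real.exp ‖z i‖) := by
        gcongr; exact norm_sum_Ioc_le _ _ _
    _ ≤ Real.exp (-(m i)) *
        ((m i * (2 / (θ * κ) * (ε * ‖ζ‖)⁻¹)) ^ (d + 1) * Real.exp (m i * S)) := by
        have := hm0 i
        gcongr
    _ = (m i ^ (d + 1) * Real.exp (-(g * m i))) * Real.exp (-(g * m i)) *
          (2 / (θ * κ)) ^ (d + 1) * (ε * ‖ζ‖)⁻¹ ^ (d + 1) := by
        rw [mul_pow, mul_pow]
        linear_combination (m i ^ (d + 1) * ((2 / (θ * κ)) ^ (d + 1) *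
          (ε * ‖ζ‖)⁻¹ ^ (d + 1))) * e4
    _ ≤ C₁ * (C₂ * ε ^ (d + 2)) * (2 / (θ * κ)) ^ (d + 1) *
          ((1 + 1 / ρ) ^ (d + 1) * ε⁻¹ ^ (d + 1) * freqWeight ζ) := by
        gcongr
    _ = _ := by
        rw [show d + 2 = (d + 1) + 1 by ring, pow_succ ε (d + 1), inv_pow]
        field_simp

lemma expTail_nonneg (N : ℕ) {m : ℝ} (hm : 0 ≤ m) : 0 ≤ expTail N m := by
  rw [expTail_eq_tsum]
  exact tsum_nonneg fun j => by positivity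

/-- High frequencies: the stable law. -/
lemma exists_stable_high_freq {σ₀ ρ : ℝ} (hσ₀ : 0 < σ₀) (hρ : 0 < ρ) :
    ∃ C > 0, ∀ s σ ε : ℝ, 1 / 2 ≤ s → σ₀ ≤ σ → 0 < ε → ∀ ζ : E d, ρ ≤ ε * ‖ζ‖ →
      ‖stableSymbol s σ ζ‖ ≤ C * ε * freqWeight ζ := by
  set D : ℝ := (d + 2)! * σ₀⁻¹ ^ (d + 2) * Real.exp σ₀ * Real.exp σ₀ with hD
  refine ⟨D / ρ, by positivity, fun s σ ε hs hσ hε ζ hζ => ?_⟩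
  have h := one_add_pow_mul_exp_neg_rpow_le (d + 2) hσ₀ hσ hs (norm_nonneg ζ)
  rw [norm_stableSymbol, freqWeight, ← div_eq_mul_inv, le_div_iff₀ (by positivity)]
  set y := Real.exp (-(σ * ‖ζ‖ ^ (2 * s))) with hy
  have hy0 : 0 ≤ y := (Real.exp_pos _).le
  have h1 : ρ ≤ ε * (1 + ‖ζ‖) := by nlinarith
  rw [div_mul_eq_mul_div, le_div_iff₀ hρ]
  calc y * (1 + ‖ζ‖) ^ (d + 1) * ρ ≤ y * (1 + ‖ζ‖) ^ (d + 1) * (ε * (1 + ‖ζ‖)) := by gcongr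
    _ = (1 + ‖ζ‖) ^ (d + 2) * y * ε := by ring
    _ ≤ D * ε := by gcongr

/-- The truncated compound Poisson law is close to the stable law in a weighted supremum norm on
the Fourier side. -/
lemma exists_trunc_sub_stable_le {C₀ δ t κ p : ℝ} (hC₀ : 0 < C₀) (hδ : 0 < δ) (hδ1 : δ ≤ 1)
    (ht : 0 < t) (hκ : 0 < κ) (hp : 0 < p) {K : ℕ} (hK : 0 < K) {A : ℕ → Set (E d)}
    (hA : ∀ ζ : E d, ∃ i < K, ∀ v ∈ A i, κ * ‖ζ‖ ≤ |⟪v, ζ⟫|) :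
    ∃ C > 0, ∃ B > 0, ∀ s ∈ Ioo (1 / 2 : ℝ) 1, ∀ P : Measure (E d), IsProbabilityMeasure P →
      LowFreq C₀ δ s P → (∀ i < K, p ≤ P.real (A i)) → ∀ ε ∈ Ioc (0 : ℝ) 1, ∀ N ≥ d, ∀ T,
      expTail N (1 / ε ^ (2 * s) * t) ≤ T → ∀ ζ : E d,
      ‖charFun (truncLaw t P A K (1 / ε ^ (2 * s)) ε N) ζ - stableSymbol s (agedTime s t) ζ‖ ≤
        (C * ε ^ δ + B * (T / ε ^ (d + 1))) * freqWeight ζ := by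
  set σ₀ : ℝ := t * Real.exp (-(2 * t)) with hσ₀
  have hσ₀p : 0 < σ₀ := by positivity
  obtain ⟨ρ, hρ, hρ1, hρC⟩ := exists_small_radius (mul_pos ht hC₀) hδ (half_pos hσ₀p)
  obtain ⟨C₁, hC₁, hlow⟩ := norm_compound_sub_stable_le (d := d) hC₀ hδ hδ1 ht hρ1 hρC
  obtain ⟨C₂, hC₂, hhigh⟩ := exists_trunc_high_freq ht hκ hp hρ hK hA
  obtain ⟨C₃, hC₃, hstab⟩ := exists_stable_high_freq (d := d) hσ₀p hρ
  have hθ : 0 < 1 - Real.exp (-t) := by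
    have : Real.exp (-t) < 1 := by rw [Real.exp_lt_one_iff]; linarith
    linarith
  have hKr : (0 : ℝ) < K := by exact_mod_cast hK
  set μ₀ := (1 - Real.exp (-t)) * p / K with hμ₀
  have hμ₀p : 0 < μ₀ := by positivity
  set C₄ : ℝ := (d + 2)! * (μ₀ / 2)⁻¹ ^ (d + 2) with hC₄
  refine ⟨C₁ + K * (2 ^ d * C₄) * (1 + ρ) ^ (d + 1) + C₂ + C₃, by positivity,
    (K + 1) * (1 + ρ) ^ (d + 1), by positivity, ?_⟩
  rintro s hs P hP hPlow hPA ε ⟨hε, hε1⟩ N hN T hT ζ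
  have hs0 : 0 < s := by linarith [hs.1]
  have hlam : 1 / ε ≤ 1 / ε ^ (2 * s) := by
    refine one_div_le_one_div_of_le (Real.rpow_pos_of_pos hε _) ?_
    calc ε ^ (2 * s) ≤ ε ^ (1 : ℝ) :=
          Real.rpow_le_rpow_of_exponent_ge hε hε1 (by linarith [hs.1])
      _ = ε := Real.rpow_one ε
  have hlam0 : 0 ≤ 1 / ε ^ (2 * s) := by positivity
  have hw := (freqWeight_pos ζ).le
  have hT0 : 0 ≤ T := (expTail_nonneg N (by positivity)).trans hT
  have hεδ : ε ≤ ε ^ δ := by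
    calc ε = ε ^ (1 : ℝ) := (Real.rpow_one ε).symm
      _ ≤ ε ^ δ := Real.rpow_le_rpow_of_exponent_ge hε hε1 hδ1
  have hεδ0 : 0 ≤ ε ^ δ := by positivity
  rcases le_total (ε * ‖ζ‖) ρ with hζ | hζ
  · have hmass : ∀ i < K, μ₀ / ε ≤ 1 / ε ^ (2 * s) * (jumpPiece t P A K i).real univ := by
      intro i hi
      rw [show jumpPiece t P A K i = (K : ℝ≥0∞)⁻¹ • sectorMeasure t P (A i) from if_pos hi,
        measureReal_ennreal_smul_apply, sectorMeasure_real_univ ht.le, ENNReal.toReal_inv,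
        ENNReal.toReal_natCast]
      calc μ₀ / ε = 1 / ε * ((K : ℝ)⁻¹ * ((1 - Real.exp (-t)) * p)) := by
            rw [hμ₀]; field_simp
        _ ≤ _ := by
            gcongr
            exact hPA i hi
    have h1 := norm_trunc_sub_compound_le (ε := ε) ht.le P A hK hN hlam0 hmass hT ζ
    have h2 := hlow s hs P hP hPlow ε hε ζ hζ
    rw [← charFun_compoundLaw t P A hK hlam0] at h2
    have h3 : Real.exp (-(μ₀ / ε / 2)) ≤ C₄ * ε ^ (d + 2) := by
      rw [div_right_comm]
      exact exp_neg_div_le (d + 2) (half_pos hμ₀p) hε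
    have h4 := freqWeight_ge hε hε1 hζ
    have h5 : (K + 1) * T + K * (2 ^ d * Real.exp (-(μ₀ / ε / 2))) ≤
        ((K + 1) * (1 + ρ) ^ (d + 1) * (T / ε ^ (d + 1)) +
          K * (2 ^ d * C₄) * (1 + ρ) ^ (d + 1) * ε) * freqWeight ζ := by
      calc (K + 1) * T + K * (2 ^ d * Real.exp (-(μ₀ / ε / 2)))
          ≤ (K + 1) * T + K * (2 ^ d * (C₄ * ε ^ (d + 2))) := by gcongr
        _ ≤ ((K + 1) * T + K * (2 ^ d * (C₄ * ε ^ (d + 2)))) *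
            (((1 + ρ) / ε) ^ (d + 1) * freqWeight ζ) :=
            le_mul_of_one_le_right (by positivity) h4
        _ = _ := by
            rw [div_pow, show d + 2 = (d + 1) + 1 by ring, pow_succ ε (d + 1)]
            field_simp
    calc _ ≤ _ := norm_sub_le_norm_sub_add_norm_sub _
            (charFun (compoundLaw t P A K (1 / ε ^ (2 * s)) ε) ζ) _
      _ ≤ ((K + 1) * (1 + ρ) ^ (d + 1) * (T / ε ^ (d + 1)) +
          K * (2 ^ d * C₄) * (1 + ρ) ^ (d + 1) * ε) * freqWeight ζ +
            C₁ * ε ^ δ * freqWeight ζ := add_le_add (h1.trans h5) h2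
      _ ≤ ((K + 1) * (1 + ρ) ^ (d + 1) * (T / ε ^ (d + 1)) +
          K * (2 ^ d * C₄) * (1 + ρ) ^ (d + 1) * ε ^ δ) * freqWeight ζ +
            C₁ * ε ^ δ * freqWeight ζ := by gcongr
      _ ≤ _ := by
        have : 0 ≤ (C₂ + C₃) * ε ^ δ * freqWeight ζ := by positivity
        linarith
  · have h1 := hhigh P hP hPA (1 / ε ^ (2 * s)) ε hε hε1 hlam N ζ hζ
    have h2 := hstab s (agedTime s t) ε hs.1.le
      (agedTime_mem_Icc ⟨hs0.le, hs.2.le⟩ ht.le).1 hε ζ hζ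
    calc _ ≤ _ := norm_sub_le _ _
      _ ≤ C₂ * ε * freqWeight ζ + C₃ * ε * freqWeight ζ := add_le_add h1 h2
      _ ≤ C₂ * ε ^ δ * freqWeight ζ + C₃ * ε ^ δ * freqWeight ζ := by gcongr
      _ ≤ _ := by
        have : 0 ≤ ((C₁ + K * (2 ^ d * C₄) * (1 + ρ) ^ (d + 1)) * ε ^ δ +
          (K + 1) * (1 + ρ) ^ (d + 1) * (T / ε ^ (d + 1))) * freqWeight ζ := by positivity
        linarith

/-! ### Uniform lower bounds for the compound Poisson laws -/

/-- The lower bound for small scales. -/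
lemma exists_truncLaw_lower_bound {C₀ δ t κ p : ℝ} (hC₀ : 0 < C₀) (hδ : 0 < δ) (hδ1 : δ ≤ 1)
    (ht : 0 < t) (hκ : 0 < κ) (hp : 0 < p) {K : ℕ} (hK : 0 < K) {A : ℕ → Set (E d)}
    (hA : ∀ ζ : E d, ∃ i < K, ∀ v ∈ A i, κ * ‖ζ‖ ≤ |⟪v, ζ⟫|)
    (hex : ∀ s ∈ Icc (1 / 2 : ℝ) 1, ∃ γ : Measure (E d), IsProbabilityMeasure γ ∧
      charFun γ = stableSymbol s 1) {R : ℝ} (hR : 0 ≤ R) :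
    ∃ c > 0, ∃ ε₁ > 0, ε₁ ≤ 1 ∧ ∀ ε₂ ∈ Ioc (0 : ℝ) ε₁, ∃ N : ℕ, ∀ ε ∈ Icc ε₂ ε₁,
      ∀ s ∈ Ioo (1 / 2 : ℝ) 1, ∀ P : Measure (E d), IsProbabilityMeasure P →
      LowFreq C₀ δ s P → (∀ i < K, p ≤ P.real (A i)) →
      ENNReal.ofReal c • (volume : Measure (E d)).restrict (Metric.ball 0 R) ≤
        truncLaw t P A K (1 / ε ^ (2 * s)) ε N := by
  obtain ⟨C, hC, B, hB, hmain⟩ := exists_trunc_sub_stable_le hC₀ hδ hδ1 ht hκ hp hK hA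
  have hσ₀p : 0 < t * Real.exp (-(2 * t)) := by positivity
  obtain ⟨c, hc, hdens⟩ := exists_stableDensity_lower_bound hex hσ₀p
    (agedTime_mem_Icc (s := 1) ⟨zero_le_one, le_rfl⟩ ht.le |> fun h => h.1.trans h.2) hR
  set W : ℝ := ((2 * Real.pi) ^ d)⁻¹ * ∫ ζ : E d, freqWeight ζ with hW
  have hW0 : 0 ≤ W := mul_nonneg (by positivity) (integral_nonneg fun ζ => (freqWeight_pos ζ).le)
  obtain ⟨ε₁, hε₁, hε₁1, hsmall⟩ := exists_small_radius (C := W * C + 1) (η := c / 4)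
    (by positivity) hδ (by positivity)
  refine ⟨c / 2, half_pos hc, ε₁, hε₁, hε₁1, ?_⟩
  rintro ε₂ ⟨hε₂, hε₂1⟩
  set T : ℝ := c * ε₂ ^ (d + 1) / (4 * (W * B + 1)) with hT
  have hTp : 0 < T := by positivity
  obtain ⟨N, hNd, hN⟩ := ((eventually_ge_atTop d).and
    ((tendsto_expTail (1 / ε₂ ^ 2 * t)).eventually (ge_mem_nhds hTp))).exists
  refine ⟨N, ?_⟩
  rintro ε ⟨hε2, hε1⟩ s hs P hP hPlow hPA
  have hε : 0 < ε := hε₂.trans_le hε2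
  have hs0 : 0 < s := by linarith [hs.1]
  have hT' : expTail N (1 / ε ^ (2 * s) * t) ≤ T := by
    refine le_trans (expTail_mono N (by positivity) ?_) hN
    gcongr
    calc ε₂ ^ 2 ≤ ε ^ 2 := by gcongr
      _ = ε ^ (2 : ℝ) := by norm_cast
      _ ≤ ε ^ (2 * s) :=
        Real.rpow_le_rpow_of_exponent_ge hε (hε1.trans hε₁1) (by linarith [hs.2])
  have hage := agedTime_mem_Icc (s := s) ⟨hs0.le, hs.2.le⟩ ht.le
  set F := truncLaw t P A K (1 / ε ^ (2 * s)) ε N with hF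
  set k : E d → ℂ := stableSymbol s (agedTime s t) with hk
  have hbound := hmain s hs P hP hPlow hPA ε ⟨hε, hε1.trans hε₁1⟩ N hNd T hT'
  have hki : Integrable k := integrable_stableSymbol (hσ₀p.trans_le hage.1) hs.1.le
  have hdi : Integrable fun ζ => charFun F ζ - k ζ :=
    (integrable_freqWeight.const_mul _).mono'
      ((continuous_charFun.sub (continuous_stableSymbol hs0.le _)).aestronglyMeasurable)
      (ae_of_all _ hbound)
  have hFi : Integrable (charFun F) := by
    exact (hdi.add hki).congr (ae_of_all _ fun ζ => by simp)
  have hη : ((2 * Real.pi) ^ d)⁻¹ * ∫ ζ, ‖charFun F ζ - k ζ‖ ≤ c / 2 := by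
    have h1 : ∫ ζ, ‖charFun F ζ - k ζ‖ ≤
        (C * ε ^ δ + B * (T / ε ^ (d + 1))) * ∫ ζ : E d, freqWeight ζ := by
      rw [← integral_const_mul]
      exact integral_mono hdi.norm (integrable_freqWeight.const_mul _) hbound
    have h2 : T / ε ^ (d + 1) ≤ c / (4 * (W * B + 1)) := by
      rw [hT, div_right_comm]
      gcongr
      rw [div_le_iff₀ (by positivity)]
      gcongr
    calc ((2 * Real.pi) ^ d)⁻¹ * ∫ ζ, ‖charFun F ζ - k ζ‖
        ≤ ((2 * Real.pi) ^ d)⁻¹ * ((C * ε ^ δ + B * (T / ε ^ (d + 1))) *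
            ∫ ζ : E d, freqWeight ζ) := by gcongr
      _ = W * C * ε ^ δ + W * B * (T / ε ^ (d + 1)) := by rw [hW]; ring
      _ ≤ (W * C + 1) * ε₁ ^ δ + (W * B + 1) * (c / (4 * (W * B + 1))) := by
          gcongr <;> linarith
      _ ≤ c / 4 + c / 4 := by
          gcongr
          rw [mul_div_assoc', div_le_div_iff₀ (by positivity) (by positivity)]
          linarith
      _ = c / 2 := by ring
  have := restrict_ball_le_of_charFun_close F hFi hki (A := R) (c := c)
    (fun x hx => hdens s ⟨hs.1.le, hs.2.le⟩ _ hage x (Metric.ball_subset_closedBall hx)) hη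
  rwa [show c - c / 2 = c / 2 by ring] at this

/-- Dilating space and decreasing the jump rate: with a bounded number of jumps, changing the
rate by a factor `b` costs at most a power of `b`. -/
lemma map_truncLaw_le {t B b lam : ℝ} (ht : 0 ≤ t) (hB : 0 < B) (hb : 1 ≤ b) (hlam : 0 ≤ lam)
    (P : Measure (E d)) [IsFiniteMeasure P] (A : ℕ → Set (E d)) (K : ℕ) (ε : ℝ) (N : ℕ) :
    (truncLaw t P A K (b * lam) (B⁻¹ * ε) N).map (fun x => B • x) ≤
      (ENNReal.ofReal b ^ N) ^ (K + 1) • truncLaw t P A K lam ε N := by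
  have hpiece : ∀ i, (scaledPiece t P A K (b * lam) (B⁻¹ * ε) i).map (fun x => B • x) =
      ENNReal.ofReal b • scaledPiece t P A K lam ε i := by
    intro i
    rw [scaledPiece, Measure.map_smul, Measure.map_map (by fun_prop) (by fun_prop), scaledPiece,
      smul_smul, ENNReal.ofReal_mul (by linarith)]
    congr 2
    ext x : 1
    simp only [Function.comp_apply, smul_smul]
    rw [mul_inv_cancel_left₀ hB.ne']
  rw [truncLaw, truncLaw, Measure.map_smul, convProd_map_smul]
  simp_rw [expTrunc_map_smul, hpiece]
  have h1 : convProd (fun i => expTrunc (truncIdx d K N i)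
      (ENNReal.ofReal b • scaledPiece t P A K lam ε i)) (K + 1) ≤
      (ENNReal.ofReal b ^ N) ^ (K + 1) •
        convProd (fun i => expTrunc (truncIdx d K N i) (scaledPiece t P A K lam ε i)) (K + 1) := by
    rw [← convProd_smul]
    have : ∀ i, IsFiniteMeasure (ENNReal.ofReal b ^ N •
        expTrunc (truncIdx d K N i) (scaledPiece t P A K lam ε i)) := fun i =>
      Measure.smul_finite _ (ENNReal.pow_ne_top ENNReal.ofReal_ne_top)
    exact convProd_mono (fun i => expTrunc_smul_le (by simpa using hb) ENNReal.ofReal_ne_top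
      (fun j hj => le_of_mem_truncIdx hj) _) _
  refine (smul_measure_mono _ h1).trans ?_
  rw [smul_smul, smul_smul, mul_comm]
  refine Measure.le_iff.2 fun s _ => ?_
  simp only [Measure.smul_apply, smul_eq_mul]
  gcongr
  exact le_mul_of_one_le_left hlam hb

lemma smul_restrict_ball_le_map {B : ℝ} (hB : 1 ≤ B) (R : ℝ) :
    ENNReal.ofReal ((B ^ d)⁻¹) • (volume : Measure (E d)).restrict (Metric.ball 0 R) ≤
      ((volume : Measure (E d)).restrict (Metric.ball 0 R)).map fun x => B • x := by
  have hB0 : 0 < B := by linarith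
  refine Measure.le_iff.2 fun s hs => ?_
  have hm : Measurable fun x : E d => B • x := by fun_prop
  rw [Measure.map_apply hm hs, Measure.restrict_apply (hm hs), Measure.smul_apply,
    Measure.restrict_apply hs, smul_eq_mul]
  have h := Measure.addHaar_preimage_smul (volume : Measure (E d)) hB0.ne' (s ∩ Metric.ball 0 R)
  rw [finrank_euclideanSpace_fin, abs_of_nonneg (by positivity)] at h
  rw [← h]
  refine measure_mono fun x hx => ⟨hx.1, ?_⟩
  have hx2 := hx.2
  simp only [Metric.mem_ball, dist_zero_right, norm_smul, Real.norm_of_nonneg hB0.le] at hx2 ⊢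
  nlinarith [norm_nonneg x]

/-- The compound Poisson laws of the jump process are bounded below on balls by a multiple of
Lebesgue measure, uniformly in the scale, the order and the jump law. -/
lemma exists_compoundLaw_lower_bound {C₀ δ t κ p : ℝ} (hC₀ : 0 < C₀) (hδ : 0 < δ) (hδ1 : δ ≤ 1)
    (ht : 0 < t) (hκ : 0 < κ) (hp : 0 < p) {K : ℕ} (hK : 0 < K) {A : ℕ → Set (E d)}
    (hA : ∀ ζ : E d, ∃ i < K, ∀ v ∈ A i, κ * ‖ζ‖ ≤ |⟪v, ζ⟫|)
    (hex : ∀ s ∈ Icc (1 / 2 : ℝ) 1, ∃ γ : Measure (E d), IsProbabilityMeasure γ ∧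
      charFun γ = stableSymbol s 1) {R : ℝ} (hR : 0 ≤ R) :
    ∃ c > 0, ∀ ε ∈ Ioc (0 : ℝ) 1, ∀ s ∈ Ioo (1 / 2 : ℝ) 1, ∀ P : Measure (E d),
      IsProbabilityMeasure P → LowFreq C₀ δ s P → (∀ i < K, p ≤ P.real (A i)) →
      ENNReal.ofReal c • (volume : Measure (E d)).restrict (Metric.ball 0 R) ≤
        compoundLaw t P A K (1 / ε ^ (2 * s)) ε := by
  obtain ⟨c, hc, ε₁, hε₁, hε₁1, hreg⟩ :=
    exists_truncLaw_lower_bound hC₀ hδ hδ1 ht hκ hp hK hA hex hR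
  obtain ⟨N, hN⟩ := hreg (ε₁ * ε₁) ⟨by positivity, mul_le_of_le_one_left hε₁.le hε₁1⟩
  set B : ℝ := ε₁⁻¹ with hB
  have hB1 : 1 ≤ B := (one_le_inv₀ hε₁).2 hε₁1
  have hB0 : 0 < B := by positivity
  set M : ℝ := ((B ^ 2) ^ N) ^ (K + 1) with hM
  have hMp : 0 < M := by positivity
  refine ⟨min c (M⁻¹ * (c * (B ^ d)⁻¹)), by positivity, ?_⟩
  rintro ε ⟨hε, hε1⟩ s hs P hP hPlow hPA
  have hmono : ∀ {x y : ℝ}, x ≤ y → ∀ ν : Measure (E d),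
      ENNReal.ofReal x • ν ≤ ENNReal.ofReal y • ν := fun h ν => Measure.le_iff.2 fun u _ => by
    simp only [Measure.smul_apply, smul_eq_mul]
    gcongr
  rcases le_total ε ε₁ with hle | hge
  · obtain ⟨N', hN'⟩ := hreg ε ⟨hε, hle⟩
    exact ((hmono (min_le_left _ _) _).trans
      (hN' ε ⟨le_rfl, hle⟩ s hs P hP hPlow hPA)).trans (truncLaw_le_compoundLaw _ _ _ _ _ _ _)
  · have h1 := hN (B⁻¹ * ε) ⟨by rw [hB, inv_inv]; gcongr, by
      rw [hB, inv_inv]; exact mul_le_of_le_one_right hε₁.le hε1⟩ s hs P hP hPlow hPA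
    have hlam0 : 0 ≤ 1 / ε ^ (2 * s) := by positivity
    have hb1 : 1 ≤ B ^ (2 * s) := Real.one_le_rpow hB1 (by linarith [hs.1])
    have hb2 : B ^ (2 * s) ≤ B ^ 2 := by
      calc B ^ (2 * s) ≤ B ^ (2 : ℝ) :=
            Real.rpow_le_rpow_of_exponent_le hB1 (by linarith [hs.2])
        _ = B ^ 2 := by norm_cast
    have hrate : 1 / (B⁻¹ * ε) ^ (2 * s) = B ^ (2 * s) * (1 / ε ^ (2 * s)) := by
      rw [Real.mul_rpow (by positivity) hε.le, Real.inv_rpow hB0.le]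
      field_simp
    rw [hrate] at h1
    have h2 := map_truncLaw_le ht.le hB0 hb1 hlam0 P A K ε N
    have h3 := Measure.map_mono h1 (f := fun x : E d => B • x) (by fun_prop)
    rw [Measure.map_smul] at h3
    have h4 : ENNReal.ofReal (c * (B ^ d)⁻¹) •
        (volume : Measure (E d)).restrict (Metric.ball 0 R) ≤
        ENNReal.ofReal M • truncLaw t P A K (1 / ε ^ (2 * s)) ε N := by
      rw [ENNReal.ofReal_mul hc.le, mul_smul]
      refine (smul_measure_mono _ (smul_restrict_ball_le_map hB1 R)).trans
        ((h3.trans h2).trans ?_)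
      refine Measure.le_iff.2 fun u _ => ?_
      simp only [Measure.smul_apply, smul_eq_mul]
      gcongr
      rw [hM, ← ENNReal.ofReal_pow (by positivity), ← ENNReal.ofReal_pow (by positivity)]
      gcongr
    have h5 := smul_measure_mono (ENNReal.ofReal M⁻¹) h4
    rw [smul_smul, smul_smul, ← ENNReal.ofReal_mul (by positivity),
      ← ENNReal.ofReal_mul (by positivity), inv_mul_cancel₀ hMp.ne', ENNReal.ofReal_one,
      one_smul] at h5
    exact ((hmono (min_le_right _ _) _).trans h5).trans (truncLaw_le_compoundLaw _ _ _ _ _ _ _)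

/-! ### Fourier transform of the mild equation -/

lemma fourierT_congr_ae {f g : E d → ℝ} (h : f =ᵐ[volume] g) (ζ : E d) :
    fourierT f ζ = fourierT g ζ := by
  refine integral_congr_ae ?_
  filter_upwards [h] with x hx
  rw [hx]

lemma norm_exp_neg_I_mul (a : ℝ) : ‖Complex.exp (-Complex.I * (a : ℂ))‖ = 1 := by
  rw [Complex.norm_exp]
  simp

lemma integrable_fourier_integrand {f : E d → ℝ} (hf : Integrable f) (ζ : E d) :
    Integrable fun x => Complex.exp (-Complex.I * ((inner ℝ x ζ : ℝ) : ℂ)) * (f x : ℂ) :=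
  hf.ofReal.bdd_mul (c := 1) (Continuous.aestronglyMeasurable (by fun_prop))
    (ae_of_all _ fun x => (norm_exp_neg_I_mul _).le)

lemma fourierT_const_mul (c : ℝ) (f : E d → ℝ) (ζ : E d) :
    fourierT (fun x => c * f x) ζ = c * fourierT f ζ := by
  rw [fourierT, fourierT, ← integral_const_mul]
  refine integral_congr_ae (ae_of_all _ fun x => ?_)
  push_cast
  ring

lemma fourierT_add {f g : E d → ℝ} (hf : Integrable f) (hg : Integrable g) (ζ : E d) :
    fourierT (fun x => f x + g x) ζ = fourierT f ζ + fourierT g ζ := by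
  rw [fourierT, fourierT, fourierT,
    ← integral_add (integrable_fourier_integrand hf ζ) (integrable_fourier_integrand hg ζ)]
  refine integral_congr_ae (ae_of_all _ fun x => ?_)
  push_cast
  ring

lemma norm_fourierT_le (f : E d → ℝ) (ζ : E d) : ‖fourierT f ζ‖ ≤ ∫ x, ‖f x‖ := by
  refine (norm_integral_le_integral_norm _).trans (le_of_eq ?_)
  refine integral_congr_ae (ae_of_all _ fun x => ?_)
  simp only [norm_mul, norm_exp_neg_I_mul, one_mul, Complex.norm_real]

lemma fourierT_comp_smul {a : ℝ} (ha : 0 < a) (f : E d → ℝ) (ζ : E d) :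
    fourierT (fun x => f (a • x)) ζ = ((a ^ d)⁻¹ : ℝ) * fourierT f (a⁻¹ • ζ) := by
  have h := Measure.integral_comp_smul (volume : Measure (E d))
    (fun y => Complex.exp (-Complex.I * ((inner ℝ y (a⁻¹ • ζ) : ℝ) : ℂ)) * (f y : ℂ)) a
  rw [finrank_euclideanSpace_fin, abs_of_nonneg (by positivity), Complex.real_smul] at h
  rw [fourierT, fourierT, ← h]
  refine integral_congr_ae (ae_of_all _ fun x => ?_)
  simp only [inner_smul_left, inner_smul_right, conj_trivial]
  rw [inv_mul_cancel_left₀ ha.ne']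

lemma fourierT_scaledKernel {ε : ℝ} (hε : 0 < ε) (J : E d → ℝ) (ζ : E d) :
    fourierT (scaledKernel ε J) ζ = fourierT J (ε • ζ) := by
  unfold scaledKernel
  rw [fourierT_const_mul, fourierT_comp_smul (inv_pos.2 hε), inv_inv, ← mul_assoc,
    ← Complex.ofReal_mul, inv_pow, inv_inv, inv_mul_cancel₀ (by positivity), Complex.ofReal_one,
    one_mul]

lemma integrable_scaledKernel {ε : ℝ} (hε : 0 < ε) {J : E d → ℝ} (hJ : Integrable J) :
    Integrable (scaledKernel ε J) :=
  (hJ.comp_smul (inv_pos.2 hε).ne').const_mul _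

lemma integrable_transport (ε s r : ℝ) {f : E d → ℝ} (hf : Integrable f) :
    Integrable (transport ε s r f) :=
  (hf.comp_smul (Real.exp_pos r).ne').const_mul _

lemma fourierT_transport (ε s r : ℝ) (f : E d → ℝ) (ζ : E d) :
    fourierT (transport ε s r f) ζ =
      (Real.exp (-(1 / ε ^ (2 * s) * r)) : ℝ) * fourierT f (Real.exp (-r) • ζ) := by
  unfold transport
  rw [fourierT_const_mul, fourierT_comp_smul (Real.exp_pos r), ← mul_assoc, ← Complex.ofReal_mul,
    ← Real.exp_neg, ← Real.exp_nat_mul, ← Real.exp_neg, ← Real.exp_add]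
  congr 3
  ring_nf

lemma fourierT_conv {f g : E d → ℝ} (hf : Integrable f) (hg : Integrable g) (ζ : E d) :
    fourierT (conv f g) ζ = fourierT f ζ * fourierT g ζ := by
  have hi : Integrable (fun p : E d × E d => f p.2 * g (p.1 - p.2)) (volume.prod volume) :=
    hf.convolution_integrand (ContinuousLinearMap.mul ℝ ℝ) hg
  have hi2 : Integrable (fun p : E d × E d => Complex.exp (-Complex.I * ((inner ℝ p.1 ζ : ℝ) : ℂ)) *
      ((f p.2 * g (p.1 - p.2) : ℝ) : ℂ)) (volume.prod volume) :=
    hi.ofReal.bdd_mul (c := 1) (Continuous.aestronglyMeasurable (by fun_prop))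
      (ae_of_all _ fun x => (norm_exp_neg_I_mul _).le)
  calc fourierT (conv f g) ζ
      = ∫ x, ∫ y, Complex.exp (-Complex.I * ((inner ℝ x ζ : ℝ) : ℂ)) *
          ((f y * g (x - y) : ℝ) : ℂ) := by
        refine integral_congr_ae (ae_of_all _ fun x => ?_)
        simp only [conv]
        rw [integral_const_mul, integral_complex_ofReal]
    _ = ∫ y, ∫ x, Complex.exp (-Complex.I * ((inner ℝ x ζ : ℝ) : ℂ)) *
          ((f y * g (x - y) : ℝ) : ℂ) := integral_integral_swap hi2
    _ = ∫ y, Complex.exp (-Complex.I * ((inner ℝ y ζ : ℝ) : ℂ)) * (f y : ℂ) * fourierT g ζ := by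
        refine integral_congr_ae (ae_of_all _ fun y => ?_)
        simp only
        rw [fourierT, ← integral_const_mul, ← integral_add_right_eq_self _ y]
        refine integral_congr_ae (ae_of_all _ fun x => ?_)
        simp only [inner_add_left, add_sub_cancel_right]
        push_cast
        rw [mul_add, Complex.exp_add]
        ring
    _ = _ := by
        rw [integral_mul_const]
        rfl

lemma volume_le_weightMeasure {k : ℝ} (hk : 0 ≤ k) : (volume : Measure (E d)) ≤ weightMeasure d k := by
  rw [weightMeasure]
  conv_lhs => rw [← withDensity_one (μ := (volume : Measure (E d)))]
  refine withDensity_mono (ae_of_all _ fun x => ?_)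
  rw [Pi.one_apply, ENNReal.one_le_ofReal]
  exact Real.one_le_rpow (by nlinarith [norm_nonneg x]) (by linarith)

lemma integrable_L1k {k : ℝ} (hk : 0 ≤ k) (f : L1k d k) : Integrable (f : E d → ℝ) :=
  (L1.integrable_coeFn f).mono_measure (volume_le_weightMeasure hk)

/-- The Fourier transform at a fixed frequency, as a continuous linear functional on the weighted
Lebesgue space. -/
def fourierCLM {k : ℝ} (hk : 0 ≤ k) (ζ : E d) : L1k d k →L[ℝ] ℂ :=
  LinearMap.mkContinuous
    { toFun := fun f => fourierT f ζ
      map_add' := fun f g => by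
        rw [← fourierT_add (integrable_L1k hk f) (integrable_L1k hk g)]
        exact fourierT_congr_ae
          ((Measure.absolutelyContinuous_of_le (volume_le_weightMeasure hk)) (Lp.coeFn_add f g)) ζ
      map_smul' := fun c f => by
        rw [RingHom.id_apply, Complex.real_smul, ← fourierT_const_mul]
        exact fourierT_congr_ae
          ((Measure.absolutelyContinuous_of_le (volume_le_weightMeasure hk))
            (Lp.coeFn_smul c f)) ζ }
    1 fun f => by
      rw [one_mul, L1.norm_eq_integral_norm]
      exact (norm_fourierT_le f ζ).trans (integral_mono_measure (volume_le_weightMeasure hk)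
        (ae_of_all _ fun _ => norm_nonneg _) (L1.integrable_coeFn f).norm)

lemma fourierCLM_apply {k : ℝ} (hk : 0 ≤ k) (ζ : E d) (f : L1k d k) :
    fourierCLM hk ζ f = fourierT f ζ := rfl

/-- A scalar linear Volterra equation is solved by an exponential. -/
lemma volterra_eq_exp {a V : ℝ → ℂ} {v₀ lam : ℂ} {T : ℝ} (hT : 0 ≤ T) (ha : Continuous a)
    (hi : IntervalIntegrable (fun τ => a τ * V τ) volume 0 T)
    (hV : ∀ t ∈ Icc 0 T, V t = v₀ + lam * ∫ τ in (0 : ℝ)..t, a τ * V τ) :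
    V T = v₀ * Complex.exp (lam * ∫ τ in (0 : ℝ)..T, a τ) := by
  have hVc : ContinuousOn V (Icc 0 T) := by
    have h1 := intervalIntegral.continuousOn_primitive_interval (μ := volume) (a := (0 : ℝ)) (b := T)
      (f := fun τ => a τ * V τ) (by
        rw [uIcc_of_le hT]
        exact (intervalIntegrable_iff_integrableOn_Icc_of_le hT).1 hi)
    rw [uIcc_of_le hT] at h1
    exact (continuousOn_const.add (continuousOn_const.mul h1)).congr hV
  -- extend `V` to a continuous function on the line
  set W : ℝ → ℂ := fun τ => V (projIcc 0 T hT τ) with hW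
  have hWc : Continuous W :=
    (continuousOn_iff_continuous_domRestrict.1 hVc).comp continuous_projIcc
  have hWV : ∀ τ ∈ Icc 0 T, W τ = V τ := fun τ hτ => by
    simp only [hW, projIcc_of_mem hT hτ]
  set X : ℝ → ℂ := fun t => v₀ + lam * ∫ τ in (0 : ℝ)..t, a τ * W τ with hX
  have hXV : ∀ t ∈ Icc 0 T, X t = V t := fun t ht => by
    rw [hV t ht, hX]
    simp only
    congr 2
    refine intervalIntegral.integral_congr fun τ hτ => ?_
    rw [uIcc_of_le ht.1] at hτ
    simp only [hWV τ ⟨hτ.1, hτ.2.trans ht.2⟩]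
  have hXd : ∀ t, HasDerivAt X (lam * (a t * W t)) t := fun t =>
    (((ha.mul hWc).integral_hasStrictDerivAt 0 t).hasDerivAt.const_mul lam).const_add v₀
  have hAd : ∀ t, HasDerivAt (fun t => ∫ τ in (0 : ℝ)..t, a τ) (a t) t := fun t =>
    (ha.integral_hasStrictDerivAt 0 t).hasDerivAt
  set Z : ℝ → ℂ := fun t => X t * Complex.exp (-(lam * ∫ τ in (0 : ℝ)..t, a τ)) with hZ
  have hZd : ∀ t, HasDerivAt Z (lam * (a t * W t) *
      Complex.exp (-(lam * ∫ τ in (0 : ℝ)..t, a τ)) +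
      X t * (Complex.exp (-(lam * ∫ τ in (0 : ℝ)..t, a τ)) * -(lam * a t))) t := fun t =>
    (hXd t).mul (((hAd t).const_mul lam).neg.cexp)
  have hconst := constant_of_has_deriv_right_zero (f := Z) (a := 0) (b := T)
    (fun t _ => (hZd t).continuousAt.continuousWithinAt) (fun t ht => by
      have h := hZd t
      have ht' : t ∈ Icc 0 T := ⟨ht.1, ht.2.le⟩
      rw [hXV t ht', hWV t ht', show lam * (a t * V t) *
        Complex.exp (-(lam * ∫ τ in (0 : ℝ)..t, a τ)) +
        V t * (Complex.exp (-(lam * ∫ τ in (0 : ℝ)..t, a τ)) * -(lam * a t)) = 0 by ring] at h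
      exact h.hasDerivWithinAt) T ⟨hT, le_rfl⟩
  simp only [hZ, hXV T ⟨hT, le_rfl⟩, Complex.exp_neg] at hconst
  simp only [hX, intervalIntegral.integral_same, mul_zero, add_zero, Complex.exp_zero, inv_one,
    mul_one] at hconst
  rw [← hconst, inv_mul_cancel_right₀ (Complex.exp_ne_zero _)]

/-- The Fourier transform of the mild equation at a fixed frequency. -/
lemma IsMildSolution.fourierT_eq {k ε s t : ℝ} (hk : 0 ≤ k) (hε : 0 < ε) {J : E d → ℝ}
    (hJ : Integrable J) {u₀ : L1k d k} {u : ℝ → L1k d k} (h : IsMildSolution ε s J u₀ u)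
    (ht : 0 ≤ t) (ζ : E d) :
    ∃ G : ℝ → ℂ, IntervalIntegrable G volume 0 t ∧
      (∀ τ ∈ Icc 0 t, G τ = (Real.exp (-(1 / ε ^ (2 * s) * (t - τ))) : ℝ) *
        (fourierT J (ε • Real.exp (-(t - τ)) • ζ) * fourierT (u τ) (Real.exp (-(t - τ)) • ζ))) ∧
      fourierT (u t) ζ = (Real.exp (-(1 / ε ^ (2 * s) * t)) : ℝ) *
        fourierT u₀ (Real.exp (-t) • ζ) + (1 / ε ^ (2 * s) : ℝ) * ∫ τ in (0 : ℝ)..t, G τ := by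
  obtain ⟨g, hg, hgi, hgu⟩ := h.mild t ht
  refine ⟨fun τ => fourierCLM hk ζ (g τ), ?_, fun τ hτ => ?_, ?_⟩
  · exact ⟨(fourierCLM hk ζ).integrable_comp hgi.1, (fourierCLM hk ζ).integrable_comp hgi.2⟩
  · simp only
    rw [fourierCLM_apply, fourierT_congr_ae (hg τ hτ), fourierT_transport,
      fourierT_conv (integrable_scaledKernel hε hJ) (integrable_L1k hk _),
      fourierT_scaledKernel hε]
  · rw [(fourierCLM hk ζ).intervalIntegral_comp_comm hgi, fourierCLM_apply,
      fourierT_congr_ae hgu, fourierT_add (integrable_transport _ _ _ (integrable_L1k hk _))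
      ((integrable_L1k hk _).const_mul _), fourierT_const_mul, fourierT_transport]

/-- The characteristic function of a mild solution, by integration along characteristics. -/
lemma IsMildSolution.fourierT_eq_exp {k ε s t : ℝ} (hk : 0 ≤ k) (hε : 0 < ε) {J : E d → ℝ}
    (hJ : IsProbDensity J) {u₀ : L1k d k} {u : ℝ → L1k d k} (h : IsMildSolution ε s J u₀ u)
    (ht : 0 ≤ t) (ζ : E d) :
    fourierT (u t) ζ = (Real.exp (-(1 / ε ^ (2 * s) * t)) : ℝ) *
      (fourierT u₀ (Real.exp (-t) • ζ) * Complex.exp ((1 / ε ^ (2 * s) : ℝ) *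
        ∫ r in (0 : ℝ)..t, fourierT J (ε • Real.exp (-r) • ζ))) := by
  have := isProbabilityMeasure_lawOf hJ
  set lam : ℝ := 1 / ε ^ (2 * s) with hlam
  have hJc : Continuous (fourierT J) := by
    have : fourierT J = fun ζ => charFun (lawOf J) (-ζ) := by
      ext ζ
      rw [charFun_lawOf hJ.integrable hJ.nonneg, neg_neg]
    rw [this]
    exact continuous_charFun.comp continuous_neg
  set a : ℝ → ℂ := fun τ => fourierT J (ε • Real.exp (-(t - τ)) • ζ) with ha
  set V : ℝ → ℂ := fun τ => (Real.exp (lam * τ) : ℝ) * fourierT (u τ) (Real.exp (-(t - τ)) • ζ)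
    with hV
  have key : ∀ t' ∈ Icc 0 t, IntervalIntegrable (fun τ => a τ * V τ) volume 0 t' ∧
      V t' = fourierT u₀ (Real.exp (-t) • ζ) + lam * ∫ τ in (0 : ℝ)..t', a τ * V τ := by
    intro t' ht'
    obtain ⟨G, hGi, hG, hGu⟩ := h.fourierT_eq hk hε hJ.integrable ht'.1 (Real.exp (-(t - t')) • ζ)
    have hsm : ∀ τ, Real.exp (-(t' - τ)) • Real.exp (-(t - t')) • ζ = Real.exp (-(t - τ)) • ζ := by
      intro τ
      rw [smul_smul, ← Real.exp_add]
      ring_nf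
    have hGe : ∀ τ ∈ Icc 0 t', a τ * V τ = (Real.exp (lam * t') : ℝ) * G τ := by
      intro τ hτ
      rw [hG τ hτ, hsm, ← hlam]
      simp only [ha, hV]
      rw [show lam * τ = lam * t' + -(lam * (t' - τ)) by ring, Real.exp_add, Complex.ofReal_mul]
      ring
    refine ⟨(hGi.const_mul ((Real.exp (lam * t') : ℝ) : ℂ)).congr fun τ hτ => ?_, ?_⟩
    · rw [uIoc_of_le ht'.1] at hτ
      exact (hGe τ ⟨hτ.1.le, hτ.2⟩).symm
    · rw [intervalIntegral.integral_congr (g := fun τ => (Real.exp (lam * t') : ℝ) * G τ)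
        fun τ hτ => hGe τ (by rwa [uIcc_of_le ht'.1] at hτ), intervalIntegral.integral_const_mul]
      have h0 := hsm 0
      rw [sub_zero, sub_zero] at h0
      simp only [hV]
      rw [hGu, h0, mul_add, ← mul_assoc, ← Complex.ofReal_mul, ← Real.exp_add, add_neg_cancel,
        Real.exp_zero, Complex.ofReal_one, one_mul]
      ring
  have hsol := volterra_eq_exp ht (a := a) (V := V) (by fun_prop) (key t ⟨ht, le_rfl⟩).1
    fun t' ht' => (key t' ht').2
  have hint : ∫ τ in (0 : ℝ)..t, a τ = ∫ r in (0 : ℝ)..t, fourierT J (ε • Real.exp (-r) • ζ) := by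
    rw [ha, intervalIntegral.integral_comp_sub_left
      (fun r => fourierT J (ε • Real.exp (-r) • ζ)) t, sub_self, sub_zero]
  rw [hint] at hsol
  rw [← hsol, hV]
  simp only
  rw [← mul_assoc, ← Complex.ofReal_mul, ← Real.exp_add, neg_add_cancel, Real.exp_zero,
    Complex.ofReal_one, one_mul, sub_self, neg_zero, Real.exp_zero, one_smul]

/-- A mild solution is the law of the sum of the contracted initial position and an independent
compound Poisson variable. -/
lemma IsMildSolution.fourierT_eq_charFun {k ε s t : ℝ} (hk : 0 ≤ k) (hε : 0 < ε) {J : E d → ℝ}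
    (hJ : IsProbDensity J) {u₀ : L1k d k} {u : ℝ → L1k d k} (hu₀ : IsProbDensity (u₀ : E d → ℝ))
    (h : IsMildSolution ε s J u₀ u) (ht : 0 ≤ t) (A : ℕ → Set (E d)) {K : ℕ} (hK : 0 < K)
    (ζ : E d) :
    fourierT (u t) ζ = charFun (Measure.conv (compoundLaw t (lawOf J) A K (1 / ε ^ (2 * s)) ε)
      ((lawOf u₀).map fun x => Real.exp (-t) • x)) (-ζ) := by
  have := isProbabilityMeasure_lawOf hJ
  have := isProbabilityMeasure_lawOf hu₀
  rw [h.fourierT_eq_exp hk hε hJ ht, charFun_conv, charFun_compoundLaw t _ A hK (by positivity),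
    charFun_map_smul, charFun_lawOf hu₀.integrable hu₀.nonneg, smul_neg, smul_neg, neg_neg,
    charFun_jumpMeasure ht]
  have hi : ∀ r : ℝ, charFun (lawOf J) (Real.exp (-r) • -(ε • ζ)) =
      fourierT J (ε • Real.exp (-r) • ζ) := by
    intro r
    rw [charFun_lawOf hJ.integrable hJ.nonneg, smul_neg, neg_neg, smul_comm]
  simp_rw [hi]
  rw [mul_sub, Complex.exp_sub, ← Complex.ofReal_mul, ← Complex.ofReal_exp, Real.exp_neg]
  push_cast
  field_simp

/-! ### Density lower bounds read off the Fourier transform -/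

/-- A function with the Fourier transform of a finite measure inherits the density lower bounds
of that measure. -/
lemma ae_le_of_fourierT_eq_charFun {f : E d → ℝ} (hf : Integrable f) {m : Measure (E d)}
    [IsFiniteMeasure m] (h : ∀ ζ, fourierT f ζ = charFun m (-ζ)) {c R : ℝ}
    (hc : ENNReal.ofReal c • (volume : Measure (E d)).restrict (Metric.ball 0 R) ≤ m) :
    ∀ᵐ x, x ∈ Metric.ball (0 : E d) R → c ≤ f x := by
  set fp : E d → ℝ := fun x => max (f x) 0 with hfp
  set fm : E d → ℝ := fun x => max (-f x) 0 with hfm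
  have hpi : Integrable fp := hf.pos_part
  have hmi : Integrable fm := hf.neg_part
  have hp0 : ∀ x, 0 ≤ fp x := fun x => le_max_right _ _
  have hm0 : ∀ x, 0 ≤ fm x := fun x => le_max_right _ _
  have hfin : ∀ {g : E d → ℝ}, Integrable g → (∀ x, 0 ≤ g x) → IsFiniteMeasure (lawOf g) :=
    fun hg _ => isFiniteMeasure_withDensity_ofReal hg.2
  have := hfin hpi hp0
  have := hfin hmi hm0
  have hsub : ∀ x, f x + fm x = fp x := fun x => by
    simp only [hfp, hfm]
    rcases le_total (f x) 0 with hx | hx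
    · rw [max_eq_left (neg_nonneg.2 hx), max_eq_right hx, add_neg_cancel]
    · rw [max_eq_right (neg_nonpos.2 hx), max_eq_left hx, add_zero]
  have hmeas : lawOf fp = m + lawOf fm := by
    refine Measure.ext_of_charFun (funext fun ζ => ?_)
    rw [charFun_add_measure, charFun_lawOf hpi (ae_of_all _ hp0),
      charFun_lawOf hmi (ae_of_all _ hm0), ← fourierT_congr_ae (ae_of_all _ hsub),
      fourierT_add hf hmi, h, neg_neg]
  have hreal : ∀ s : Set (E d), MeasurableSet s → m.real s = ∫ x in s, f x := by
    intro s hs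
    have hlaw : ∀ {g : E d → ℝ}, Integrable g → (∀ x, 0 ≤ g x) →
        (lawOf g).real s = ∫ x in s, g x := by
      intro g hg h0
      rw [measureReal_def, lawOf, withDensity_apply _ hs,
        ← ofReal_integral_eq_lintegral_ofReal hg.integrableOn (ae_of_all _ h0),
        ENNReal.toReal_ofReal (integral_nonneg h0)]
    have h1 : (lawOf fp).real s = m.real s + (lawOf fm).real s := by
      rw [hmeas, measureReal_add_apply]
    rw [hlaw hpi hp0, hlaw hmi hm0, ← integral_congr_ae (ae_of_all _ hsub),
      integral_add hf.integrableOn hmi.integrableOn] at h1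
    linarith
  have hball : ∀ᵐ x ∂(volume.restrict (Metric.ball (0 : E d) R)), c ≤ f x := by
    refine ae_le_of_forall_setIntegral_le (f := fun _ => c)
      (integrableOn_const measure_ball_lt_top.ne) hf.integrableOn
      fun s hs _ => ?_
    rw [Measure.restrict_restrict hs, ← hreal _ (hs.inter Metric.isOpen_ball.measurableSet),
      setIntegral_const, smul_eq_mul]
    rcases le_total c 0 with hc0 | hc0
    · exact (mul_nonpos_of_nonneg_of_nonpos measureReal_nonneg hc0).trans measureReal_nonneg
    · have h2 := ENNReal.toReal_mono (measure_ne_top m _) (hc (s ∩ Metric.ball 0 R))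
      rw [Measure.smul_apply, Measure.restrict_apply (hs.inter Metric.isOpen_ball.measurableSet),
        inter_assoc, inter_self, smul_eq_mul, ENNReal.toReal_mul, ENNReal.toReal_ofReal hc0,
        mul_comm] at h2
      exact h2
  exact (ae_restrict_iff' Metric.isOpen_ball.measurableSet).1 hball

end FracFP

end

theorem theorem3p2 (d : ℕ) (hd : 0 < d)
    (J : ℝ → FracFP.E d → ℝ) (hJ : FracFP.UniformKernelFamily J)
    (t R₁ R₂ : ℝ) (ht : 0 < t) (hR₁ : 0 < R₁) (hR₂ : 0 < R₂) :
    ∃ α : ℝ, 0 < α ∧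
      ∀ ε ∈ Set.Ioc (0 : ℝ) 1, ∀ s ∈ Set.Ioo (1 / 2 : ℝ) 1,
      ∀ k ∈ Set.Ico (0 : ℝ) (2 * s),
      ∀ (u₀ : FracFP.L1k d k) (u : ℝ → FracFP.L1k d k),
        FracFP.IsProbDensity (u₀ : FracFP.E d → ℝ) →
        FracFP.IsMildSolution ε s (J s) u₀ u →
        ∀ᵐ x : FracFP.E d, x ∈ Metric.ball (0 : FracFP.E d) R₁ →
          α * (∫ y in Metric.ball (0 : FracFP.E d) R₂, u₀ y) ≤ u t x := by
  obtain ⟨δ', hδ', C₀, hC₀, hlow'⟩ := hJ.low_freq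
  -- the rate in the low frequency expansion may be decreased
  set δ := min δ' 1 with hδdef
  have hδ : 0 < δ := lt_min hδ' one_pos
  have hlow : ∀ s ∈ Ioo (1 / 2 : ℝ) 1, FracFP.LowFreq C₀ δ s (FracFP.lawOf (J s)) := by
    intro s hs ζ hζ
    have h1 := hlow' s hs (-ζ) (by rwa [norm_neg])
    rw [norm_neg, ← FracFP.charFun_lawOf (hJ.prob s hs).integrable (hJ.prob s hs).nonneg] at h1
    refine h1.trans ?_
    have h2 : 0 < 2 * s + δ := by linarith [hs.1]
    gcongr ?_ * ?_
    rcases eq_or_ne ζ 0 with rfl | hζ0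
    · rw [norm_zero, Real.zero_rpow h2.ne', Real.zero_rpow (by linarith [hs.1])]
    · exact Real.rpow_le_rpow_of_exponent_ge (norm_pos_iff.2 hζ0) hζ
        (by linarith [min_le_left δ' 1])
  obtain ⟨κ, hκ, p, hp, K, hK, A, hAκ, hAp⟩ := FracFP.exists_sectors hd hC₀ hδ
  have hex : ∀ s ∈ Icc (1 / 2 : ℝ) 1, ∃ γ : Measure (FracFP.E d), IsProbabilityMeasure γ ∧
      charFun γ = FracFP.stableSymbol s 1 :=
    fun _ => FracFP.exists_stableLaw_Icc fun s hs => by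
      have := FracFP.isProbabilityMeasure_lawOf (hJ.prob s hs)
      exact FracFP.exists_stableLaw_of_low_freq hδ (by linarith [hs.1]) (hlow s hs)
  obtain ⟨c, hc, hbound⟩ := FracFP.exists_compoundLaw_lower_bound hC₀ hδ (min_le_right _ _) ht hκ
    hp hK hAκ hex (R := R₁ + R₂) (by positivity)
  refine ⟨c, hc, fun ε hε s hs k hk u₀ u hu₀ hu => ?_⟩
  have hPJ := FracFP.isProbabilityMeasure_lawOf (hJ.prob s hs)
  have hPu := FracFP.isProbabilityMeasure_lawOf hu₀
  have hcomp := hbound ε hε s hs _ hPJ (hlow s hs) (hAp s hs _ hPJ (hlow s hs))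
  refine FracFP.ae_le_of_fourierT_eq_charFun (FracFP.integrable_L1k hk.1 _)
    (hu.fourierT_eq_charFun hk.1 hε.1 (hJ.prob s hs) hu₀ ht.le A hK) ?_
  set ν := (FracFP.lawOf u₀).map fun x => Real.exp (-t) • x with hν
  -- the contraction moves mass into the ball of radius `R₂`
  have hmass : ENNReal.ofReal (∫ y in Metric.ball (0 : FracFP.E d) R₂, u₀ y) ≤
      ν (Metric.ball 0 R₂) := by
    rw [hν, Measure.map_apply (by fun_prop) Metric.isOpen_ball.measurableSet,
      ofReal_integral_eq_lintegral_ofReal hu₀.integrable.integrableOn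
        (ae_restrict_of_ae hu₀.nonneg), ← withDensity_apply _ Metric.isOpen_ball.measurableSet]
    refine measure_mono fun x hx => ?_
    have he : Real.exp (-t) ≤ 1 := Real.exp_le_one_iff.2 (by linarith)
    simp only [mem_preimage, Metric.mem_ball, dist_zero_right, norm_smul,
      Real.norm_of_nonneg (Real.exp_pos _).le] at hx ⊢
    exact (mul_le_of_le_one_left (norm_nonneg x) he).trans_lt hx
  rw [ENNReal.ofReal_mul hc.le, mul_smul]
  refine (FracFP.smul_measure_mono _ (Measure.le_iff.2 fun S _ => ?_)).trans
    ((FracFP.smul_measure_mono _ (FracFP.restrict_ball_le_conv ν R₁ R₂)).trans ?_)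
  · simp only [Measure.smul_apply, smul_eq_mul]
    gcongr
  · rw [← Measure.conv_smul_left]
    exact FracFP.conv_mono hcomp le_rfl
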